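/- **Notation.** Let $V$ be an $n$-dimensional $\mathbb{Q}$-vector space with dual $V^*$; for $R=\mathbb{R}$ or $R=\mathbb{A}_f$ (the finite adeles of $\mathbb{Q}$) put $V(R)=V\otimes R$. Let $e(z)=e^{2\pi i z}$, and let $\psi:\mathbb{A}_f\to\mathbb{C}^\times$ be $\psi(a)=e(m)$ for any $m\in\mathbb{Q}$ with $a-m\in\hat{\mathbb{Z}}$. Fix an isomorphism $\rho:V(\mathbb{R})\to\mathbb{R}^n$ of real vector spaces, and let $\rho^*:V^*(\mathbb{R})\to\mathbb{R}^n$ be the dual isomorphism, $\langle t,v\rangle=\sum_\mu\rho^*_\mu(t)\rho_\mu(v)$. Let $dv_f$ be the Haar measure on $V(\mathbb{A}_f)$ such that $V(\mathbb{A})/V$ has volume $1$ for the product of $dv_f$ with the pull-back by $\rho$ of Lebesgue measure. For a Schwartz–Bruhat function $\Phi$ on $V(\mathbb{A}_f)$ put $\hat\Phi(t)=\int_{V(\mathbb{A}_f)}\Phi(v)\psi(\langle v,t\rangle)\,dv_f$, a function on $V^*(\mathbb{A}_f)$. **Fans.** A fan $\mathbb{B}$ is an element of the free $\mathbb{Z}$-module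 on the symbols (cones) $\Lambda(u_1,\dots,u_n)$ with $u_j\in V\setminus\{0\}$; a cone is simple if $u_1,\dots,u_n$ are linearly independent. The dual fan $\varphi(\mathbb{B})$ is defined linearly by sending a simple cone to the cone on the dual basis and a non-simple cone to $0$. Fix an orientation $r:V^n\to\{0,\pm1\}$ of $V$ (a nonzero function with $r(f(u_1),\dots,f(u_n))=\operatorname{sgn}(\det f)\,r(u_1,\dots,u_n)$ for every linear $f:V\to V$), and give $V^*$ the dual orientation (same value on a basis and on its dual basis). The characteristic function $\mathfrak{C}(\mathbb{B}):V\to\mathbb{Z}$ is defined linearly by sending a simple cone to $r(u_1,\dots,u_n)$ times the indicator function of $\{\sum t_ju_j : t_j\in\mathbb{Q}_{>0}\}$ and a non-simple cone to $0$. $\Phi$ is regular with respect to $\mathbb{B}$ if for every simple cone $\Lambda(u_1,\dots,u_n)$ occurring in $\mathbb{B}$ with nonzero coefficient: $\Phi(\sum x_ku_k)=0$ whenever $x\in\mathbb{A}_f^n$ has a zero entry, and $\int_{\mathbb{A}_f}\Phi(v+xu_j)\,dx=0$ for all $j$ and all $v\in V(\mathbb{A}_f)$. **L-functions.** For $w\in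 V$ let $(\Delta_wf)(v)=f(v-w)$. If $f:V\to\mathbb{C}$ and $\Delta=\sum_wd_w\Delta_w\ne0$ is a finite combination such that $\Delta f$ has finite support, put $$F(f)(t)=\frac{\sum_{v\in V}(\Delta f)(v)\,e(i\langle t,v\rangle)}{\sum_wd_w\,e(i\langle t,w\rangle)}\qquad(t\in V^*(\mathbb{R})),$$ which does not depend on $\Delta$. If $F(f)$ extends to a Schwartz function on $V^*(\mathbb{R})$, then for $\sigma:\{1,\dots,n\}\to\{0,1\}$ and $\operatorname{Re}(s_\mu)>0$ put $$L_\sigma(\boldsymbol{s},f,\rho)=\frac{2^n}{\prod_\mu\Gamma_{\mathbb{C}}(s_\mu)}\int_{(\mathbb{R}^\times)^n}F(f)\big((\rho^*)^{-1}(t)\big)\prod_\mu\Big(\frac{t_\mu}{|t_\mu|}\Big)^{\sigma(\mu)}|t_\mu|^{s_\mu}\,\frac{dt_1}{t_1}\cdots\frac{dt_n}{t_n},$$ where $dt_\mu$ is Lebesgue measure, and continue it to an entire function of $\boldsymbol{s}\in\mathbb{C}^n$. Put $L_\sigma(\boldsymbol{s},\Phi,\mathbb{B},\rho)=L_\sigma(\boldsymbol{s},\Phi\,\mathfrak{C}(\mathbb{B}),\rho)$.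 Here $\Gamma_{\mathbb{C}}(s)=2(2\pi)^{-s}\Gamma(s)$ and $\Gamma_{\mathbb{R}}(s)=\pi^{-s/2}\Gamma(s/2)$. Finally let $\Gamma_\sigma(\boldsymbol{s})=\prod_\mu\Gamma_{\mathbb{R}}(\sigma(\mu)+s_\mu)$, $i_\sigma=\prod_\mu i^{\sigma(\mu)}$ and $\hat L_\sigma(\boldsymbol{s},\Phi,\mathbb{B},\rho)=\Gamma_\sigma(\boldsymbol{s})L_\sigma(\boldsymbol{s},\Phi,\mathbb{B},\rho)$. **Proposition.** Let $\mathbb{B}$ be a fan in $V$, let $\Phi$ be a Schwartz–Bruhat function on $V(\mathbb{A}_f)$ which is regular with respect to $\mathbb{B}$, and let $\sigma:\{1,\dots,n\}\to\{0,1\}$. Then $\hat\Phi$ is a Schwartz–Bruhat function on $V^*(\mathbb{A}_f)$ which is regular with respect to $\varphi(\mathbb{B})$; both $L_\sigma(\boldsymbol{s},\Phi,\mathbb{B},\rho)$ and $L_\sigma(\boldsymbol{s},\hat\Phi,\varphi(\mathbb{B}),\rho^*)$ are well defined (the transform $F$ is Schwartz, the integral converges absolutely for $\operatorname{Re}(s_\mu)>0$,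 and the entire continuation exists); and $$\Gamma_\sigma(\boldsymbol{s})\,L_\sigma(\boldsymbol{s},\Phi,\mathbb{B},\rho)=i_\sigma^{-1}\,\Gamma_\sigma(\boldsymbol{1}-\boldsymbol{s})\,L_\sigma(\boldsymbol{1}-\boldsymbol{s},\hat\Phi,\varphi(\mathbb{B}),\rho^*),$$ that is, $$\hat L_\sigma(\boldsymbol{s},\Phi,\mathbb{B},\rho)=i_\sigma^{-1}\,\hat L_\sigma(\boldsymbol{1}-\boldsymbol{s},\hat\Phi,\varphi(\mathbb{B}),\rho^*),$$ for all $\boldsymbol{s}\in\mathbb{C}^n$ at which neither $\Gamma_\sigma(\boldsymbol{s})$ nor $\Gamma_\sigma(\boldsymbol{1}-\boldsymbol{s})$ has a pole (hence as meromorphic functions on $\mathbb{C}^n$). -/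

import Mathlib

open MeasureTheory Module TensorProduct

noncomputable section

namespace Shintani

/-! ### Real and finite-adelic points of a rational vector space -/

/-- The ring of finite adeles of `ℚ`. -/
abbrev FinAdele : Type := IsDedekindDomain.FiniteAdeleRing ℤ ℚ

/-- `V(𝔸_f)`, the base change of `V` to the finite adeles. -/
abbrev AdelicPts (V : Type*) [AddCommGroup V] [Module ℚ V] : Type _ := FinAdele ⊗[ℚ] V

/-- `V(ℝ)`, the base change of `V` to the reals. -/
abbrev RealPts (V : Type*) [AddCommGroup V] [Module ℚ V] : Type _ := ℝ ⊗[ℚ] V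

instance : MeasurableSpace FinAdele := borel FinAdele

instance : BorelSpace FinAdele := ⟨rfl⟩

instance (V : Type*) [AddCommGroup V] [Module ℚ V] : TopologicalSpace (AdelicPts V) :=
  moduleTopology FinAdele (AdelicPts V)

instance (V : Type*) [AddCommGroup V] [Module ℚ V] : MeasurableSpace (AdelicPts V) :=
  borel (AdelicPts V)

instance (V : Type*) [AddCommGroup V] [Module ℚ V] : BorelSpace (AdelicPts V) := ⟨rfl⟩

instance (V : Type*) [AddCommGroup V] [Module ℚ V] : TopologicalSpace (RealPts V) :=
  moduleTopology ℝ (RealPts V)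

instance (V : Type*) [AddCommGroup V] [Module ℚ V] : MeasurableSpace (RealPts V) :=
  borel (RealPts V)

instance (V : Type*) [AddCommGroup V] [Module ℚ V] : BorelSpace (RealPts V) := ⟨rfl⟩

/-- The canonical pairing `V*(R) × V(R) → R`. -/
def pairing (R : Type*) [CommRing R] [Algebra ℚ R] {V : Type*} [AddCommGroup V] [Module ℚ V]
    [FiniteDimensional ℚ V] : (R ⊗[ℚ] Dual ℚ V) ≃ₗ[R] Dual R (R ⊗[ℚ] V) :=
  (TensorProduct.isBaseChange ℚ V R).toDualBaseChange

theorem pairing_tmul (R : Type*) [CommRing R] [Algebra ℚ R] {V : Type*} [AddCommGroup V]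
    [Module ℚ V] [FiniteDimensional ℚ V] (a b : R) (f : Dual ℚ V) (v : V) :
    pairing R (a ⊗ₜ[ℚ] f) (b ⊗ₜ[ℚ] v) = a * b * algebraMap ℚ R (f v) := by
  have h := (TensorProduct.isBaseChange ℚ V R).toDualBaseChange_tmul a f v
  have hb : (b ⊗ₜ[ℚ] v : R ⊗[ℚ] V) = b • (TensorProduct.mk ℚ R V 1 v) := by
    simp [TensorProduct.smul_tmul']
  rw [pairing, hb, map_smul, h, smul_eq_mul]
  ring

/-- The isomorphism `ρ* : V*(ℝ) → ℝⁿ` dual to `ρ : V(ℝ) → ℝⁿ`. -/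
def dualIso {V : Type*} [AddCommGroup V] [Module ℚ V] [FiniteDimensional ℚ V] {n : ℕ}
    (ρ : RealPts V ≃ₗ[ℝ] (Fin n → ℝ)) : RealPts (Dual ℚ V) ≃ₗ[ℝ] (Fin n → ℝ) :=
  ((pairing ℝ).trans (Dual.congr ρ)).trans (Module.piEquiv (Fin n) ℝ ℝ).symm

/-- `ρ*` is the isomorphism with `⟨t, v⟩ = ∑ μ, ρ*(t)_μ ρ(v)_μ`. -/
theorem pairing_eq_sum_dualIso {V : Type*} [AddCommGroup V] [Module ℚ V] [FiniteDimensional ℚ V]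
    {n : ℕ} (ρ : RealPts V ≃ₗ[ℝ] (Fin n → ℝ)) (t : RealPts (Dual ℚ V)) (v : RealPts V) :
    pairing ℝ t v = ∑ μ, dualIso ρ t μ * ρ v μ := by
  have h : Module.piEquiv (Fin n) ℝ ℝ (dualIso ρ t) = Dual.congr ρ (pairing ℝ t) := by
    simp [dualIso]
  have h2 := congrArg (fun l => l (ρ v)) h
  simp only [Module.piEquiv_apply_apply, smul_eq_mul] at h2
  have h3 : (Dual.congr ρ (pairing ℝ t)) (ρ v) = pairing ℝ t v := by
    simp [Module.Dual.congr]
  rw [← h3, ← h2]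
  exact Finset.sum_congr rfl fun μ _ => mul_comm _ _

/-! ### Additive characters, Schwartz–Bruhat functions, Fourier transform -/

/-- `e(z) = exp(2πiz)`. -/
def expTwoPiI (z : ℂ) : ℂ := Complex.exp (2 * Real.pi * Complex.I * z)

/-- The finite adeles lying in `∏ p, ℤ_p`. -/
def IsIntegralAdele (a : FinAdele) : Prop := ∀ p, a p ∈ p.adicCompletionIntegers ℚ

/-- The standard additive character of `𝔸_f`: `ψ(a) = e(m)` for any `m ∈ ℚ` such that
`a - m` is integral. -/
def adelicChar (a : FinAdele) : ℂ :=
  expTwoPiI ((Classical.epsilon fun m : ℚ => IsIntegralAdele (a - algebraMap ℚ FinAdele m) : ℚ) : ℂ)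

theorem adelicChar_eq {a : FinAdele} {m : ℚ}
    (hm : IsIntegralAdele (a - algebraMap ℚ FinAdele m)) : adelicChar a = expTwoPiI (m : ℂ) := by
  have h := Classical.epsilon_spec
    (p := fun m : ℚ => IsIntegralAdele (a - algebraMap ℚ FinAdele m)) ⟨m, hm⟩
  unfold adelicChar
  generalize (Classical.epsilon fun m : ℚ => IsIntegralAdele (a - algebraMap ℚ FinAdele m)) = k at *
  have hint : ∀ p : IsDedekindDomain.HeightOneSpectrum ℤ, p.valuation ℚ (k - m) ≤ 1 := by
    intro p
    have h1 := sub_mem (hm p) (h p)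
    have hsub : ∀ x y : FinAdele, (x - y) p = x p - y p := fun x y =>
      RestrictedProduct.sub_apply
        (R := fun q : IsDedekindDomain.HeightOneSpectrum ℤ => q.adicCompletion ℚ) x y p
    have h2 : (a - algebraMap ℚ FinAdele m) p - (a - algebraMap ℚ FinAdele k) p
        = (algebraMap ℚ FinAdele (k - m)) p := by
      rw [← hsub, map_sub]
      congr 1
      ring
    rw [h2, IsDedekindDomain.HeightOneSpectrum.mem_adicCompletionIntegers,
      IsDedekindDomain.FiniteAdeleRing.algebraMap_apply,
      IsDedekindDomain.HeightOneSpectrum.valuedAdicCompletion_eq_valuation'] at h1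
    exact h1
  obtain ⟨z, hz⟩ := IsDedekindDomain.HeightOneSpectrum.mem_integers_of_valuation_le_one ℚ _ hint
  have hk : (k : ℂ) = m + z := by
    have : k = m + z := by
      have : ((z : ℤ) : ℚ) = k - m := by simpa using hz
      linarith
    rw [this]
    push_cast
    ring
  rw [hk, expTwoPiI, expTwoPiI, mul_add, Complex.exp_add]
  have : Complex.exp (2 * Real.pi * Complex.I * z) = 1 :=
    Complex.exp_eq_one_iff.mpr ⟨z, by ring⟩
  rw [this, mul_one]

/-- Schwartz–Bruhat functions on `V(𝔸_f)`. -/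
def IsSchwartzBruhat {V : Type*} [AddCommGroup V] [Module ℚ V] (Φ : AdelicPts V → ℂ) : Prop :=
  IsLocallyConstant Φ ∧ HasCompactSupport Φ

/-- The Fourier transform `Φ̂(t) = ∫ Φ(v) ψ(⟨v, t⟩) dv`, with respect to the measure `ν` on
`V(𝔸_f)`. -/
def adelicFourier {V : Type*} [AddCommGroup V] [Module ℚ V] [FiniteDimensional ℚ V]
    (ν : Measure (AdelicPts V)) (Φ : AdelicPts V → ℂ) : AdelicPts (Dual ℚ V) → ℂ :=
  fun t => ∫ v, Φ v * adelicChar (pairing FinAdele t v) ∂ν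

/-- `V` embedded diagonally in `V(𝔸) = V(ℝ) × V(𝔸_f)`. -/
def diagonal (V : Type*) [AddCommGroup V] [Module ℚ V] :
    AddSubgroup (RealPts V × AdelicPts V) :=
  ((TensorProduct.mk ℚ ℝ V 1).prod (TensorProduct.mk ℚ FinAdele V 1)).toAddMonoidHom.range

/-- The measure `ν` on `V(𝔸_f)` is compatible with the pull-back of Lebesgue measure by
`ρ : V(ℝ) → ℝⁿ`, i.e. `V(𝔸)/V` has volume one for the product measure. -/
def IsCompatible {V : Type*} [AddCommGroup V] [Module ℚ V] {n : ℕ}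
    (ρ : RealPts V ≃ₗ[ℝ] (Fin n → ℝ)) (ν : Measure (AdelicPts V)) : Prop :=
  addCovolume (diagonal V) (RealPts V × AdelicPts V)
    ((Measure.map ρ.symm (volume : Measure (Fin n → ℝ))).prod ν) = 1

/-! ### Orientations, cones and fans -/

/-- An orientation of an `n`-dimensional rational vector space `V`: a nonzero function
`r : Vⁿ → {0, ±1}` with `r(f u₁, …, f uₙ) = sign(det f) r(u₁, …, uₙ)`. -/
structure FanOrientation (n : ℕ) (V : Type*) [AddCommGroup V] [Module ℚ V] where
  toFun : (Fin n → V) → SignType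
  exists_ne_zero : ∃ u, toFun u ≠ 0
  map_comp : ∀ (f : V →ₗ[ℚ] V) (u : Fin n → V),
    toFun (fun j => f (u j)) = SignType.sign (LinearMap.det f) * toFun u

theorem FanOrientation.basis_ne_zero {V : Type*} [AddCommGroup V] [Module ℚ V] {n : ℕ}
    (r : FanOrientation n V) (b : Basis (Fin n) ℚ V) : r.toFun b ≠ 0 := by
  obtain ⟨u, hu⟩ := r.exists_ne_zero
  intro h
  apply hu
  have h1 := r.map_comp (b.constr ℚ u) b
  have h2 : (fun j => b.constr ℚ u (b j)) = u := by
    funext j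
    simp
  rw [h2, h, mul_zero] at h1
  exact h1

theorem FanOrientation.basis_eq {V : Type*} [AddCommGroup V] [Module ℚ V] {n : ℕ}
    (r : FanOrientation n V) (b : Basis (Fin n) ℚ V) (u : Fin n → V) :
    r.toFun u = SignType.sign (b.det u) * r.toFun b := by
  have h1 := r.map_comp (b.constr ℚ u) b
  have h2 : (fun j => b.constr ℚ u (b j)) = u := by
    funext j
    simp
  have h3 : LinearMap.det (b.constr ℚ u) = b.det u := by
    have := b.det_comp (b.constr ℚ u) b
    rw [b.det_self, mul_one] at this
    rw [← this]
    congr 1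
  rw [h2, h3] at h1
  exact h1

/-- The dual orientation of `V*`: the one which takes the same value on a basis of `V` and on the
dual basis, see `FanOrientation.dual_dualBasis`. -/
def FanOrientation.dual {V : Type*} [AddCommGroup V] [Module ℚ V] [FiniteDimensional ℚ V] {n : ℕ}
    (hn : finrank ℚ V = n) (r : FanOrientation n V) : FanOrientation n (Dual ℚ V) where
  toFun t := SignType.sign ((finBasisOfFinrankEq ℚ V hn).dualBasis.det t) *
    r.toFun (finBasisOfFinrankEq ℚ V hn)
  exists_ne_zero := by
    refine ⟨(finBasisOfFinrankEq ℚ V hn).dualBasis, ?_⟩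
    rw [Basis.det_self, sign_one, one_mul]
    exact r.basis_ne_zero _
  map_comp f t := by
    have := (finBasisOfFinrankEq ℚ V hn).dualBasis.det_comp f t
    rw [show (fun j => f (t j)) = f ∘ t from rfl, this, sign_mul, mul_assoc]

theorem FanOrientation.dual_dualBasis {V : Type*} [AddCommGroup V] [Module ℚ V]
    [FiniteDimensional ℚ V] {n : ℕ} (hn : finrank ℚ V = n) (r : FanOrientation n V)
    (b : Basis (Fin n) ℚ V) : (r.dual hn).toFun b.dualBasis = r.toFun b := by
  rw [r.basis_eq (finBasisOfFinrankEq ℚ V hn) b]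
  change SignType.sign _ * _ = _
  congr 1
  set c := finBasisOfFinrankEq ℚ V hn
  have h1 : c.det b * b.det c = 1 := by
    rw [Basis.det_apply, Basis.det_apply, ← Matrix.det_mul, Basis.toMatrix_mul_toMatrix_flip,
      Matrix.det_one]
  have h2 : c.dualBasis.det b.dualBasis = b.det c := by
    rw [Basis.det_apply, Basis.det_apply, ← Matrix.det_transpose]
    congr 1
    ext i j
    simp [Basis.toMatrix_apply, Matrix.transpose_apply, Basis.dualBasis_repr,
      Basis.coe_dualBasis]
  rw [h2]
  have h3 : SignType.sign (c.det b) * SignType.sign (b.det c) = 1 := by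
    rw [← sign_mul, h1, sign_one]
  revert h3
  generalize SignType.sign (c.det b) = x
  generalize SignType.sign (b.det c) = y
  revert x y
  decide

/-- The symbols `Λ(a₁, …, aₙ)` with `a₁, …, aₙ ∈ V ∖ {0}`. -/
abbrev Cone (n : ℕ) (V : Type*) [AddCommGroup V] : Type _ := Fin n → {a : V // a ≠ 0}

/-- Fans: elements of the free `ℤ`-module on the cones. -/
abbrev Fan (n : ℕ) (V : Type*) [AddCommGroup V] : Type _ := Cone n V →₀ ℤ

/-- The cone `Λ(a₁, …, aₙ)` is simple. -/
def IsSimple {n : ℕ} {V : Type*} [AddCommGroup V] [Module ℚ V] (Λ : Cone n V) : Prop :=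
  LinearIndependent ℚ fun j => (Λ j : V)

/-- `C(u₁, …, uₙ) = {∑ t_j u_j | t_j ∈ ℚ, t_j > 0}`. -/
def openCone {n : ℕ} {V : Type*} [AddCommGroup V] [Module ℚ V] (Λ : Cone n V) : Set V :=
  {v | ∃ t : Fin n → ℚ, (∀ j, 0 < t j) ∧ v = ∑ j, t j • (Λ j : V)}

open Classical in
/-- The characteristic function of a cone. -/
def charCone {n : ℕ} {V : Type*} [AddCommGroup V] [Module ℚ V] (r : FanOrientation n V)
    (Λ : Cone n V) (v : V) : ℤ :=
  if IsSimple Λ ∧ v ∈ openCone Λ then ((r.toFun fun j => (Λ j : V) : SignType) : ℤ) else 0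

/-- The characteristic function of a fan. -/
def charFan {n : ℕ} {V : Type*} [AddCommGroup V] [Module ℚ V] (r : FanOrientation n V)
    (B : Fan n V) (v : V) : ℤ :=
  B.sum fun Λ c => c * charCone r Λ v

open Classical in
/-- The dual of a cone: the cone on the dual basis if the cone is simple, and `0` otherwise. -/
def dualCone {n : ℕ} {V : Type*} [AddCommGroup V] [Module ℚ V] [FiniteDimensional ℚ V]
    (hn : finrank ℚ V = n) (Λ : Cone n V) : Fan n (Dual ℚ V) :=
  if h : IsSimple Λ then
    Finsupp.single (fun j => ⟨(basisOfLinearIndependentOfCardEqFinrank' (fun j => (Λ j : V)) h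
      (by rw [Fintype.card_fin, hn])).dualBasis j, Basis.ne_zero _ j⟩) 1
  else 0

/-- The dual of a fan. -/
def dualFan {n : ℕ} {V : Type*} [AddCommGroup V] [Module ℚ V] [FiniteDimensional ℚ V]
    (hn : finrank ℚ V = n) (B : Fan n V) : Fan n (Dual ℚ V) :=
  B.sum fun Λ c => c • dualCone hn Λ

/-! ### Regularity -/

/-- `Φ` vanishes at `x₁u₁ + ⋯ + xₙuₙ` whenever some `x_k ∈ 𝔸_f` is zero. -/
def ConditionP1 {n : ℕ} {V : Type*} [AddCommGroup V] [Module ℚ V] (Φ : AdelicPts V → ℂ)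
    (Λ : Cone n V) : Prop :=
  ∀ x : Fin n → FinAdele, (∃ k, x k = 0) → Φ (∑ k, x k ⊗ₜ[ℚ] (Λ k : V)) = 0

/-- The integral of `Φ` over every translate of every line `𝔸_f u_j` vanishes. (The choice of the
Haar measure of `𝔸_f` does not matter.) -/
def ConditionP2 {n : ℕ} {V : Type*} [AddCommGroup V] [Module ℚ V] (Φ : AdelicPts V → ℂ)
    (Λ : Cone n V) : Prop :=
  ∀ (η : Measure FinAdele) [η.IsAddHaarMeasure] (j : Fin n) (v : AdelicPts V),
    ∫ x : FinAdele, Φ (v + x ⊗ₜ[ℚ] (Λ j : V)) ∂η = 0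

/-- `Φ` is regular with respect to the fan `B`: both conditions hold for every simple cone which
occurs in `B` with nonzero coefficient. -/
def IsRegularFor {n : ℕ} {V : Type*} [AddCommGroup V] [Module ℚ V] (Φ : AdelicPts V → ℂ)
    (B : Fan n V) : Prop :=
  ∀ Λ ∈ B.support, IsSimple Λ → ConditionP1 Φ Λ ∧ ConditionP2 Φ Λ

/-- The function `Φ · 𝔠(B)` on `V`, where `V` is embedded in `V(𝔸_f)`. -/
def fanFunction {n : ℕ} {V : Type*} [AddCommGroup V] [Module ℚ V] (r : FanOrientation n V)
    (Φ : AdelicPts V → ℂ) (B : Fan n V) : V → ℂ :=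
  fun v => Φ (1 ⊗ₜ[ℚ] v) * (charFan r B v : ℂ)

/-! ### The transform `F` -/

/-- The operator `∑ w, d_w Δ_w`, where `(Δ_w f)(v) = f(v - w)`. The `Δ_w` are linearly
independent, so these operators form the group algebra of `V`, and the operator is nonzero exactly
if `d ≠ 0`. -/
def translationOp {V : Type*} [AddCommGroup V] (d : V →₀ ℂ) (f : V → ℂ) : V → ℂ :=
  fun v => d.sum fun w c => c * f (v - w)

/-- `e(i⟨t, v⟩)` for `t ∈ V*(ℝ)` and `v ∈ V`. -/
def realExp {V : Type*} [AddCommGroup V] [Module ℚ V] [FiniteDimensional ℚ V]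
    (t : RealPts (Dual ℚ V)) (v : V) : ℂ :=
  expTwoPiI (Complex.I * ((pairing ℝ t (1 ⊗ₜ[ℚ] v) : ℝ) : ℂ))

/-- `P(∑ w, d_w Δ_w)(t) = ∑ w, d_w e(i⟨t, w⟩)`. -/
def symbol {V : Type*} [AddCommGroup V] [Module ℚ V] [FiniteDimensional ℚ V]
    (d : V →₀ ℂ) (t : RealPts (Dual ℚ V)) : ℂ :=
  d.sum fun w c => c * realExp t w

/-- The function `G` on `V*(ℝ)` represents the fraction `F(f) = F(Δ f) / P(Δ)`, where `Δ` is a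
nonzero combination of translations such that `Δ f` has finite support (in particular such a `Δ`
exists). -/
def Represents {V : Type*} [AddCommGroup V] [Module ℚ V] [FiniteDimensional ℚ V]
    (f : V → ℂ) (G : RealPts (Dual ℚ V) → ℂ) : Prop :=
  ∃ d : V →₀ ℂ, d ≠ 0 ∧ (Function.support (translationOp d f)).Finite ∧
    ∀ t, symbol d t * G t = ∑ᶠ v, translationOp d f v * realExp t v

/-- Schwartz functions on a finite-dimensional real vector space. -/
def IsSchwartz {E : Type*} [AddCommGroup E] [Module ℝ E] (G : E → ℂ) : Prop :=
  ∃ (m : ℕ) (ε : E ≃ₗ[ℝ] (Fin m → ℝ)) (g : SchwartzMap (Fin m → ℝ) ℂ), ∀ x, G x = g (ε x)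

/-- `F(f)` is (represented by) a Schwartz function on `V*(ℝ)`. -/
def HasSchwartzTransform {V : Type*} [AddCommGroup V] [Module ℚ V] [FiniteDimensional ℚ V]
    (f : V → ℂ) : Prop :=
  ∃ G : RealPts (Dual ℚ V) → ℂ, IsSchwartz G ∧ Represents f G

/-- The Schwartz function `F(f)`. It is meaningful if `HasSchwartzTransform f` holds, and it is
then unique, because the zeros of `P(Δ)` are nowhere dense. -/
def transform {V : Type*} [AddCommGroup V] [Module ℚ V] [FiniteDimensional ℚ V]
    (f : V → ℂ) : RealPts (Dual ℚ V) → ℂ :=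
  Classical.epsilon fun G => IsSchwartz G ∧ Represents f G

/-! ### The normalized Shintani L-function -/

/-- `|t|_σ^s = ∏ μ, (t_μ / |t_μ|)^{σ(μ)} |t_μ|^{s_μ}`. -/
def signedPow {n : ℕ} (σ : Fin n → Fin 2) (s : Fin n → ℂ) (t : Fin n → ℝ) : ℂ :=
  ∏ μ, ((t μ / |t μ| : ℝ) : ℂ) ^ (σ μ : ℕ) * ((|t μ| : ℝ) : ℂ) ^ (s μ)

/-- The integrand `F(f)((ρ*)⁻¹(t)) |t|_σ^s / (t₁ ⋯ tₙ)`. -/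
def integrand {V : Type*} [AddCommGroup V] [Module ℚ V] [FiniteDimensional ℚ V] {n : ℕ}
    (σ : Fin n → Fin 2) (f : V → ℂ) (ρ : RealPts V ≃ₗ[ℝ] (Fin n → ℝ)) (s : Fin n → ℂ)
    (t : Fin n → ℝ) : ℂ :=
  transform f ((dualIso ρ).symm t) * signedPow σ s t * ∏ μ, ((t μ : ℝ) : ℂ)⁻¹

/-- The integral which defines `L_σ(s, f, ρ)` for `Re(s_μ) > 0`. -/
def integralL {V : Type*} [AddCommGroup V] [Module ℚ V] [FiniteDimensional ℚ V] {n : ℕ}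
    (σ : Fin n → Fin 2) (f : V → ℂ) (ρ : RealPts V ≃ₗ[ℝ] (Fin n → ℝ)) (s : Fin n → ℂ) : ℂ :=
  2 ^ n / (∏ μ, Complex.Gammaℂ (s μ)) *
    ∫ t in {t : Fin n → ℝ | ∀ μ, t μ ≠ 0}, integrand σ f ρ s t

/-- `G` is an entire function on `ℂⁿ` which agrees with `g` where all `Re(s_μ) > 0`. -/
def IsEntireContinuation {n : ℕ} (g G : (Fin n → ℂ) → ℂ) : Prop :=
  Differentiable ℂ G ∧ ∀ s : Fin n → ℂ, (∀ μ, 0 < (s μ).re) → G s = g s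

/-- `L_σ(s, f, ρ)` for all `s ∈ ℂⁿ`: the entire continuation of the integral. -/
def LSigma {V : Type*} [AddCommGroup V] [Module ℚ V] [FiniteDimensional ℚ V] {n : ℕ}
    (σ : Fin n → Fin 2) (f : V → ℂ) (ρ : RealPts V ≃ₗ[ℝ] (Fin n → ℝ)) : (Fin n → ℂ) → ℂ :=
  Classical.epsilon fun G => IsEntireContinuation (integralL σ f ρ) G

/-- `Γ_σ(s) = ∏ μ, Γ_ℝ(σ(μ) + s_μ)`. -/
def GammaSigma {n : ℕ} (σ : Fin n → Fin 2) (s : Fin n → ℂ) : ℂ :=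
  ∏ μ, Complex.Gammaℝ (((σ μ : ℕ) : ℂ) + s μ)

/-- `i_σ = ∏ μ, i^{σ(μ)}`. -/
def iSigma {n : ℕ} (σ : Fin n → Fin 2) : ℂ := ∏ μ, Complex.I ^ (σ μ : ℕ)

/-- `L̂_σ(s, f, ρ) = Γ_σ(s) L_σ(s, f, ρ)`. -/
def LHatSigma {V : Type*} [AddCommGroup V] [Module ℚ V] [FiniteDimensional ℚ V] {n : ℕ}
    (σ : Fin n → Fin 2) (f : V → ℂ) (ρ : RealPts V ≃ₗ[ℝ] (Fin n → ℝ)) (s : Fin n → ℂ) : ℂ :=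
  GammaSigma σ s * LSigma σ f ρ s

/-- `s` is not on the polar divisor of `Γ_σ`. -/
def NotPole {n : ℕ} (σ : Fin n → Fin 2) (s : Fin n → ℂ) : Prop :=
  ∀ (μ : Fin n) (k : ℕ), ((σ μ : ℕ) : ℂ) + s μ ≠ -(2 * (k : ℂ))

/-- The function `L_σ(·, f, ρ)` is well defined: `F(f)` is a Schwartz function, the defining
integral converges absolutely for `Re(s_μ) > 0`, and it continues to the entire function
`LSigma σ f ρ`. -/
def LSigmaWellDefined {V : Type*} [AddCommGroup V] [Module ℚ V] [FiniteDimensional ℚ V] {n : ℕ}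
    (σ : Fin n → Fin 2) (f : V → ℂ) (ρ : RealPts V ≃ₗ[ℝ] (Fin n → ℝ)) : Prop :=
  HasSchwartzTransform f ∧
    (∀ s : Fin n → ℂ, (∀ μ, 0 < (s μ).re) →
      IntegrableOn (integrand σ f ρ s) {t : Fin n → ℝ | ∀ μ, t μ ≠ 0}) ∧
    IsEntireContinuation (integralL σ f ρ) (LSigma σ f ρ)

end Shintani

end

open Shintani

/-!
The functional equation is Tate's argument with the adelic theta series replaced by a rational
function of exponentials.

*Step functions.* Let `b` be the basis of a simple cone. A Schwartz–Bruhat function is supported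
on `N⁻¹ L` and invariant under `N L`, where `L = ⊕ ℤ_f b_j` and `ℤ_f = ∏ p, ℤ_p`, so that it is
given by its values at the grid points `∑ (a_j / N) b_j` with `0 ≤ a_j < N²`. Regularity for the
cone means that it vanishes where a coordinate is zero, and that its sums over each `a_j` vanish
(`exists_isRegularStep`). The adelic Fourier transform is a finite Fourier transform in these
terms and exchanges the two conditions (`IsRegularStep.adelicFourier`). This gives the regularity
of `Φ̂`.

*The transform on a cone.* Put `q_j = exp(-2π y_j / N)` and `M = N²`. Summation over the lattice
cones with vertices at the grid points gives `F(Φ 𝔠) = ∑_a Φ(a) ∏_j q_j^(a_j) / (1 - q_j^M)`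
(`IsRegularStep.represents`). As the sums over each `a_j` vanish, `q_j^(a_j)` may be replaced by
`q_j^(a_j) - q_j` (`sum_mul_prod_add_const`), and `(q^a - q) / (1 - q^M)` is a Schwartz function
for `0 < a < M` (`exists_schwartz_qDiff`); the terms with some `a_j = 0` are absent by regularity.
Continuous representatives of `F` are unique since exponential sums vanish only on nowhere dense
sets (`Represents.unique`).

*Duality.* By the partial fractions of the cotangent, the Fourier transform of `(q^a - q) / (1 -
q^M)` is `-i / N` times a difference of geometric sums divided by `1 - q^M` (`integral_qDiff`).
The sums that arise are those of the finite Fourier transform. With the normalization of the Haar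
measure, computed on a fundamental domain of `V(𝔸) / V` in `measure_basisLattice`, it follows that
`F` of the dual data is `i^n` times the Fourier transform of `F(Φ 𝔠)`
(`IsRegularStep.exists_transform_pair`). Everything is linear in the fan.

*L-functions.* What remains concerns an arbitrary Schwartz function on `ℝⁿ`. Its Mellin transform
against `∏ sgn(t_μ)^(σ_μ + 1) |t_μ|^(s_μ - 1)`, divided by the complex Gamma factors, is entire by
repeated integration by parts (`exists_entire_normMellinZ`). In the strip `0 < Re s_μ < 1` the
homogeneous kernel is a superposition of Gaussians, or of Hermite functions `t exp(-π u t²)`, for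
each of which Parseval's formula applies; this relates the Mellin transforms of a Schwartz
function and of its Fourier transform (`mellinZ_functional_equation`). The sign `(t_μ /
|t_μ|)^(σ_μ + 1)`, with one factor coming from `dt_μ / t_μ`, explains why the Gamma factor of the
opposite parity appears; its product with `Γ_ℝ(σ_μ + s_μ)` is `Γ_ℂ(s_μ)`. The identity theorem
extends the equation to all `s` (`entire_functional_equation`).
-/

noncomputable section

namespace Shintani

/-! ### Integral finite adeles -/

section

open IsDedekindDomain Rat.HeightOneSpectrum Topology

local instance (p : Nat.Primes) : Fact p.1.Prime := ⟨p.2⟩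

theorem finAdele_sub_apply (x y : FinAdele) (v : HeightOneSpectrum ℤ) : (x - y) v = x v - y v :=
  rfl
theorem finAdele_mul_apply (x y : FinAdele) (v : HeightOneSpectrum ℤ) : (x * y) v = x v * y v :=
  rfl
theorem finAdele_algebraMap_apply (q : ℚ) (p : HeightOneSpectrum ℤ) :
    (algebraMap ℚ FinAdele q) p = algebraMap ℚ (p.adicCompletion ℚ) q := rfl

/-- The integral finite adeles `∏ p, ℤ_p`, as a subring. -/
def intAdele : Subring FinAdele where
  carrier := {a | IsIntegralAdele a}
  zero_mem' _ := zero_mem _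
  one_mem' _ := one_mem _
  add_mem' ha hb p := add_mem (ha p) (hb p)
  mul_mem' ha hb p := mul_mem (ha p) (hb p)
  neg_mem' ha p := neg_mem (ha p)

theorem isOpen_adicCompletionIntegers (v : HeightOneSpectrum ℤ) :
    IsOpen (v.adicCompletionIntegers ℚ : Set (v.adicCompletion ℚ)) :=
  Valued.isOpen_valuationSubring _

theorem isOpen_intAdele : IsOpen (intAdele : Set FinAdele) :=
  RestrictedProduct.isOpen_forall_mem
    (R := fun v : HeightOneSpectrum ℤ => v.adicCompletion ℚ)
    (A := fun v => (v.adicCompletionIntegers ℚ : Set (v.adicCompletion ℚ)))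
    isOpen_adicCompletionIntegers

/-- Integrality at a place, read off in the field `ℚ_p`. -/
theorem integral_iff_norm_le (v : HeightOneSpectrum ℤ) (x : v.adicCompletion ℚ) :
    x ∈ v.adicCompletionIntegers ℚ ↔ ‖adicCompletion.padicEquiv v x‖ ≤ 1 := by
  constructor
  · intro hx
    exact (adicCompletion.padicEquiv_bijOn v).1 hx
  · intro hx
    obtain ⟨y, hy, h⟩ := (adicCompletion.padicEquiv_bijOn v).2.2 hx
    exact (adicCompletion.padicEquiv v).injective h ▸ hy

instance compactSpace_adicCompletionIntegers (v : HeightOneSpectrum ℤ) :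
    CompactSpace (v.adicCompletionIntegers ℚ) := by
  have h : (v.adicCompletionIntegers ℚ : Set (v.adicCompletion ℚ)) =
      (adicCompletion.padicEquiv v).symm '' Metric.closedBall 0 1 := by
    ext x
    rw [SetLike.mem_coe, integral_iff_norm_le]
    constructor
    · intro hx
      exact ⟨_, by simpa using hx, (adicCompletion.padicEquiv v).symm_apply_apply x⟩
    · rintro ⟨y, hy, rfl⟩
      simpa using hy
  have hc : IsCompact (v.adicCompletionIntegers ℚ : Set (v.adicCompletion ℚ)) := by
    rw [h]
    exact (isCompact_closedBall _ _).image (adicCompletion.padicEquiv v).symm.continuous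
  exact isCompact_iff_compactSpace.1 hc

theorem isCompact_intAdele : IsCompact (intAdele : Set FinAdele) := by
  have h := RestrictedProduct.isEmbedding_structureMap
    (R := fun v : HeightOneSpectrum ℤ => v.adicCompletion ℚ)
    (A := fun v => (v.adicCompletionIntegers ℚ : Set (v.adicCompletion ℚ))) (𝓕 := Filter.cofinite)
  have (v : HeightOneSpectrum ℤ) :
      CompactSpace ((v.adicCompletionIntegers ℚ : Set (v.adicCompletion ℚ))) :=
    compactSpace_adicCompletionIntegers v
  have h2 := isCompact_range h.continuous
  rw [RestrictedProduct.range_structureMap] at h2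
  exact h2

/-- An integral adele is congruent to a natural number modulo a given prime. -/
theorem exists_natCast_sub_prime_mul {p : ℕ} (hp : p.Prime) {y : FinAdele} (hy : y ∈ intAdele) :
    ∃ (c : ℕ) (z : FinAdele), z ∈ intAdele ∧ y = c + p * z := by
  obtain ⟨v₀, hv₀⟩ := (primesEquiv (R := ℤ)).surjective ⟨p, hp⟩
  have h1 := (integral_iff_norm_le v₀ _).1 (hy v₀)
  obtain ⟨c, -, hc⟩ := PadicInt.exists_mem_range (p := (primesEquiv v₀ : Nat.Primes))
    ⟨_, h1⟩
  have hp0 : (p : FinAdele) * algebraMap ℚ FinAdele (p : ℚ)⁻¹ = 1 := by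
    have : (p : FinAdele) = algebraMap ℚ FinAdele (p : ℚ) := by simp
    rw [this, ← map_mul, mul_inv_cancel₀ (by exact_mod_cast hp.ne_zero), map_one]
  -- `p⁻¹ (y - c)` is integral at `p` by the choice of `c`, and elsewhere because `p` is a unit
  refine ⟨c, algebraMap ℚ FinAdele (p : ℚ)⁻¹ * (y - c), ?_, ?_⟩
  · intro v
    rw [finAdele_mul_apply, finAdele_algebraMap_apply, integral_iff_norm_le, map_mul,
      AlgEquivClass.commutes, finAdele_sub_apply]
    have hcv : (c : FinAdele) v = (c : v.adicCompletion ℚ) := by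
      have : (c : FinAdele) = algebraMap ℚ FinAdele (c : ℚ) := by simp
      rw [this, finAdele_algebraMap_apply]; simp
    rw [hcv, map_sub, map_natCast, norm_mul]
    simp only [map_inv₀, map_natCast, norm_inv]
    by_cases hv : (primesEquiv v : Nat.Primes) = ⟨p, hp⟩
    · have : v = v₀ := primesEquiv.injective (hv.trans hv₀.symm)
      subst this
      have hpv : ((primesEquiv v : Nat.Primes) : ℕ) = p := by rw [hv]
      rw [PadicInt.maximalIdeal_eq_span_p, Ideal.mem_span_singleton] at hc
      obtain ⟨w, hw⟩ := hc
      have hw' : adicCompletion.padicEquiv v (y v) - (c : ℚ_[(primesEquiv v : Nat.Primes)]) =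
          (((primesEquiv v : Nat.Primes) : ℕ) : ℚ_[(primesEquiv v : Nat.Primes)]) * w :=
        congrArg (fun t : ℤ_[(primesEquiv v : Nat.Primes)] =>
          (t : ℚ_[(primesEquiv v : Nat.Primes)])) hw
      subst hpv
      rw [hw', norm_mul, ← mul_assoc, inv_mul_cancel₀, one_mul]
      · exact PadicInt.norm_le_one w
      · rw [norm_ne_zero_iff]; exact_mod_cast hp.ne_zero
    · have hpv : ‖(p : ℚ_[(primesEquiv v : Nat.Primes)])‖ = 1 := by
        rw [← PadicInt.coe_natCast, PadicInt.padic_norm_e_of_padicInt,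
          PadicInt.norm_natCast_eq_one_iff]
        exact (Nat.coprime_primes (primesEquiv v : Nat.Primes).2 hp).2 fun h => hv (Subtype.ext h)
      rw [hpv, inv_one, one_mul]
      exact PadicInt.norm_le_one (⟨_, (integral_iff_norm_le v _).1 (hy v)⟩ - (c : ℤ_[_]))
  · rw [← mul_assoc, hp0, one_mul]; ring

/-- The integers are dense in `∏ p, ℤ_p`: an integral adele is congruent to a natural number
modulo any given positive integer. -/
theorem exists_natCast_sub_mul {M : ℕ} (hM : M ≠ 0) {y : FinAdele} (hy : y ∈ intAdele) :
    ∃ (c : ℕ) (z : FinAdele), z ∈ intAdele ∧ y = c + M * z := by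
  induction M using Nat.recOnMul generalizing y with
  | zero => exact absurd rfl hM
  | one => exact ⟨0, y, hy, by simp⟩
  | prime p hp => exact exists_natCast_sub_prime_mul hp hy
  | mul a b ha hb =>
    obtain ⟨c, z, hz, rfl⟩ := ha (left_ne_zero_of_mul hM) hy
    obtain ⟨d, w, hw, rfl⟩ := hb (right_ne_zero_of_mul hM) hz
    exact ⟨c + a * d, w, hw, by push_cast; ring⟩

/-- A rational number which is an integral adele is an integer. -/
theorem exists_int_of_mem_intAdele {q : ℚ} (hq : algebraMap ℚ FinAdele q ∈ intAdele) :
    ∃ z : ℤ, q = z := by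
  obtain ⟨z, hz⟩ := HeightOneSpectrum.mem_integers_of_valuation_le_one (R := ℤ) ℚ q fun p => by
    have h1 := hq p
    rwa [HeightOneSpectrum.mem_adicCompletionIntegers, FiniteAdeleRing.algebraMap_apply,
      HeightOneSpectrum.valuedAdicCompletion_eq_valuation'] at h1
  exact ⟨z, by simpa using hz.symm⟩

theorem algebraMap_mul_inv {N : ℚ} (hN : N ≠ 0) :
    algebraMap ℚ FinAdele N * algebraMap ℚ FinAdele N⁻¹ = 1 := by
  rw [← map_mul, mul_inv_cancel₀ hN, map_one]

theorem algebraMap_inv_mul {N : ℚ} (hN : N ≠ 0) :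
    algebraMap ℚ FinAdele N⁻¹ * algebraMap ℚ FinAdele N = 1 := by
  rw [← map_mul, inv_mul_cancel₀ hN, map_one]

theorem natCast_mem_intAdele (n : ℕ) : (n : FinAdele) ∈ intAdele := natCast_mem _ n

theorem intCast_mem_intAdele (n : ℤ) : (n : FinAdele) ∈ intAdele := intCast_mem _ n

/-- Every finite adele has a positive integral multiple which is an integral adele. -/
theorem exists_nat_mul_mem_intAdele (x : FinAdele) :
    ∃ N : ℕ, N ≠ 0 ∧ (N : FinAdele) * x ∈ intAdele := by
  have hfin : {v : HeightOneSpectrum ℤ | x v ∉ v.adicCompletionIntegers ℚ}.Finite := x.2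
  have key : ∀ s : Finset (HeightOneSpectrum ℤ), ∃ N : ℕ, N ≠ 0 ∧ ∀ v ∈ s,
      ((N : FinAdele) * x) v ∈ v.adicCompletionIntegers ℚ := by
    intro s
    classical
    have hnat : ∀ (N : ℕ) (v : HeightOneSpectrum ℤ),
        (N : FinAdele) v ∈ v.adicCompletionIntegers ℚ := fun N => natCast_mem_intAdele N
    induction s using Finset.induction_on with
    | empty => exact ⟨1, one_ne_zero, by simp⟩
    | insert v s _ ih =>
      obtain ⟨N, hN, h⟩ := ih
      obtain ⟨b, hb, hb'⟩ :=
        HeightOneSpectrum.adicCompletion.mul_nonZeroDivisor_mem_adicCompletionIntegers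
          (R := ℤ) (K := ℚ) v (x v)
      have hb0 : b.natAbs ≠ 0 := Int.natAbs_ne_zero.2 (nonZeroDivisors.ne_zero hb)
      have hbv : ((b.natAbs : ℕ) : FinAdele) v * x v ∈ v.adicCompletionIntegers ℚ := by
        have hcv : ((b : ℤ) : FinAdele) v = algebraMap ℤ (v.adicCompletion ℚ) b := by
          have : ((b : ℤ) : FinAdele) = algebraMap ℚ FinAdele b := by simp
          rw [this, finAdele_algebraMap_apply]; simp
        have hb2 : ((b : ℤ) : FinAdele) v * x v ∈ v.adicCompletionIntegers ℚ := by
          rw [hcv, mul_comm]; exact hb'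
        rcases Int.natAbs_eq b with h0 | h0
        · have : ((b.natAbs : ℕ) : FinAdele) = (b : FinAdele) := by
            rw [← Int.cast_natCast, ← h0]
          rw [this]; exact hb2
        · have : ((b.natAbs : ℕ) : FinAdele) = -(b : FinAdele) := by
            rw [← Int.cast_natCast, ← Int.cast_neg]
            congr 1; omega
          have h3 := neg_mem hb2
          rw [← neg_mul] at h3
          rw [this]; exact h3
      refine ⟨b.natAbs * N, mul_ne_zero hb0 hN, fun w hw => ?_⟩
      rcases Finset.mem_insert.1 hw with rfl | hw
      · have : ((b.natAbs * N : ℕ) : FinAdele) * x = N * ((b.natAbs : ℕ) * x) := by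
          push_cast; ring
        rw [this]
        exact mul_mem (hnat N _) hbv
      · have : ((b.natAbs * N : ℕ) : FinAdele) * x = (b.natAbs : ℕ) * (N * x) := by
          push_cast; ring
        rw [this]
        exact mul_mem (hnat _ w) (h w hw)
  obtain ⟨N, hN, h⟩ := key hfin.toFinset
  refine ⟨N, hN, fun v => ?_⟩
  by_cases hv : x v ∈ v.adicCompletionIntegers ℚ
  · exact mul_mem (natCast_mem_intAdele N v) hv
  · exact h v (by simpa using hv)

/-- Strong approximation: `𝔸_f = ℚ + ∏ p, ℤ_p`. -/
theorem exists_rat_add_mem_intAdele (x : FinAdele) :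
    ∃ q : ℚ, x + algebraMap ℚ FinAdele q ∈ intAdele := by
  obtain ⟨N, hN, h⟩ := exists_nat_mul_mem_intAdele x
  obtain ⟨c, z, hz, hx⟩ := exists_natCast_sub_mul hN h
  have hNq : (N : ℚ) ≠ 0 := by exact_mod_cast hN
  refine ⟨-(c / N), ?_⟩
  convert hz using 1
  have h1 := congrArg (fun t => algebraMap ℚ FinAdele (N : ℚ)⁻¹ * t) hx
  have hNN : (N : FinAdele) = algebraMap ℚ FinAdele N := by simp
  have hcc : (c : FinAdele) = algebraMap ℚ FinAdele c := by simp
  simp only [mul_add, ← mul_assoc, hNN, algebraMap_inv_mul hNq, one_mul, hcc] at h1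
  rw [h1, ← map_mul, map_neg, div_eq_inv_mul]
  ring

end

/-! ### Lattices in `𝔸_f^ι` -/

section

open IsDedekindDomain Rat.HeightOneSpectrum Topology

local instance (p : Nat.Primes) : Fact p.1.Prime := ⟨p.2⟩

/-- The subgroup `(c ∏ p, ℤ_p)^ι` of `𝔸_f^ι`, for a rational number `c ≠ 0`. -/
def adeleLattice (ι : Type*) (c : ℚ) : AddSubgroup (ι → FinAdele) where
  carrier := {x | ∀ j, algebraMap ℚ FinAdele c⁻¹ * x j ∈ intAdele}
  zero_mem' j := by simp
  add_mem' ha hb j := by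
    rw [Pi.add_apply, mul_add]
    exact add_mem (ha j) (hb j)
  neg_mem' ha j := by
    rw [Pi.neg_apply, mul_neg]
    exact neg_mem (ha j)

variable {ι : Type*}

theorem mem_adeleLattice {c : ℚ} {x : ι → FinAdele} :
    x ∈ adeleLattice ι c ↔ ∀ j, algebraMap ℚ FinAdele c⁻¹ * x j ∈ intAdele := Iff.rfl

theorem adeleLattice_mul_le (c : ℚ) (k : ℕ) (hk : k ≠ 0) :
    adeleLattice ι (c * k) ≤ adeleLattice ι c := fun x hx j => by
  have hk' : (k : ℚ) ≠ 0 := by exact_mod_cast hk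
  have h : algebraMap ℚ FinAdele c⁻¹ * x j =
      (k : FinAdele) * (algebraMap ℚ FinAdele (c * k)⁻¹ * x j) := by
    have : (k : FinAdele) = algebraMap ℚ FinAdele k := by simp
    rw [this, ← mul_assoc, ← map_mul, mul_inv, mul_left_comm, mul_inv_cancel₀ hk', mul_one]
  rw [h]
  exact mul_mem (natCast_mem_intAdele k) (hx j)

theorem isOpen_adeleLattice [Finite ι] (c : ℚ) :
    IsOpen (adeleLattice ι c : Set (ι → FinAdele)) := by
  have h : (adeleLattice ι c : Set (ι → FinAdele)) =
      ⋂ j, (fun x : ι → FinAdele => algebraMap ℚ FinAdele c⁻¹ * x j) ⁻¹' intAdele := by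
    ext x; simp [mem_adeleLattice]
  rw [h]
  exact isOpen_iInter_of_finite fun j => isOpen_intAdele.preimage (by fun_prop)

theorem isCompact_adeleLattice {c : ℚ} (hc : c ≠ 0) :
    IsCompact (adeleLattice ι c : Set (ι → FinAdele)) := by
  have h : (adeleLattice ι c : Set (ι → FinAdele)) =
      (fun (x : ι → FinAdele) j => algebraMap ℚ FinAdele c * x j) ''
        Set.pi Set.univ fun _ => (intAdele : Set FinAdele) := by
    ext x
    constructor
    · intro hx
      refine ⟨fun j => algebraMap ℚ FinAdele c⁻¹ * x j, fun j _ => hx j, ?_⟩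
      funext j
      simp only
      rw [← mul_assoc, algebraMap_mul_inv hc, one_mul]
    · rintro ⟨y, hy, rfl⟩ j
      simp only
      rw [← mul_assoc, algebraMap_inv_mul hc, one_mul]
      exact hy j trivial
  rw [h]
  exact (isCompact_univ_pi fun _ => isCompact_intAdele).image (by fun_prop)

instance : T2Space FinAdele :=
  inferInstanceAs <| T2Space <| RestrictedProduct
    (fun v : HeightOneSpectrum ℤ => v.adicCompletion ℚ)
    (fun v => (v.adicCompletionIntegers ℚ : Set (v.adicCompletion ℚ))) Filter.cofinite

instance : LocallyCompactSpace FinAdele := by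
  have : WeaklyLocallyCompactSpace FinAdele := ⟨fun x => by
    refine ⟨(fun y => x + y) '' (intAdele : Set FinAdele),
      isCompact_intAdele.image (by fun_prop), ?_⟩
    have h1 := (Homeomorph.addLeft x).isOpenMap _ isOpen_intAdele
    exact h1.mem_nhds ⟨0, zero_mem _, by simp⟩⟩
  infer_instance

theorem exists_mem_adeleLattice [Finite ι] (x : ι → FinAdele) :
    ∃ N : ℕ, N ≠ 0 ∧ x ∈ adeleLattice ι (N : ℚ)⁻¹ := by
  cases nonempty_fintype ι
  choose N hN hx using fun j => exists_nat_mul_mem_intAdele (x j)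
  refine ⟨∏ j, N j, Finset.prod_ne_zero_iff.2 fun j _ => hN j, fun j => ?_⟩
  classical
  have h : algebraMap ℚ FinAdele (((∏ j, N j : ℕ) : ℚ)⁻¹)⁻¹ * x j =
      ((∏ i ∈ Finset.univ.erase j, N i : ℕ) : FinAdele) * (N j * x j) := by
    rw [inv_inv, ← mul_assoc, map_natCast, ← Nat.cast_mul,
      Finset.prod_erase_mul _ _ (Finset.mem_univ j)]
  rw [h]
  exact mul_mem (natCast_mem_intAdele _) (hx j)

/-- The subgroups `(N ∏ p, ℤ_p)^ι` intersect in zero. -/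
theorem eq_zero_of_forall_mem_adeleLattice {x : ι → FinAdele}
    (hx : ∀ N : ℕ, N ≠ 0 → x ∈ adeleLattice ι N) : x = 0 := by
  funext j
  refine FiniteAdeleRing.ext ℚ fun v => ?_
  apply (adicCompletion.padicEquiv v).injective
  change _ = adicCompletion.padicEquiv v 0
  rw [map_zero]
  by_contra hne
  set y := adicCompletion.padicEquiv v (x j v)
  have hp : 1 < ((primesEquiv v : Nat.Primes) : ℕ) := (primesEquiv v : Nat.Primes).2.one_lt
  obtain ⟨k, hk⟩ := pow_unbounded_of_one_lt (‖y‖⁻¹)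
    (show (1 : ℝ) < ((primesEquiv v : Nat.Primes) : ℕ) by exact_mod_cast hp)
  have h1 := (integral_iff_norm_le v _).1
    (hx (((primesEquiv v : Nat.Primes) : ℕ) ^ k) (pow_ne_zero _ (by omega)) j v)
  rw [finAdele_mul_apply, finAdele_algebraMap_apply, map_mul, AlgEquivClass.commutes,
    norm_mul] at h1
  simp only [map_inv₀, map_natCast, norm_inv, Nat.cast_pow, norm_pow, map_pow] at h1
  rw [Padic.norm_p, inv_pow, inv_inv] at h1
  have hy : 0 < ‖y‖ := norm_pos_iff.2 hne
  rw [inv_lt_iff_one_lt_mul₀ hy] at hk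
  linarith

/-- The subgroups `(N ∏ p, ℤ_p)^ι` form a neighbourhood basis of zero. -/
theorem exists_adeleLattice_subset [Finite ι] {U : Set (ι → FinAdele)} (hU : U ∈ 𝓝 0) :
    ∃ N : ℕ, N ≠ 0 ∧ (adeleLattice ι (N : ℚ) : Set (ι → FinAdele)) ⊆ U := by
  obtain ⟨N, hN⟩ := exists_subset_nhds_of_isCompact'
    (V := fun N : ℕ => (adeleLattice ι ((N + 1 : ℕ) : ℚ) : Set (ι → FinAdele))) (U := U)
    (by
      intro a b
      refine ⟨(a + 1) * (b + 1) - 1, ?_, ?_⟩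
      · have := adeleLattice_mul_le (ι := ι) ((a + 1 : ℕ) : ℚ) (b + 1) (by omega)
        rw [← Nat.cast_mul] at this
        simpa [Nat.sub_add_cancel (show 1 ≤ (a + 1) * (b + 1) by nlinarith)] using this
      · have := adeleLattice_mul_le (ι := ι) ((b + 1 : ℕ) : ℚ) (a + 1) (by omega)
        rw [← Nat.cast_mul, mul_comm] at this
        simpa [Nat.sub_add_cancel (show 1 ≤ (a + 1) * (b + 1) by nlinarith)] using this)
    (fun N => isCompact_adeleLattice (by positivity))
    (fun N => (isCompact_adeleLattice (by positivity)).isClosed)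
    (by
      intro x hx
      rw [eq_zero_of_forall_mem_adeleLattice (x := x) fun N hN => ?_]
      · exact hU
      · have := Set.mem_iInter.1 hx (N - 1)
        simpa [Nat.sub_add_cancel (Nat.one_le_iff_ne_zero.2 hN)] using this)
  exact ⟨N + 1, by omega, hN⟩

/-- A compact set is contained in `N⁻¹ ℤ_f^ι` for some `N`, where `ℤ_f = ∏ p, ℤ_p`. -/
theorem exists_subset_adeleLattice [Finite ι] {K : Set (ι → FinAdele)} (hK : IsCompact K) :
    ∃ N : ℕ, N ≠ 0 ∧ K ⊆ (adeleLattice ι (N : ℚ)⁻¹ : Set (ι → FinAdele)) := by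
  have key : ∀ a b : ℕ, a ≠ 0 → b ≠ 0 →
      adeleLattice ι (a : ℚ)⁻¹ ≤ adeleLattice ι ((a * b : ℕ) : ℚ)⁻¹ := by
    intro a b ha hb
    have := adeleLattice_mul_le (ι := ι) (((a * b : ℕ) : ℚ)⁻¹) b hb
    have hb' : (b : ℚ) ≠ 0 := by exact_mod_cast hb
    rwa [Nat.cast_mul, mul_inv, mul_assoc, inv_mul_cancel₀ hb', mul_one, ← mul_inv,
      ← Nat.cast_mul] at this
  obtain ⟨N, hN⟩ := hK.elim_directed_cover
    (fun N : ℕ => (adeleLattice ι ((N + 1 : ℕ) : ℚ)⁻¹ : Set (ι → FinAdele)))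
    (fun N => isOpen_adeleLattice _)
    (fun x _ => by
      obtain ⟨N, hN, hx⟩ := exists_mem_adeleLattice x
      refine Set.mem_iUnion.2 ⟨N - 1, ?_⟩
      simpa [Nat.sub_add_cancel (Nat.one_le_iff_ne_zero.2 hN)] using hx)
    (by
      intro a b
      refine ⟨(a + 1) * (b + 1) - 1, ?_, ?_⟩
      · have := key (a + 1) (b + 1) (by omega) (by omega)
        simpa [Nat.sub_add_cancel (show 1 ≤ (a + 1) * (b + 1) by nlinarith)] using this
      · have := key (b + 1) (a + 1) (by omega) (by omega)
        rw [mul_comm] at this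
        simpa [Nat.sub_add_cancel (show 1 ≤ (a + 1) * (b + 1) by nlinarith)] using this)
  exact ⟨N + 1, by omega, hN⟩

instance : SigmaCompactSpace FinAdele := by
  refine SigmaCompactSpace.of_countable
    (Set.range fun N : ℕ => (fun x : Unit → FinAdele => x ()) ''
      (adeleLattice Unit ((N + 1 : ℕ) : ℚ)⁻¹ : Set (Unit → FinAdele)))
    (Set.countable_range _) ?_ ?_
  · rintro _ ⟨N, rfl⟩
    exact (isCompact_adeleLattice (by positivity)).image (by fun_prop)
  · refine Set.eq_univ_of_forall fun x => ?_
    obtain ⟨N, hN, hx⟩ := exists_mem_adeleLattice (fun _ : Unit => x)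
    refine ⟨_, ⟨N - 1, rfl⟩, fun _ => x, ?_, rfl⟩
    simpa [Nat.sub_add_cancel (Nat.one_le_iff_ne_zero.2 hN)] using hx

/-! ### The additive character -/

theorem adelicChar_algebraMap (q : ℚ) : adelicChar (algebraMap ℚ FinAdele q) = expTwoPiI q :=
  adelicChar_eq (by rw [sub_self]; exact zero_mem intAdele)

theorem exists_rat_sub_mem_intAdele (x : FinAdele) :
    ∃ q : ℚ, x - algebraMap ℚ FinAdele q ∈ intAdele := by
  obtain ⟨q, hq⟩ := exists_rat_add_mem_intAdele x
  exact ⟨-q, by rwa [map_neg, sub_neg_eq_add]⟩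

theorem expTwoPiI_add (z w : ℂ) : expTwoPiI (z + w) = expTwoPiI z * expTwoPiI w := by
  rw [expTwoPiI, mul_add, Complex.exp_add]; rfl

theorem adelicChar_add (x y : FinAdele) : adelicChar (x + y) = adelicChar x * adelicChar y := by
  obtain ⟨p, hp⟩ := exists_rat_sub_mem_intAdele x
  obtain ⟨q, hq⟩ := exists_rat_sub_mem_intAdele y
  have h : x + y - algebraMap ℚ FinAdele (p + q) ∈ intAdele := by
    have := add_mem hp hq
    rw [map_add]
    convert this using 1
    ring
  rw [adelicChar_eq hp, adelicChar_eq hq, adelicChar_eq h, ← expTwoPiI_add]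
  push_cast; rfl

theorem adelicChar_of_mem {x : FinAdele} (hx : x ∈ intAdele) : adelicChar x = 1 := by
  have h : x - algebraMap ℚ FinAdele 0 ∈ intAdele := by simpa using hx
  rw [adelicChar_eq h]
  simp [expTwoPiI]

theorem adelicChar_zero : adelicChar 0 = 1 := adelicChar_of_mem (zero_mem _)

theorem adelicChar_sum {κ : Type*} (s : Finset κ) (f : κ → FinAdele) :
    adelicChar (∑ k ∈ s, f k) = ∏ k ∈ s, adelicChar (f k) := by
  classical
  induction s using Finset.induction_on with
  | empty => simp [adelicChar_zero]
  | insert a s ha ih => rw [Finset.sum_insert ha, Finset.prod_insert ha, adelicChar_add, ih]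

theorem expTwoPiI_eq_one_iff {q : ℚ} : expTwoPiI q = 1 ↔ ∃ z : ℤ, q = z := by
  rw [expTwoPiI, Complex.exp_eq_one_iff]
  have hne : (2 * Real.pi * Complex.I : ℂ) ≠ 0 := Complex.two_pi_I_ne_zero
  refine exists_congr fun z => ?_
  rw [mul_comm (z : ℂ), mul_right_inj' hne]
  exact_mod_cast Iff.rfl

/-- Since `x` is rational modulo integral adeles, the kernel of the character is exactly
`∏ p, ℤ_p`. -/
theorem mem_intAdele_of_adelicChar_eq_one {x : FinAdele} (h : adelicChar x = 1) :
    x ∈ intAdele := by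
  obtain ⟨p, hp⟩ := exists_rat_sub_mem_intAdele x
  rw [adelicChar_eq hp, expTwoPiI_eq_one_iff] at h
  obtain ⟨z, rfl⟩ := h
  have := add_mem hp (intCast_mem_intAdele z)
  simpa using this

end

/-! ### Coordinates and integration on `V(𝔸_f)` -/

section

open Topology

/-- The integral of a function which is invariant under a subgroup `L` and supported on finitely
many cosets `p a + L`. -/
theorem integral_eq_sum_cosets {G α : Type*} [AddCommGroup G] [MeasurableSpace G]
    [MeasurableAdd G] (μ : Measure G) [μ.IsAddLeftInvariant] (L : AddSubgroup G)
    (hL : MeasurableSet (L : Set G)) (hfin : μ L ≠ ⊤) [Fintype α] (p : α → G) (F : G → ℂ)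
    (hinv : ∀ x, ∀ w ∈ L, F (x + w) = F x) (hsupp : ∀ x, F x ≠ 0 → ∃ a, x - p a ∈ L)
    (hinj : ∀ a b, p a - p b ∈ L → a = b) :
    ∫ x, F x ∂μ = μ.real L * ∑ a, F (p a) := by
  classical
  have hF : F = fun x => ∑ a, Set.indicator ((fun y => -p a + y) ⁻¹' (L : Set G))
      (fun _ => F (p a)) x := by
    funext x
    by_cases hx : F x = 0
    · rw [hx, Finset.sum_eq_zero]
      intro a _
      rw [Set.indicator_apply]
      split_ifs with h
      · have := hinv (p a) _ h
        rw [add_neg_cancel_left] at this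
        rw [← this, hx]
      · rfl
    · obtain ⟨a, ha⟩ := hsupp x hx
      rw [Finset.sum_eq_single a]
      · have h : x ∈ (fun y => -p a + y) ⁻¹' (L : Set G) := by
          simpa [sub_eq_neg_add] using ha
        rw [Set.indicator_of_mem h]
        have := hinv (p a) _ ha
        rw [add_sub_cancel] at this
        exact this
      · intro b _ hb
        refine Set.indicator_of_notMem (fun h => hb (hinj _ _ ?_)) _
        have h2 := sub_mem ha h
        have : x - p a - (-p b + x) = p b - p a := by abel
        rwa [this] at h2
      · simp
  have hms : ∀ a, MeasurableSet ((fun y => -p a + y) ⁻¹' (L : Set G)) := fun a =>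
    (measurable_const_add _) hL
  have hmu : ∀ a, μ ((fun y => -p a + y) ⁻¹' (L : Set G)) = μ L := fun a =>
    measure_preimage_add _ _ _
  have hint : ∫ x, F x ∂μ = ∫ x, ∑ a, Set.indicator ((fun y => -p a + y) ⁻¹' (L : Set G))
      (fun _ => F (p a)) x ∂μ := by rw [← hF]
  rw [hint, integral_finsetSum]
  · simp only [integral_indicator_const _ (hms _), Measure.real, hmu]
    rw [Finset.mul_sum]
    simp [Complex.real_smul]
  · intro a _
    rw [integrable_indicator_iff (hms a)]
    exact integrableOn_const (by rw [hmu]; exact hfin)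

variable {V : Type*} [AddCommGroup V] [Module ℚ V] {n : ℕ}

instance : IsModuleTopology FinAdele (AdelicPts V) := ⟨rfl⟩
instance : IsTopologicalAddGroup (AdelicPts V) := IsModuleTopology.topologicalAddGroup FinAdele _
instance : ContinuousSMul FinAdele (AdelicPts V) := IsModuleTopology.toContinuousSMul _ _
instance : IsModuleTopology ℝ (RealPts V) := ⟨rfl⟩
instance : IsTopologicalAddGroup (RealPts V) := IsModuleTopology.topologicalAddGroup ℝ _
instance : ContinuousSMul ℝ (RealPts V) := IsModuleTopology.toContinuousSMul _ _

/-- The coordinates of a point of `V(𝔸_f)` with respect to a basis of `V`. -/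
def adelicCoord (b : Basis (Fin n) ℚ V) : AdelicPts V ≃ₗ[FinAdele] (Fin n → FinAdele) :=
  (Algebra.TensorProduct.basis FinAdele b).equivFun

theorem continuous_adelicCoord (b : Basis (Fin n) ℚ V) : Continuous (adelicCoord b) :=
  IsModuleTopology.continuous_of_linearMap (adelicCoord b).toLinearMap

theorem continuous_adelicCoord_symm (b : Basis (Fin n) ℚ V) :
    Continuous (adelicCoord b).symm :=
  IsModuleTopology.continuous_of_linearMap (adelicCoord b).symm.toLinearMap

theorem adelicCoord_symm_apply (b : Basis (Fin n) ℚ V) (x : Fin n → FinAdele) :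
    (adelicCoord b).symm x = ∑ k, x k ⊗ₜ[ℚ] b k := by
  simp [adelicCoord, Basis.equivFun_symm_apply, TensorProduct.smul_tmul']

theorem adelicCoord_tmul (b : Basis (Fin n) ℚ V) (x : FinAdele) (j : Fin n) :
    adelicCoord b (x ⊗ₜ[ℚ] b j) = Pi.single j x := by
  rw [← LinearEquiv.eq_symm_apply, adelicCoord_symm_apply, Finset.sum_eq_single j]
  · simp
  · intro k _ hk
    rw [Pi.single_eq_of_ne hk, TensorProduct.zero_tmul]
  · simp

theorem adelicCoord_one_tmul (b : Basis (Fin n) ℚ V) (v : V) (j : Fin n) :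
    adelicCoord b (1 ⊗ₜ[ℚ] v) j = algebraMap ℚ FinAdele (b.repr v j) := by
  simp [adelicCoord]

theorem pairing_adelicCoord [FiniteDimensional ℚ V] (b : Basis (Fin n) ℚ V)
    (t : AdelicPts (Dual ℚ V)) (v : AdelicPts V) :
    pairing FinAdele t v = ∑ k, adelicCoord b.dualBasis t k * adelicCoord b v k := by
  obtain ⟨y, rfl⟩ := (adelicCoord b.dualBasis).symm.surjective t
  obtain ⟨x, rfl⟩ := (adelicCoord b).symm.surjective v
  rw [LinearEquiv.apply_symm_apply, LinearEquiv.apply_symm_apply]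
  simp only [adelicCoord_symm_apply, map_sum, LinearMap.sum_apply, pairing_tmul]
  refine Finset.sum_congr rfl fun k _ => ?_
  rw [Finset.sum_eq_single k]
  · simp
  · intro l _ hl
    simp [hl]
  · simp

/-- The lattice `⊕ c ℤ_f b_j` in `V(𝔸_f)`, where `ℤ_f = ∏ p, ℤ_p`. -/
def basisLattice (b : Basis (Fin n) ℚ V) (c : ℚ) : AddSubgroup (AdelicPts V) :=
  (adeleLattice (Fin n) c).comap (adelicCoord b).toLinearMap.toAddMonoidHom

theorem mem_basisLattice {b : Basis (Fin n) ℚ V} {c : ℚ} {v : AdelicPts V} :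
    v ∈ basisLattice b c ↔ ∀ j, algebraMap ℚ FinAdele c⁻¹ * adelicCoord b v j ∈ intAdele := Iff.rfl

theorem isOpen_basisLattice (b : Basis (Fin n) ℚ V) (c : ℚ) :
    IsOpen (basisLattice b c : Set (AdelicPts V)) :=
  (isOpen_adeleLattice c).preimage (continuous_adelicCoord b)

theorem basisLattice_eq_image (b : Basis (Fin n) ℚ V) (c : ℚ) :
    (basisLattice b c : Set (AdelicPts V)) =
      (adelicCoord b).symm '' (adeleLattice (Fin n) c : Set (Fin n → FinAdele)) := by
  ext v
  constructor
  · intro h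
    exact ⟨_, h, by simp⟩
  · rintro ⟨x, hx, rfl⟩
    rw [SetLike.mem_coe, mem_basisLattice, LinearEquiv.apply_symm_apply]
    exact hx

theorem isCompact_basisLattice (b : Basis (Fin n) ℚ V) {c : ℚ} (hc : c ≠ 0) :
    IsCompact (basisLattice b c : Set (AdelicPts V)) := by
  rw [basisLattice_eq_image]
  exact (isCompact_adeleLattice hc).image (continuous_adelicCoord_symm b)

/-- The point `∑ (a_j / N) b_j` of `V`. -/
def ratPoint (b : Basis (Fin n) ℚ V) (N : ℕ) (a : Fin n → ℕ) : V :=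
  ∑ j, ((a j : ℚ) / N) • b j

theorem repr_ratPoint (b : Basis (Fin n) ℚ V) (N : ℕ) (a : Fin n → ℕ) (j : Fin n) :
    b.repr (ratPoint b N a) j = (a j : ℚ) / N := by
  classical
  simp [ratPoint, Finsupp.single_apply]

/-- `Φ` is supported on `N⁻¹ L` and invariant under `N L`, where `L = ⊕ ℤ_f b_j`. -/
structure IsStepFun (b : Basis (Fin n) ℚ V) (N : ℕ) (Φ : AdelicPts V → ℂ) : Prop where
  supp : ∀ v, Φ v ≠ 0 → v ∈ basisLattice b (N : ℚ)⁻¹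
  inv : ∀ v, ∀ w ∈ basisLattice b (N : ℚ), Φ (v + w) = Φ v

theorem basisLattice_mul_le (b : Basis (Fin n) ℚ V) (c : ℚ) (k : ℕ) (hk : k ≠ 0) :
    basisLattice b (c * k) ≤ basisLattice b c := fun v hv =>
  adeleLattice_mul_le c k hk (x := adelicCoord b v) hv

theorem basisLattice_inv_le (b : Basis (Fin n) ℚ V) (N k : ℕ) (hk : k ≠ 0) :
    basisLattice b (N : ℚ)⁻¹ ≤ basisLattice b ((N * k : ℕ) : ℚ)⁻¹ := by
  have := basisLattice_mul_le b (((N * k : ℕ) : ℚ)⁻¹) k hk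
  have hb' : (k : ℚ) ≠ 0 := by exact_mod_cast hk
  rwa [Nat.cast_mul, mul_inv, mul_assoc, inv_mul_cancel₀ hb', mul_one, ← mul_inv,
    ← Nat.cast_mul] at this

/-- A Schwartz–Bruhat function is a function on a finite quotient of lattices. -/
theorem IsSchwartzBruhat.exists_isStepFun {Φ : AdelicPts V → ℂ} (hΦ : IsSchwartzBruhat Φ)
    (b : Basis (Fin n) ℚ V) : ∃ N : ℕ, 2 ≤ N ∧ IsStepFun b N Φ := by
  obtain ⟨hlc, hcs⟩ := hΦ
  obtain ⟨N₀, hN₀, hsupp⟩ := exists_subset_adeleLattice (hcs.isCompact.image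
    (continuous_adelicCoord b))
  have hN₀q : (N₀ : ℚ) ≠ 0 := by exact_mod_cast hN₀
  set K := (basisLattice b (N₀ : ℚ)⁻¹ : Set (AdelicPts V))
  have hKsupp : ∀ v, Φ v ≠ 0 → v ∈ K := fun v hv =>
    hsupp ⟨v, subset_tsupport _ hv, rfl⟩
  have hK : IsCompact K := isCompact_basisLattice b (inv_ne_zero hN₀q)
  -- by compactness of `K`, one lattice of periods serves all points of `K`
  have hopen : IsOpen {p : AdelicPts V × AdelicPts V | Φ (p.1 + p.2) = Φ p.1} := by
    have h1 : IsLocallyConstant fun p : AdelicPts V × AdelicPts V => Φ (p.1 + p.2) - Φ p.1 :=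
      (hlc.comp_continuous (continuous_fst.add continuous_snd)).sub
        (hlc.comp_continuous continuous_fst)
    have h2 := h1.isOpen_fiber 0
    simpa [sub_eq_zero] using h2
  obtain ⟨U, W, hU, hW, hKU, h0W, hUW⟩ := generalized_tube_lemma hK
    (isCompact_singleton (x := (0 : AdelicPts V))) hopen (by
      rintro ⟨v, w⟩ ⟨-, hw⟩
      simp only [Set.mem_singleton_iff] at hw
      simp [hw])
  have hW0 : (adelicCoord b).symm ⁻¹' W ∈ 𝓝 0 :=
    (hW.preimage (continuous_adelicCoord_symm b)).mem_nhds
      (by simpa using h0W rfl)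
  obtain ⟨N₁, hN₁, hN₁W⟩ := exists_adeleLattice_subset hW0
  have hWW : ∀ w ∈ basisLattice b (N₁ : ℚ), w ∈ W := fun w hw => by
    have := hN₁W hw
    simpa using this
  refine ⟨N₀ * (N₁ * 2), ?_, ?_⟩
  · have : 0 < N₀ * N₁ := by positivity
    nlinarith
  refine ⟨fun v hv => basisLattice_inv_le b N₀ _ (by positivity) (hKsupp v hv), fun v w hw => ?_⟩
  have hw1 : w ∈ basisLattice b (N₁ : ℚ) := by
    refine basisLattice_mul_le b N₁ (N₀ * 2) (by positivity) ?_
    convert hw using 2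
    push_cast; ring
  by_cases hv : v ∈ K
  · have := hUW (show (v, w) ∈ U ×ˢ W from ⟨hKU hv, hWW w hw1⟩)
    exact this
  · have hwK : w ∈ K := by
      have h2 : w ∈ basisLattice b ((N₀ : ℚ)⁻¹ * ((N₀ * N₀ * N₁ * 2 : ℕ) : ℚ)) := by
        convert hw using 2
        push_cast; field_simp
      exact basisLattice_mul_le b _ _ (by positivity) h2
    have hvw : v + w ∉ K := fun h => hv (by
      have := sub_mem (H := basisLattice b (N₀ : ℚ)⁻¹) h hwK
      rw [add_sub_cancel_right] at this
      exact this)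
    rw [not_imp_comm.1 (hKsupp _) hv, not_imp_comm.1 (hKsupp _) hvw]

theorem IsStepFun.isSchwartzBruhat {b : Basis (Fin n) ℚ V} {N : ℕ} (hN : N ≠ 0)
    {Φ : AdelicPts V → ℂ} (h : IsStepFun b N Φ) : IsSchwartzBruhat Φ := by
  have hNq : (N : ℚ) ≠ 0 := by exact_mod_cast hN
  constructor
  · refine (IsLocallyConstant.iff_exists_open _).2 fun x => ?_
    refine ⟨(fun y => x + y) '' (basisLattice b (N : ℚ) : Set (AdelicPts V)),
      (Homeomorph.addLeft x).isOpenMap _ (isOpen_basisLattice b _), ⟨0, zero_mem _, by simp⟩, ?_⟩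
    rintro _ ⟨y, hy, rfl⟩
    exact h.inv x y hy
  · refine HasCompactSupport.of_support_subset_isCompact
      (isCompact_basisLattice b (inv_ne_zero hNq)) fun v hv => h.supp v hv

end

/-! ### Regular step functions -/

section

open Topology

/-- The fractions `m / N` with `0 ≤ m < N²` represent all classes of `N⁻¹ ℤ_f` modulo `N ℤ_f`, where
`ℤ_f = ∏ p, ℤ_p`. -/
theorem exists_fin_sub_mem {N : ℕ} (hN : N ≠ 0) {x : FinAdele}
    (hx : algebraMap ℚ FinAdele N * x ∈ intAdele) :
    ∃ m : Fin (N * N),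
      algebraMap ℚ FinAdele (N : ℚ)⁻¹ * (x - algebraMap ℚ FinAdele ((m : ℕ) / N)) ∈ intAdele := by
  have hM : N * N ≠ 0 := mul_ne_zero hN hN
  have hNq : (N : ℚ) ≠ 0 := by exact_mod_cast hN
  obtain ⟨c, z, hz, h⟩ := exists_natCast_sub_mul hM hx
  refine ⟨⟨c % (N * N), Nat.mod_lt _ (Nat.pos_of_ne_zero hM)⟩, ?_⟩
  have hc : (c : ℚ) = (c % (N * N) : ℕ) + (N * N : ℕ) * (c / (N * N) : ℕ) := by
    exact_mod_cast (Nat.mod_add_div c (N * N)).symm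
  have hx' : x = algebraMap ℚ FinAdele ((c : ℚ) / N) + algebraMap ℚ FinAdele N * z := by
    have h1 := congrArg (fun t => algebraMap ℚ FinAdele (N : ℚ)⁻¹ * t) h
    have e1 : ((N * N : ℕ) : FinAdele) = algebraMap ℚ FinAdele N * algebraMap ℚ FinAdele N := by
      simp
    have e2 : (c : FinAdele) = algebraMap ℚ FinAdele c := by simp
    simp only [mul_add, ← mul_assoc, e1, e2, algebraMap_inv_mul hNq, one_mul] at h1
    rw [h1, ← map_mul, div_eq_inv_mul]
  have e : algebraMap ℚ FinAdele (N : ℚ)⁻¹ *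
      (x - algebraMap ℚ FinAdele (((c % (N * N) : ℕ) : ℚ) / N)) =
      z + ((c / (N * N) : ℕ) : FinAdele) := by
    have e3 : ((c / (N * N) : ℕ) : FinAdele) = algebraMap ℚ FinAdele (c / (N * N) : ℕ) := by simp
    have e4 : (N : ℚ)⁻¹ * ((c : ℚ) / N - ((c % (N * N) : ℕ) : ℚ) / N) = (c / (N * N) : ℕ) := by
      rw [hc]; push_cast; field_simp; ring
    rw [hx', e3, ← e4, map_mul, map_sub]
    linear_combination z * algebraMap_inv_mul hNq
  rw [e]
  exact add_mem hz (natCast_mem_intAdele _)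

/-- The fractions `m / N` with `0 ≤ m < N²` are incongruent modulo `N ℤ_f`, where
`ℤ_f = ∏ p, ℤ_p`. -/
theorem fin_eq_of_sub_mem {N : ℕ} (hN : N ≠ 0) {m m' : Fin (N * N)}
    (h : algebraMap ℚ FinAdele (N : ℚ)⁻¹ * (algebraMap ℚ FinAdele ((m : ℕ) / N) -
      algebraMap ℚ FinAdele ((m' : ℕ) / N)) ∈ intAdele) : m = m' := by
  have hNq : (N : ℚ) ≠ 0 := by exact_mod_cast hN
  rw [← map_sub, ← map_mul] at h
  obtain ⟨z, hz⟩ := exists_int_of_mem_intAdele h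
  have h1 : ((m : ℕ) : ℤ) - (m' : ℕ) = (N * N : ℕ) * z := by
    have : ((m : ℕ) : ℚ) - (m' : ℕ) = (N * N : ℕ) * z := by
      rw [← hz]; push_cast; field_simp
    exact_mod_cast this
  have h2 := m.2
  have h3 := m'.2
  have h4 : z = 0 := by
    by_contra hne
    rcases lt_or_gt_of_ne hne with hlt | hgt
    · have : ((N * N : ℕ) : ℤ) * z ≤ ((N * N : ℕ) : ℤ) * (-1) :=
        mul_le_mul_of_nonneg_left (by omega) (by positivity)
      omega
    · have : ((N * N : ℕ) : ℤ) * 1 ≤ ((N * N : ℕ) : ℤ) * z :=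
        mul_le_mul_of_nonneg_left (by omega) (by positivity)
      omega
  rw [h4] at h1
  exact Fin.ext (by omega)

variable {V : Type*} [AddCommGroup V] [Module ℚ V] {n : ℕ}

/-- The point `1 ⊗ ∑ (a_j / N) b_j` of `V(𝔸_f)`. -/
def gridPoint (b : Basis (Fin n) ℚ V) (N : ℕ) (a : Fin n → Fin (N * N)) : AdelicPts V :=
  1 ⊗ₜ[ℚ] ratPoint b N fun j => a j

theorem adelicCoord_gridPoint (b : Basis (Fin n) ℚ V) (N : ℕ) (a : Fin n → Fin (N * N))
    (j : Fin n) : adelicCoord b (gridPoint b N a) j = algebraMap ℚ FinAdele ((a j : ℕ) / N) := by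
  rw [gridPoint, adelicCoord_one_tmul, repr_ratPoint]

/-- The grid points represent the classes of `N⁻¹ L` modulo `N L`, where `L = ⊕ ℤ_f b_j`; they are
incongruent by `gridPoint_injective`. -/
theorem exists_gridPoint_sub_mem {N : ℕ} (hN : N ≠ 0) (b : Basis (Fin n) ℚ V) {v : AdelicPts V}
    (hv : v ∈ basisLattice b (N : ℚ)⁻¹) :
    ∃ a : Fin n → Fin (N * N), v - gridPoint b N a ∈ basisLattice b (N : ℚ) := by
  choose a ha using fun j => exists_fin_sub_mem hN (x := adelicCoord b v j)
    (by simpa using mem_basisLattice.1 hv j)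
  refine ⟨a, mem_basisLattice.2 fun j => ?_⟩
  rw [map_sub, Pi.sub_apply, adelicCoord_gridPoint]
  exact ha j

theorem gridPoint_injective {N : ℕ} (hN : N ≠ 0) (b : Basis (Fin n) ℚ V)
    {a a' : Fin n → Fin (N * N)}
    (h : gridPoint b N a - gridPoint b N a' ∈ basisLattice b (N : ℚ)) : a = a' := by
  funext j
  have := mem_basisLattice.1 h j
  rw [map_sub, Pi.sub_apply, adelicCoord_gridPoint, adelicCoord_gridPoint] at this
  exact fin_eq_of_sub_mem hN this

theorem IsStepFun.integral_eq {N : ℕ} (hN : N ≠ 0) {b : Basis (Fin n) ℚ V}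
    {Φ : AdelicPts V → ℂ} (h : IsStepFun b N Φ) (ν : Measure (AdelicPts V)) [ν.IsAddHaarMeasure] :
    ∫ v, Φ v ∂ν = ν.real (basisLattice b (N : ℚ)) * ∑ a, Φ (gridPoint b N a) :=
  integral_eq_sum_cosets ν _ (isOpen_basisLattice b _).measurableSet
    (isCompact_basisLattice b (by exact_mod_cast hN)).measure_ne_top (gridPoint b N) Φ h.inv
    (fun v hv => exists_gridPoint_sub_mem hN b (h.supp v hv)) fun _ _ => gridPoint_injective hN b

/-- A function whose sums over one of the variables vanish has total sum zero. -/
theorem sum_eq_zero_of_sum_update {ι β : Type*} [Fintype ι] [DecidableEq ι] [Fintype β]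
    (G : (ι → β) → ℂ) (j : ι) (h : ∀ a, ∑ m, G (Function.update a j m) = 0) :
    ∑ a, G a = 0 := by
  rw [← (Equiv.funSplitAt j β).symm.sum_comp, Fintype.sum_prod_type_right]
  refine Finset.sum_eq_zero fun c _ => ?_
  by_cases hβ : Nonempty β
  · obtain ⟨m₀⟩ := hβ
    rw [← h ((Equiv.funSplitAt j β).symm (m₀, c))]
    refine Finset.sum_congr rfl fun m _ => ?_
    congr 1
    funext i
    by_cases hi : i = j
    · subst hi; simp [Equiv.funSplitAt, Equiv.piSplitAt]
    · simp [Equiv.funSplitAt, Equiv.piSplitAt, hi]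
  · have := not_nonempty_iff.1 hβ
    simp

/-- The value `ψ(⟨m/N, a/N⟩)` of the additive character is a product of roots of unity. -/
def gridChar (N : ℕ) (a m : Fin n → Fin (N * N)) : ℂ :=
  ∏ j, expTwoPiI (((a j : ℕ) * (m j : ℕ) : ℚ) / (N * N : ℚ) : ℚ)

/-- Regularity of a step function with respect to the cone on `b`: it vanishes on the coordinate
hyperplanes, and its sums along the lines of the grid in the coordinate directions vanish. -/
structure IsRegularStep (b : Basis (Fin n) ℚ V) (N : ℕ) (Φ : AdelicPts V → ℂ) : Prop
    extends IsStepFun b N Φ where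
  zero : ∀ v, (∃ k, adelicCoord b v k = 0) → Φ v = 0
  sum : ∀ (a : Fin n → Fin (N * N)) (j : Fin n),
    ∑ m, Φ (gridPoint b N (Function.update a j m)) = 0

theorem IsStepFun.mul_char [FiniteDimensional ℚ V] {N : ℕ} (hN : N ≠ 0) {b : Basis (Fin n) ℚ V}
    {Φ : AdelicPts V → ℂ} (h : IsStepFun b N Φ) {t : AdelicPts (Dual ℚ V)}
    (ht : t ∈ basisLattice b.dualBasis (N : ℚ)⁻¹) :
    IsStepFun b N fun v => Φ v * adelicChar (pairing FinAdele t v) where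
  supp v hv := h.supp v (left_ne_zero_of_mul hv)
  inv v w hw := by
    have hNq : (N : ℚ) ≠ 0 := by exact_mod_cast hN
    rw [h.inv v w hw, map_add, adelicChar_add, adelicChar_of_mem (x := pairing FinAdele t w),
      mul_one]
    rw [pairing_adelicCoord b]
    refine sum_mem fun k _ => ?_
    have h1 := mul_mem (mem_basisLattice.1 ht k) (mem_basisLattice.1 hw k)
    rw [inv_inv, mul_mul_mul_comm, algebraMap_mul_inv hNq, one_mul] at h1
    exact h1

/-- The Fourier transform of a step function is a finite Fourier transform. -/
theorem adelicFourier_eq [FiniteDimensional ℚ V] {N : ℕ} (hN : N ≠ 0) {b : Basis (Fin n) ℚ V}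
    {Φ : AdelicPts V → ℂ} (h : IsStepFun b N Φ) (ν : Measure (AdelicPts V)) [ν.IsAddHaarMeasure]
    {t : AdelicPts (Dual ℚ V)} (ht : t ∈ basisLattice b.dualBasis (N : ℚ)⁻¹) :
    adelicFourier ν Φ t = ν.real (basisLattice b (N : ℚ)) *
      ∑ a, Φ (gridPoint b N a) * adelicChar (pairing FinAdele t (gridPoint b N a)) :=
  (h.mul_char hN ht).integral_eq hN ν

/-- The dual of the lattice of periods `⊕ N ℤ_f b_j` is `⊕ N⁻¹ ℤ_f b_j*`: outside of it, translation
by a period multiplies the Fourier integral by a character value different from `1`. -/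
theorem adelicFourier_eq_zero [FiniteDimensional ℚ V] {N : ℕ} (hN : N ≠ 0)
    {b : Basis (Fin n) ℚ V}
    {Φ : AdelicPts V → ℂ} (h : IsStepFun b N Φ) (ν : Measure (AdelicPts V)) [ν.IsAddHaarMeasure]
    {t : AdelicPts (Dual ℚ V)} (ht : t ∉ basisLattice b.dualBasis (N : ℚ)⁻¹) :
    adelicFourier ν Φ t = 0 := by
  have hNq : (N : ℚ) ≠ 0 := by exact_mod_cast hN
  rw [mem_basisLattice, not_forall] at ht
  obtain ⟨k, hk⟩ := ht
  rw [inv_inv] at hk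
  have hk' : adelicChar (algebraMap ℚ FinAdele N * adelicCoord b.dualBasis t k) ≠ 1 := fun h' =>
    hk (mem_intAdele_of_adelicChar_eq_one h')
  set w : AdelicPts V := algebraMap ℚ FinAdele N ⊗ₜ[ℚ] b k
  have hw : w ∈ basisLattice b (N : ℚ) := mem_basisLattice.2 fun j => by
    rw [adelicCoord_tmul]
    by_cases hj : j = k
    · subst hj
      rw [Pi.single_eq_same, algebraMap_inv_mul hNq]
      exact one_mem _
    · rw [Pi.single_eq_of_ne hj, mul_zero]
      exact zero_mem _
  have hpw : pairing FinAdele t w = algebraMap ℚ FinAdele N * adelicCoord b.dualBasis t k := by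
    rw [pairing_adelicCoord b, adelicCoord_tmul, Finset.sum_eq_single k]
    · rw [Pi.single_eq_same, mul_comm]
    · intro j _ hj
      rw [Pi.single_eq_of_ne hj, mul_zero]
    · simp
  have h1 : adelicFourier ν Φ t =
      adelicFourier ν Φ t * adelicChar (pairing FinAdele t w) := by
    unfold adelicFourier
    rw [← integral_mul_const, ← integral_add_right_eq_self _ w]
    refine integral_congr_ae (Filter.Eventually.of_forall fun v => ?_)
    simp only
    rw [h.inv v w hw, map_add, adelicChar_add, mul_assoc]
  rw [hpw] at h1
  by_contra hne
  exact hk' (mul_left_cancel₀ hne (by rw [← h1, mul_one]))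

theorem IsStepFun.adelicFourier [FiniteDimensional ℚ V] {N : ℕ} (hN : N ≠ 0)
    {b : Basis (Fin n) ℚ V} {Φ : AdelicPts V → ℂ} (h : IsStepFun b N Φ)
    (ν : Measure (AdelicPts V)) [ν.IsAddHaarMeasure] :
    IsStepFun b.dualBasis N (adelicFourier ν Φ) where
  supp t ht := by
    by_contra hne
    exact ht (adelicFourier_eq_zero hN h ν hne)
  inv t w hw := by
    have hNq : (N : ℚ) ≠ 0 := by exact_mod_cast hN
    refine integral_congr_ae (Filter.Eventually.of_forall fun v => ?_)
    simp only
    by_cases hv : Φ v = 0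
    · rw [hv, zero_mul, zero_mul]
    · have hv' := h.supp v hv
      rw [map_add, LinearMap.add_apply, adelicChar_add,
        adelicChar_of_mem (x := pairing FinAdele w v), mul_one]
      rw [pairing_adelicCoord b]
      refine sum_mem fun k _ => ?_
      have h1 := mul_mem (mem_basisLattice.1 hw k) (mem_basisLattice.1 hv' k)
      rw [inv_inv, mul_mul_mul_comm, algebraMap_inv_mul hNq, one_mul] at h1
      exact h1

theorem gridPoint_mem {N : ℕ} (hN : N ≠ 0) (b : Basis (Fin n) ℚ V) (a : Fin n → Fin (N * N)) :
    gridPoint b N a ∈ basisLattice b (N : ℚ)⁻¹ := mem_basisLattice.2 fun j => by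
  have hNq : (N : ℚ) ≠ 0 := by exact_mod_cast hN
  rw [adelicCoord_gridPoint, inv_inv, ← map_mul, mul_div_cancel₀ _ hNq, map_natCast]
  exact natCast_mem_intAdele _

theorem adelicFourier_gridPoint [FiniteDimensional ℚ V] {N : ℕ} (hN : N ≠ 0)
    {b : Basis (Fin n) ℚ V} {Φ : AdelicPts V → ℂ} (h : IsStepFun b N Φ)
    (ν : Measure (AdelicPts V)) [ν.IsAddHaarMeasure] (m : Fin n → Fin (N * N)) :
    adelicFourier ν Φ (gridPoint b.dualBasis N m) = ν.real (basisLattice b (N : ℚ)) *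
      ∑ a, Φ (gridPoint b N a) * gridChar N a m := by
  rw [adelicFourier_eq hN h ν (gridPoint_mem hN _ m)]
  congr 1
  refine Finset.sum_congr rfl fun a _ => ?_
  congr 1
  rw [pairing_adelicCoord b, adelicChar_sum, gridChar]
  refine Finset.prod_congr rfl fun j _ => ?_
  rw [adelicCoord_gridPoint, adelicCoord_gridPoint, ← map_mul, adelicChar_algebraMap]
  congr 2
  ring

end

/-! ### Regularity of the Fourier transform -/

section

open Topology

variable {V : Type*} [AddCommGroup V] [Module ℚ V] {n : ℕ}

theorem gridPoint_update (b : Basis (Fin n) ℚ V) (N : ℕ) (a : Fin n → Fin (N * N)) (j : Fin n)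
    (m : Fin (N * N)) :
    gridPoint b N (Function.update a j m) = gridPoint b N a +
      (algebraMap ℚ FinAdele ((m : ℕ) / N) - algebraMap ℚ FinAdele ((a j : ℕ) / N)) ⊗ₜ[ℚ] b j := by
  apply (adelicCoord b).injective
  rw [map_add, adelicCoord_tmul]
  funext k
  rw [Pi.add_apply, adelicCoord_gridPoint, adelicCoord_gridPoint]
  by_cases hk : k = j
  · subst hk; simp
  · simp [hk]

/-- The integral of a step function along a line is, up to a nonzero constant, a sum over the
points of the line whose `j`-th coordinate is one of the fractions `m / N`. -/
theorem IsStepFun.integral_line {N : ℕ} (hN : N ≠ 0) {b : Basis (Fin n) ℚ V}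
    {Φ : AdelicPts V → ℂ} (h : IsStepFun b N Φ) (η : Measure FinAdele) [η.IsAddHaarMeasure]
    (v : AdelicPts V) (j : Fin n) :
    ∃ c : ℝ, c ≠ 0 ∧ ∫ x : FinAdele, Φ (v + x ⊗ₜ[ℚ] b j) ∂η =
      c * ∑ m : Fin (N * N),
        Φ (v + (algebraMap ℚ FinAdele ((m : ℕ) / N) - adelicCoord b v j) ⊗ₜ[ℚ] b j) := by
  have hNq : (N : ℚ) ≠ 0 := by exact_mod_cast hN
  set L : AddSubgroup FinAdele :=
    intAdele.toAddSubgroup.comap (AddMonoidHom.mulLeft (algebraMap ℚ FinAdele (N : ℚ)⁻¹))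
  have hmem : ∀ x, x ∈ L ↔ algebraMap ℚ FinAdele (N : ℚ)⁻¹ * x ∈ intAdele := fun x => Iff.rfl
  have hLo : IsOpen (L : Set FinAdele) :=
    isOpen_intAdele.preimage (f := fun x => algebraMap ℚ FinAdele (N : ℚ)⁻¹ * x) (by fun_prop)
  have hLc : IsCompact (L : Set FinAdele) := by
    have : (L : Set FinAdele) = (fun x => algebraMap ℚ FinAdele (N : ℚ) * x) ''
        (intAdele : Set FinAdele) := by
      ext x
      constructor
      · intro hx
        refine ⟨_, hx, ?_⟩
        change algebraMap ℚ FinAdele (N : ℚ) * (algebraMap ℚ FinAdele (N : ℚ)⁻¹ * x) = x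
        rw [← mul_assoc, algebraMap_mul_inv hNq, one_mul]
      · rintro ⟨y, hy, rfl⟩
        rw [SetLike.mem_coe, hmem, ← mul_assoc, algebraMap_inv_mul hNq, one_mul]
        exact hy
    rw [this]
    exact isCompact_intAdele.image (by fun_prop)
  have hcoord : ∀ x : FinAdele, adelicCoord b (v + x ⊗ₜ[ℚ] b j) j = adelicCoord b v j + x := by
    intro x
    rw [map_add, adelicCoord_tmul, Pi.add_apply, Pi.single_eq_same]
  refine ⟨η.real L, ?_, ?_⟩
  · rw [Measure.real, ENNReal.toReal_ne_zero]
    exact ⟨(hLo.measure_pos η ⟨0, zero_mem _⟩).ne', hLc.measure_ne_top⟩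
  · refine integral_eq_sum_cosets η L hLo.measurableSet hLc.measure_ne_top
      (fun m : Fin (N * N) => algebraMap ℚ FinAdele ((m : ℕ) / N) - adelicCoord b v j)
      (fun x => Φ (v + x ⊗ₜ[ℚ] b j)) ?_ ?_ ?_
    · intro x w hw
      rw [TensorProduct.add_tmul, ← add_assoc]
      refine h.inv _ _ (mem_basisLattice.2 fun k => ?_)
      rw [adelicCoord_tmul]
      by_cases hk : k = j
      · subst hk
        rw [Pi.single_eq_same]
        exact hw
      · rw [Pi.single_eq_of_ne hk, mul_zero]
        exact zero_mem _
    · intro x hx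
      have h1 := mem_basisLattice.1 (h.supp _ hx) j
      rw [hcoord, inv_inv] at h1
      obtain ⟨m, hm⟩ := exists_fin_sub_mem hN h1
      refine ⟨m, ?_⟩
      rw [hmem]
      convert hm using 2
      ring
    · intro m m' hmm
      rw [hmem] at hmm
      refine fin_eq_of_sub_mem hN ?_
      convert hmm using 2
      ring

/-- Regularity with respect to a simple cone, in terms of the values of a step function. -/
theorem exists_isRegularStep {Φ : AdelicPts V → ℂ} (hΦ : IsSchwartzBruhat Φ) {Λ : Cone n V}
    {b : Basis (Fin n) ℚ V} (hb : ∀ j, b j = Λ j) (h1 : ConditionP1 Φ Λ) (h2 : ConditionP2 Φ Λ) :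
    ∃ N, 2 ≤ N ∧ IsRegularStep b N Φ := by
  obtain ⟨N, hN, h⟩ := hΦ.exists_isStepFun b
  have hN0 : N ≠ 0 := by omega
  refine ⟨N, hN, h, ?_, ?_⟩
  · intro v hv
    have := h1 (adelicCoord b v) hv
    simp_rw [← hb, ← adelicCoord_symm_apply b, LinearEquiv.symm_apply_apply] at this
    exact this
  · intro a j
    obtain ⟨c, hc, hint⟩ := h.integral_line hN0 Measure.addHaar (gridPoint b N a) j
    have h3 := h2 Measure.addHaar j (gridPoint b N a)
    rw [← hb, hint] at h3
    have h4 := (mul_eq_zero.1 h3).resolve_left (by exact_mod_cast hc)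
    rw [← h4]
    refine Finset.sum_congr rfl fun m _ => ?_
    rw [gridPoint_update, adelicCoord_gridPoint]

theorem IsRegularStep.conditionP1 {N : ℕ} {b : Basis (Fin n) ℚ V} {Φ : AdelicPts V → ℂ}
    (h : IsRegularStep b N Φ) {Λ : Cone n V} (hb : ∀ j, b j = Λ j) : ConditionP1 Φ Λ := by
  rintro x ⟨k, hk⟩
  simp_rw [← hb, ← adelicCoord_symm_apply b]
  exact h.zero _ ⟨k, by rw [LinearEquiv.apply_symm_apply, hk]⟩

/-- The sums over the grid lines determine the integrals over all lines: by periodicity, only the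
class of the line modulo `N L` matters, and lines which miss `N⁻¹ L` contribute nothing. -/
theorem IsRegularStep.conditionP2 {N : ℕ} (hN : N ≠ 0) {b : Basis (Fin n) ℚ V}
    {Φ : AdelicPts V → ℂ}
    (h : IsRegularStep b N Φ) {Λ : Cone n V} (hb : ∀ j, b j = Λ j) : ConditionP2 Φ Λ := by
  intro η _ j v
  rw [← hb]
  obtain ⟨c, -, hint⟩ := h.integral_line hN η v j
  rw [hint]
  apply mul_eq_zero_of_right
  set v' := v - adelicCoord b v j ⊗ₜ[ℚ] b j with hv'
  have hv'j : adelicCoord b v' j = 0 := by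
    rw [hv', map_sub, adelicCoord_tmul, Pi.sub_apply, Pi.single_eq_same, sub_self]
  have hrw : ∀ m : Fin (N * N),
      v + (algebraMap ℚ FinAdele ((m : ℕ) / N) - adelicCoord b v j) ⊗ₜ[ℚ] b j =
        v' + algebraMap ℚ FinAdele ((m : ℕ) / N) ⊗ₜ[ℚ] b j := by
    intro m
    rw [hv', TensorProduct.sub_tmul]; abel
  simp_rw [hrw]
  by_cases hL : v' ∈ basisLattice b (N : ℚ)⁻¹
  · obtain ⟨a, ha⟩ := exists_gridPoint_sub_mem hN b hL
    have hNN : 0 < N * N := Nat.mul_pos (Nat.pos_of_ne_zero hN) (Nat.pos_of_ne_zero hN)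
    have haj : a j = ⟨0, hNN⟩ := by
      symm
      refine fin_eq_of_sub_mem hN ?_
      have := mem_basisLattice.1 ha j
      rw [map_sub, Pi.sub_apply, hv'j, adelicCoord_gridPoint] at this
      simpa using this
    rw [← h.sum a j]
    refine Finset.sum_congr rfl fun m _ => ?_
    rw [gridPoint_update, haj]
    have := h.inv (gridPoint b N a + algebraMap ℚ FinAdele ((m : ℕ) / N) ⊗ₜ[ℚ] b j) _ ha
    simp only [Nat.cast_zero, zero_div, map_zero, sub_zero]
    rw [← this]
    congr 1
    abel
  · rw [mem_basisLattice, not_forall] at hL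
    obtain ⟨k, hk⟩ := hL
    have hkj : k ≠ j := by
      rintro rfl
      rw [hv'j, mul_zero] at hk
      exact hk (zero_mem _)
    refine Finset.sum_eq_zero fun m _ => ?_
    by_contra hne
    have := mem_basisLattice.1 (h.supp _ hne) k
    rw [map_add, adelicCoord_tmul, Pi.add_apply, Pi.single_eq_of_ne hkj, add_zero] at this
    exact hk this

/-- The sum of all powers of a nontrivial `M`-th root of unity. -/
theorem sum_expTwoPiI_eq_zero {M : ℕ} {a : ℕ} (ha : a ≠ 0) (haM : a < M) :
    ∑ m : Fin M, expTwoPiI (((a : ℚ) * (m : ℕ) / M : ℚ) : ℂ) = 0 := by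
  have hM : (M : ℚ) ≠ 0 := by exact_mod_cast (by omega : M ≠ 0)
  have hpow : ∀ m : ℕ, expTwoPiI (((a : ℚ) * m / M : ℚ) : ℂ) =
      expTwoPiI (((a : ℚ) / M : ℚ) : ℂ) ^ m := by
    intro m
    rw [expTwoPiI, expTwoPiI, ← Complex.exp_nat_mul]
    congr 1
    push_cast; ring
  simp_rw [hpow]
  rw [Fin.sum_univ_eq_sum_range (fun m => expTwoPiI (((a : ℚ) / M : ℚ) : ℂ) ^ m)]
  have h1 : expTwoPiI (((a : ℚ) / M : ℚ) : ℂ) ≠ 1 := by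
    rw [Ne, expTwoPiI_eq_one_iff]
    rintro ⟨z, hz⟩
    rw [div_eq_iff hM] at hz
    have hz' : (a : ℤ) = z * M := by exact_mod_cast hz
    have : 0 < z := by
      by_contra hneg
      have : z * (M : ℤ) ≤ 0 := mul_nonpos_of_nonpos_of_nonneg (by omega) (by positivity)
      omega
    nlinarith
  rw [geom_sum_eq h1, ← hpow, mul_div_assoc, div_self hM, mul_one,
    (expTwoPiI_eq_one_iff).2 ⟨a, by simp⟩, sub_self, zero_div]

/-- The Fourier transform preserves regularity. -/
theorem IsRegularStep.adelicFourier [FiniteDimensional ℚ V] {N : ℕ} (hN : N ≠ 0)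
    {b : Basis (Fin n) ℚ V} {Φ : AdelicPts V → ℂ} (h : IsRegularStep b N Φ)
    (ν : Measure (AdelicPts V)) [ν.IsAddHaarMeasure] :
    IsRegularStep b.dualBasis N (adelicFourier ν Φ) where
  toIsStepFun := h.toIsStepFun.adelicFourier hN ν
  zero t := by
    rintro ⟨k, hk⟩
    by_cases ht : t ∈ basisLattice b.dualBasis (N : ℚ)⁻¹
    · rw [adelicFourier_eq hN h.toIsStepFun ν ht]
      apply mul_eq_zero_of_right
      -- if `t` has a zero coordinate, the character is constant along the lines of that direction
      refine sum_eq_zero_of_sum_update _ k fun a => ?_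
      have hp : ∀ m, pairing FinAdele t (gridPoint b N (Function.update a k m)) =
          pairing FinAdele t (gridPoint b N a) := by
        intro m
        rw [gridPoint_update, map_add, pairing_adelicCoord b t (_ ⊗ₜ[ℚ] _), adelicCoord_tmul,
          Finset.sum_eq_zero, add_zero]
        intro j _
        by_cases hj : j = k
        · rw [hj, hk, zero_mul]
        · rw [Pi.single_eq_of_ne hj, mul_zero]
      simp_rw [hp, ← Finset.sum_mul, h.sum a k, zero_mul]
    · exact adelicFourier_eq_zero hN h.toIsStepFun ν ht
  sum m₀ j := by
    simp_rw [adelicFourier_gridPoint hN h.toIsStepFun ν]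
    rw [← Finset.mul_sum, Finset.sum_comm]
    apply mul_eq_zero_of_right
    refine Finset.sum_eq_zero fun a _ => ?_
    rw [← Finset.mul_sum]
    -- `Φ` vanishes at the grid points with `a_j = 0`; at the others the character is nontrivial
    -- along the line
    by_cases ha : (a j : ℕ) = 0
    · rw [h.zero _ ⟨j, ?_⟩, zero_mul]
      rw [adelicCoord_gridPoint, ha]; simp
    · apply mul_eq_zero_of_right
      have hg : ∀ m, gridChar N a (Function.update m₀ j m) =
          expTwoPiI (((a j : ℕ) * (m : ℕ) / (N * N : ℕ) : ℚ) : ℂ) *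
            ∏ k ∈ Finset.univ.erase j,
              expTwoPiI (((a k : ℕ) * (m₀ k : ℕ) : ℚ) / (N * N : ℚ) : ℚ) := by
        intro m
        rw [gridChar, ← Finset.mul_prod_erase _ _ (Finset.mem_univ j), Function.update_self]
        congr 1
        · push_cast; rfl
        · refine Finset.prod_congr rfl fun k hk => ?_
          rw [Function.update_of_ne (Finset.ne_of_mem_erase hk)]
      simp_rw [hg]
      rw [← Finset.sum_mul, sum_expTwoPiI_eq_zero ha (a j).2, zero_mul]

end

/-! ### The compatible Haar measure -/

section

open Topology

variable {V : Type*} [AddCommGroup V] [Module ℚ V] {n : ℕ}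

/-- The coordinates of a point of `V(ℝ)` with respect to a basis of `V`. -/
def realCoord (b : Basis (Fin n) ℚ V) : RealPts V ≃ₗ[ℝ] (Fin n → ℝ) :=
  (Algebra.TensorProduct.basis ℝ b).equivFun

theorem realCoord_one_tmul (b : Basis (Fin n) ℚ V) (v : V) (j : Fin n) :
    realCoord b (1 ⊗ₜ[ℚ] v) j = (b.repr v j : ℝ) := by
  simp [realCoord]

theorem realCoord_symm_apply (b : Basis (Fin n) ℚ V) (x : Fin n → ℝ) :
    (realCoord b).symm x = ∑ k, x k • (1 ⊗ₜ[ℚ] b k : RealPts V) := by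
  simp [realCoord, Basis.equivFun_symm_apply]

theorem continuous_realCoord (b : Basis (Fin n) ℚ V) : Continuous (realCoord b) :=
  IsModuleTopology.continuous_of_linearMap (realCoord b).toLinearMap

/-- The matrix of the real coordinates `ρ_μ(b_j)` of a rational basis `b`. -/
def periodMatrix (ρ : RealPts V ≃ₗ[ℝ] (Fin n → ℝ)) (b : Basis (Fin n) ℚ V) :
    Matrix (Fin n) (Fin n) ℝ := Matrix.of fun j μ => ρ (1 ⊗ₜ[ℚ] b j) μ

theorem toLin'_transpose_periodMatrix (ρ : RealPts V ≃ₗ[ℝ] (Fin n → ℝ)) (b : Basis (Fin n) ℚ V) :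
    Matrix.toLin' (periodMatrix ρ b).transpose = ((realCoord b).symm.trans ρ).toLinearMap := by
  refine LinearMap.ext fun y => ?_
  funext μ
  simp [realCoord_symm_apply, Matrix.mulVec, dotProduct, periodMatrix, mul_comm]

theorem det_periodMatrix_ne_zero (ρ : RealPts V ≃ₗ[ℝ] (Fin n → ℝ)) (b : Basis (Fin n) ℚ V) :
    (periodMatrix ρ b).det ≠ 0 := by
  rw [← Matrix.det_transpose, ← LinearMap.det_toLin', toLin'_transpose_periodMatrix]
  exact (LinearEquiv.isUnit_det' _).ne_zero

theorem sigmaFinite_of_isAddHaarMeasure [FiniteDimensional ℚ V] (ν : Measure (AdelicPts V))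
    [ν.IsAddHaarMeasure] (b : Basis (Fin n) ℚ V) : SigmaFinite ν := by
  have : SigmaCompactSpace (AdelicPts V) := by
    let e : (Fin n → FinAdele) ≃ₜ AdelicPts V :=
      { (adelicCoord b).symm.toEquiv with
        continuous_toFun := continuous_adelicCoord_symm b
        continuous_invFun := continuous_adelicCoord b }
    exact e.symm.isClosedEmbedding.sigmaCompactSpace
  infer_instance

/-- The product of a fundamental parallelotope of a rational lattice with the closure of this
lattice in `V(𝔸_f)` is a fundamental domain of `V(𝔸)/V`. -/
theorem isAddFundamentalDomain_basis (b : Basis (Fin n) ℚ V)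
    (μ : Measure (RealPts V × AdelicPts V)) :
    IsAddFundamentalDomain (diagonal V)
      ((realCoord b ⁻¹' Set.pi Set.univ fun _ => Set.Ico 0 1) ×ˢ
        (basisLattice b 1 : Set (AdelicPts V))) μ := by
  refine IsAddFundamentalDomain.mk' ?_ ?_
  · refine MeasurableSet.nullMeasurableSet (MeasurableSet.prod ?_ ?_)
    · exact (continuous_realCoord b).measurable
        (MeasurableSet.univ_pi fun _ => measurableSet_Ico)
    · exact (isOpen_basisLattice b 1).measurableSet
  · rintro ⟨r, a⟩
    choose q hq using fun j => exists_rat_add_mem_intAdele (adelicCoord b a j)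
    set g : Fin n → ℚ := fun j => q j - ⌊realCoord b r j + q j⌋
    set v : V := ∑ j, g j • b j
    have hv : ∀ j, b.repr v j = g j := by
      classical
      intro j; simp [v, Finsupp.single_apply]
    have key : ∀ w : V, (((1 : ℝ) ⊗ₜ[ℚ] w, (1 : FinAdele) ⊗ₜ[ℚ] w) + (r, a) :
        RealPts V × AdelicPts V) ∈
        (realCoord b ⁻¹' Set.pi Set.univ fun _ => Set.Ico 0 1) ×ˢ
        (basisLattice b 1 : Set (AdelicPts V)) ↔ ∀ j, (b.repr w j + realCoord b r j ∈ Set.Ico 0 1)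
          ∧ algebraMap ℚ FinAdele (b.repr w j) + adelicCoord b a j ∈ intAdele := by
      intro w
      simp only [Prod.mk_add_mk, Set.mem_prod, Set.mem_preimage, Set.mem_pi, Set.mem_univ,
        true_imp_iff, SetLike.mem_coe, mem_basisLattice, map_add, Pi.add_apply,
        realCoord_one_tmul, adelicCoord_one_tmul, inv_one, map_one, one_mul, forall_and]
    -- strong approximation determines the translating vector up to integers, which the fundamental
    -- parallelotope then fixes
    refine ⟨⟨((1 : ℝ) ⊗ₜ[ℚ] v, (1 : FinAdele) ⊗ₜ[ℚ] v), v, rfl⟩, ?_, ?_⟩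
    · refine (key v).2 fun j => ?_
      rw [hv]
      constructor
      · simp only [g, Set.mem_Ico]
        push_cast
        have h1 := Int.floor_le (realCoord b r j + q j)
        have h2 := Int.lt_floor_add_one (realCoord b r j + q j)
        constructor <;> linarith
      · simp only [g]
        rw [map_sub]
        have := sub_mem (hq j) (intCast_mem_intAdele ⌊realCoord b r j + q j⌋)
        convert this using 1
        simp only [map_intCast]
        ring
    · rintro ⟨_, w, rfl⟩ hw
      have hw' := (key w).1 hw
      have : w = v := by
        apply b.repr.injective
        ext j
        rw [hv]
        obtain ⟨h1, h2⟩ := hw' j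
        have h3 := sub_mem h2 (hq j)
        obtain ⟨z, hz⟩ := exists_int_of_mem_intAdele (q := b.repr w j - q j) (by
          rw [map_sub]; convert h3 using 1; ring)
        simp only [g]
        have h4 : b.repr w j = q j + z := by linarith
        have h5 : ⌊realCoord b r j + q j⌋ = -z := by
          rw [Int.floor_eq_iff]
          rw [h4] at h1
          push_cast at h1 ⊢
          constructor <;> linarith [h1.1, h1.2]
        rw [h5, h4]; push_cast; ring
      subst this
      rfl

/-- Compatibility of the measures says that the covolume of a lattice in `V(ℝ)` times the volume of
its closure in `V(𝔸_f)` is `1`. -/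
theorem measure_basisLattice_one [FiniteDimensional ℚ V] {ρ : RealPts V ≃ₗ[ℝ] (Fin n → ℝ)}
    {ν : Measure (AdelicPts V)} [ν.IsAddHaarMeasure] (hν : IsCompatible ρ ν)
    (b : Basis (Fin n) ℚ V) :
    |(periodMatrix ρ b).det| * ν.real (basisLattice b 1) = 1 := by
  have := sigmaFinite_of_isAddHaarMeasure ν b
  have hc : Continuous ρ.symm := IsModuleTopology.continuous_of_linearMap ρ.symm.toLinearMap
  set μ := Measure.map ρ.symm (volume : Measure (Fin n → ℝ))
  have : μ.IsAddLeftInvariant :=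
    isAddLeftInvariant_map (ρ.symm.toLinearMap.toAddMonoidHom.toAddHom) hc.measurable
      ρ.symm.surjective
  have : SFinite μ := by infer_instance
  have : Countable (diagonal V) := by
    have : Countable V := (b.equivFun.toEquiv.countable_iff).2 inferInstance
    exact Set.countable_range _
  have : MeasurableConstVAdd (diagonal V) (RealPts V × AdelicPts V) :=
    ⟨fun g => ((measurable_const_add (g : RealPts V × AdelicPts V).1).comp measurable_fst).prodMk
      ((measurable_const_add (g : RealPts V × AdelicPts V).2).comp measurable_snd)⟩
  have : VAddInvariantMeasure (diagonal V) (RealPts V × AdelicPts V) (μ.prod ν) := by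
    refine ⟨fun g s hs => ?_⟩
    have h1 := (measurePreserving_add_left μ (g : RealPts V × AdelicPts V).1).prod
      (measurePreserving_add_left ν (g : RealPts V × AdelicPts V).2)
    exact h1.measure_preimage hs.nullMeasurableSet
  have h : addCovolume (diagonal V) (RealPts V × AdelicPts V) (μ.prod ν) = 1 := hν
  rw [(isAddFundamentalDomain_basis b _).covolume_eq_volume, Measure.prod_prod,
    Measure.map_apply hc.measurable ((continuous_realCoord b).measurable
        (MeasurableSet.univ_pi fun _ => measurableSet_Ico))] at h
  have hpre : ρ.symm ⁻¹' (realCoord b ⁻¹' Set.pi Set.univ fun _ => Set.Ico (0 : ℝ) 1) =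
      Matrix.toLin' (periodMatrix ρ b).transpose '' Set.pi Set.univ fun _ => Set.Ico (0 : ℝ) 1 := by
    rw [toLin'_transpose_periodMatrix]
    ext t
    constructor
    · intro ht
      exact ⟨_, ht, by simp⟩
    · rintro ⟨y, hy, rfl⟩
      simpa using hy
  rw [hpre, Measure.addHaar_image_linearMap, LinearMap.det_toLin', Matrix.det_transpose,
    Real.volume_pi_Ico] at h
  have h2 := congrArg ENNReal.toReal h
  simpa [ENNReal.toReal_mul, Measure.real] using h2

/-- The normalization of the Haar measure, applied to the lattice spanned by the `N b_j`. -/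
theorem measure_basisLattice [FiniteDimensional ℚ V] {ρ : RealPts V ≃ₗ[ℝ] (Fin n → ℝ)}
    {ν : Measure (AdelicPts V)} [ν.IsAddHaarMeasure] (hν : IsCompatible ρ ν)
    (b : Basis (Fin n) ℚ V) {N : ℕ} (hN : N ≠ 0) :
    (N : ℝ) ^ n * |(periodMatrix ρ b).det| * ν.real (basisLattice b (N : ℚ)) = 1 := by
  have hNq : (N : ℚ) ≠ 0 := by exact_mod_cast hN
  set b' : Basis (Fin n) ℚ V := b.unitsSMul fun _ => Units.mk0 (N : ℚ) hNq
  have hb' : ∀ j, b' j = (N : ℚ) • b j := fun j => by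
    simp [b', Basis.unitsSMul_apply, Units.smul_def]
  have h := measure_basisLattice_one hν b'
  have hL : basisLattice b' 1 = basisLattice b (N : ℚ) := by
    ext v
    obtain ⟨x, rfl⟩ := (adelicCoord b').symm.surjective v
    rw [mem_basisLattice, mem_basisLattice, LinearEquiv.apply_symm_apply]
    refine forall_congr' fun j => ?_
    have : adelicCoord b ((adelicCoord b').symm x) j = algebraMap ℚ FinAdele N * x j := by
      rw [adelicCoord_symm_apply, map_sum, Finset.sum_apply, Finset.sum_eq_single j]
      · rw [hb', TensorProduct.tmul_smul, TensorProduct.smul_tmul', adelicCoord_tmul,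
          Pi.single_eq_same, Algebra.smul_def]
      · intro k _ hk
        rw [hb', TensorProduct.tmul_smul, TensorProduct.smul_tmul', adelicCoord_tmul,
          Pi.single_eq_of_ne hk.symm]
      · simp
    rw [this, ← mul_assoc, algebraMap_inv_mul hNq, inv_one, map_one]
  have hA : periodMatrix ρ b' = (N : ℝ) • periodMatrix ρ b := by
    ext j μ
    have : (1 : ℝ) ⊗ₜ[ℚ] ((N : ℚ) • b j) = (N : ℝ) • ((1 : ℝ) ⊗ₜ[ℚ] b j) := by
      rw [← TensorProduct.smul_tmul, TensorProduct.smul_tmul', Algebra.smul_def]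
      simp
    simp only [periodMatrix, hb', this, Matrix.of_apply, Matrix.smul_apply, map_smul,
      Pi.smul_apply]
  rw [hL, hA, Matrix.det_smul, abs_mul, Fintype.card_fin] at h
  simpa using h

end

/-! ### The transform `F` -/

section

open Topology

variable {V : Type*} [AddCommGroup V]

/-- The action of `V` on functions by translations. -/
def shiftHom : Multiplicative V →* Module.End ℂ (V → ℂ) where
  toFun w :=
    { toFun := fun f v => f (v - w.toAdd)
      map_add' := fun _ _ => rfl
      map_smul' := fun _ _ => rfl }
  map_one' := by ext f v; simp
  map_mul' w w' := by
    ext f v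
    simp only [LinearMap.coe_mk, AddHom.coe_mk, toAdd_mul, Module.End.mul_apply]
    rw [sub_sub]

/-- The action of the group algebra of `V` on functions. -/
def opHom : AddMonoidAlgebra ℂ V →ₐ[ℂ] Module.End ℂ (V → ℂ) :=
  AddMonoidAlgebra.lift ℂ _ V shiftHom

theorem opHom_apply (d : AddMonoidAlgebra ℂ V) (f : V → ℂ) :
    opHom d f = translationOp d.coeff f := by
  funext v
  rw [opHom, AddMonoidAlgebra.lift_apply, translationOp, Finsupp.sum, Finsupp.sum,
    LinearMap.sum_apply, Finset.sum_apply]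
  rfl

theorem opHom_single (w : V) (c : ℂ) (f : V → ℂ) :
    opHom (AddMonoidAlgebra.single w c) f = fun v => c * f (v - w) := by
  rw [opHom, AddMonoidAlgebra.lift_single]
  rfl

theorem translationOp_support_finite (d : AddMonoidAlgebra ℂ V) {f : V → ℂ}
    (hf : (Function.support f).Finite) : (Function.support (opHom d f)).Finite := by
  classical
  rw [opHom_apply]
  refine (d.coeff.support.finite_toSet.image2 (fun w v => v + w) hf).subset fun v hv => ?_
  rw [Function.mem_support, translationOp, Finsupp.sum] at hv
  obtain ⟨w, hw, hne⟩ := Finset.exists_ne_zero_of_sum_ne_zero hv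
  exact ⟨w, hw, v - w, right_ne_zero_of_mul hne, sub_add_cancel v w⟩

variable [Module ℚ V] [FiniteDimensional ℚ V]

theorem realExp_add (t : RealPts (Dual ℚ V)) (v w : V) :
    realExp t (v + w) = realExp t v * realExp t w := by
  rw [realExp, TensorProduct.tmul_add, map_add, Complex.ofReal_add, mul_add, expTwoPiI_add]
  rfl

theorem realExp_zero (t : RealPts (Dual ℚ V)) : realExp t (0 : V) = 1 := by
  simp [realExp, expTwoPiI]

theorem realExp_eq (t : RealPts (Dual ℚ V)) (v : V) :
    realExp t v = ((Real.exp (-2 * Real.pi * pairing ℝ t (1 ⊗ₜ[ℚ] v)) : ℝ) : ℂ) := by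
  rw [realExp, expTwoPiI, Complex.ofReal_exp]
  congr 1
  push_cast
  linear_combination (2 * Real.pi * (pairing ℝ t (1 ⊗ₜ[ℚ] v) : ℂ)) * Complex.I_mul_I

/-- The character `v ↦ e(i⟨t, v⟩)` of `V`. -/
def realExpHom (t : RealPts (Dual ℚ V)) : Multiplicative V →* ℂ where
  toFun v := realExp t v.toAdd
  map_one' := realExp_zero t
  map_mul' _ _ := realExp_add t _ _

/-- Evaluation at `t` of the symbol of an element of the group algebra. -/
def symbolHom (t : RealPts (Dual ℚ V)) : AddMonoidAlgebra ℂ V →ₐ[ℂ] ℂ :=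
  AddMonoidAlgebra.lift ℂ _ V (realExpHom t)

theorem symbolHom_apply (d : AddMonoidAlgebra ℂ V) (t : RealPts (Dual ℚ V)) :
    symbolHom t d = symbol d.coeff t := by
  rw [symbolHom, AddMonoidAlgebra.lift_apply, symbol]
  rfl

theorem symbolHom_single (w : V) (c : ℂ) (t : RealPts (Dual ℚ V)) :
    symbolHom t (AddMonoidAlgebra.single w c) = c * realExp t w := by
  rw [symbolHom, AddMonoidAlgebra.lift_single]
  rfl

/-- The exponential sum attached to a finitely supported function on `V`. -/
def expSum (g : V → ℂ) (t : RealPts (Dual ℚ V)) : ℂ := ∑ᶠ v, g v * realExp t v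

theorem expSum_add {g g' : V → ℂ} (hg : (Function.support g).Finite)
    (hg' : (Function.support g').Finite) (t : RealPts (Dual ℚ V)) :
    expSum (g + g') t = expSum g t + expSum g' t := by
  rw [expSum, expSum, expSum, ← finsum_add_distrib]
  · simp only [Pi.add_apply, add_mul]
  · exact hg.subset (Function.support_mul_subset_left _ _)
  · exact hg'.subset (Function.support_mul_subset_left _ _)

theorem expSum_smul (c : ℂ) {g : V → ℂ} (hg : (Function.support g).Finite)
    (t : RealPts (Dual ℚ V)) : expSum (c • g) t = c * expSum g t := by
  rw [expSum, expSum, mul_finsum' _ _ (hg.subset (Function.support_mul_subset_left _ _))]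
  simp only [Pi.smul_apply, smul_eq_mul, mul_assoc]

/-- The symbol turns the action of the group algebra into multiplication. -/
theorem expSum_opHom (d : AddMonoidAlgebra ℂ V) {g : V → ℂ} (hg : (Function.support g).Finite)
    (t : RealPts (Dual ℚ V)) : expSum (opHom d g) t = symbolHom t d * expSum g t := by
  induction d using AddMonoidAlgebra.induction_linear with
  | zero => simp [expSum]
  | add d d' h h' =>
    rw [map_add, map_add, LinearMap.add_apply, expSum_add (translationOp_support_finite d hg)
      (translationOp_support_finite d' hg), h, h', add_mul]
  | single w c =>
    rw [opHom_single, symbolHom_single, expSum, expSum,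
      mul_finsum' _ _ (hg.subset (Function.support_mul_subset_left _ _)),
      ← finsum_comp_equiv (Equiv.addRight w)]
    refine finsum_congr fun v => ?_
    rw [Equiv.coe_addRight, add_sub_cancel_right, realExp_add]
    ring

/-- `G` is the fraction `F(f)`, with numerator and denominator computed by means of `d`. -/
structure RepresentsWith (d : AddMonoidAlgebra ℂ V) (f : V → ℂ) (G : RealPts (Dual ℚ V) → ℂ) :
    Prop where
  finite : (Function.support (opHom d f)).Finite
  eq : ∀ t, symbolHom t d * G t = expSum (opHom d f) t

theorem represents_iff {f : V → ℂ} {G : RealPts (Dual ℚ V) → ℂ} :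
    Represents f G ↔ ∃ d : AddMonoidAlgebra ℂ V, d ≠ 0 ∧ RepresentsWith d f G := by
  constructor
  · rintro ⟨d, hd, hfin, h⟩
    refine ⟨.ofCoeff d, fun h0 => hd ?_, ?_, fun t => ?_⟩
    · rw [← AddMonoidAlgebra.coeff_ofCoeff d, h0, AddMonoidAlgebra.coeff_zero]
    · rw [opHom_apply]; exact hfin
    · rw [opHom_apply, symbolHom_apply]; exact h t
  · rintro ⟨d, hd, hfin, h⟩
    refine ⟨d.coeff, fun h0 => hd ?_, ?_, fun t => ?_⟩
    · rw [← AddMonoidAlgebra.ofCoeff_coeff d, h0, AddMonoidAlgebra.ofCoeff_zero]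
    · rw [← opHom_apply]; exact hfin
    · rw [← opHom_apply, ← symbolHom_apply]; exact h t

/-- A common denominator may be introduced; this is what makes representations additive and
unique. -/
theorem RepresentsWith.mul_left {d : AddMonoidAlgebra ℂ V} {f : V → ℂ}
    {G : RealPts (Dual ℚ V) → ℂ} (h : RepresentsWith d f G) (d' : AddMonoidAlgebra ℂ V) :
    RepresentsWith (d' * d) f G where
  finite := by
    rw [map_mul, Module.End.mul_apply]
    exact translationOp_support_finite d' h.finite
  eq t := by
    rw [map_mul, map_mul, Module.End.mul_apply, expSum_opHom d' h.finite, ← h.eq t, mul_assoc]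

theorem RepresentsWith.add {d : AddMonoidAlgebra ℂ V} {f f' : V → ℂ}
    {G G' : RealPts (Dual ℚ V) → ℂ} (h : RepresentsWith d f G) (h' : RepresentsWith d f' G') :
    RepresentsWith d (f + f') (G + G') where
  finite := by
    rw [map_add]
    exact (h.finite.union h'.finite).subset (Function.support_add _ _)
  eq t := by
    rw [map_add, expSum_add h.finite h'.finite, Pi.add_apply, mul_add, h.eq, h'.eq]

theorem Represents.add {f f' : V → ℂ} {G G' : RealPts (Dual ℚ V) → ℂ} (h : Represents f G)
    (h' : Represents f' G') : Represents (f + f') (G + G') := by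
  obtain ⟨d, hd, h⟩ := represents_iff.1 h
  obtain ⟨d', hd', h'⟩ := represents_iff.1 h'
  refine represents_iff.2 ⟨d' * d, mul_ne_zero hd' hd, (h.mul_left d').add ?_⟩
  rw [mul_comm]
  exact h'.mul_left d

theorem Represents.smul {f : V → ℂ} {G : RealPts (Dual ℚ V) → ℂ} (h : Represents f G) (c : ℂ) :
    Represents (c • f) (c • G) := by
  obtain ⟨d, hd, h⟩ := represents_iff.1 h
  refine represents_iff.2 ⟨d, hd, ?_, fun t => ?_⟩
  · rw [map_smul]
    exact h.finite.subset (Function.support_const_smul_subset _ _)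
  · rw [map_smul, expSum_smul _ h.finite, ← h.eq, Pi.smul_apply, smul_eq_mul]
    ring

theorem Represents.zero : Represents (0 : V → ℂ) 0 :=
  represents_iff.2 ⟨1, one_ne_zero, by simp, fun t => by simp [expSum]⟩

theorem Represents.sum {κ : Type*} (s : Finset κ) {f : κ → V → ℂ}
    {G : κ → RealPts (Dual ℚ V) → ℂ} (h : ∀ k ∈ s, Represents (f k) (G k)) :
    Represents (∑ k ∈ s, f k) (∑ k ∈ s, G k) := by
  classical
  induction s using Finset.induction_on with
  | empty => simpa using Represents.zero
  | insert a s ha ih =>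
    rw [Finset.sum_insert ha, Finset.sum_insert ha]
    exact (h a (Finset.mem_insert_self a s)).add
      (ih fun k hk => h k (Finset.mem_insert_of_mem hk))

theorem realExp_add_left (t t' : RealPts (Dual ℚ V)) (v : V) :
    realExp (t + t') v = realExp t v * realExp t' v := by
  rw [realExp, map_add, LinearMap.add_apply, Complex.ofReal_add, mul_add, expTwoPiI_add]
  rfl

/-- The character `t ↦ e(i⟨t, v⟩)` of `V*(ℝ)`. -/
def realExpDualHom (v : V) : Multiplicative (RealPts (Dual ℚ V)) →* ℂ where
  toFun t := realExp t.toAdd v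
  map_one' := by simp [realExp, expTwoPiI]
  map_mul' _ _ := realExp_add_left _ _ v

theorem realExpDualHom_injective :
    Function.Injective (realExpDualHom : V → Multiplicative (RealPts (Dual ℚ V)) →* ℂ) := by
  intro v w h
  rw [← sub_eq_zero, ← Module.forall_dual_apply_eq_zero_iff ℚ]
  intro ℓ
  have h1 : realExp (1 ⊗ₜ[ℚ] ℓ) v = realExp (1 ⊗ₜ[ℚ] ℓ) w :=
    DFunLike.congr_fun h (Multiplicative.ofAdd (1 ⊗ₜ[ℚ] ℓ))
  rw [realExp_eq, realExp_eq, Complex.ofReal_inj, Real.exp_eq_exp, pairing_tmul,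
    pairing_tmul] at h1
  have hpi := Real.pi_pos
  have h2 := mul_left_cancel₀ (by nlinarith : (-2 * Real.pi) ≠ 0) h1
  simp only [one_mul, eq_ratCast, Rat.cast_inj, mul_one] at h2
  rw [map_sub, h2, sub_self]

/-- Independence of characters: the symbol of a nonzero operator is a nonzero function. -/
theorem exists_symbolHom_ne_zero {d : AddMonoidAlgebra ℂ V} (hd : d ≠ 0) :
    ∃ t, symbolHom t d ≠ 0 := by
  by_contra! h
  have hli := (linearIndependent_monoidHom (Multiplicative (RealPts (Dual ℚ V))) ℂ).comp _
    (realExpDualHom_injective (V := V))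
  rw [linearIndependent_iff] at hli
  apply hd
  rw [← AddMonoidAlgebra.ofCoeff_coeff d, hli d.coeff ?_, AddMonoidAlgebra.ofCoeff_zero]
  funext t
  rw [Finsupp.linearCombination_apply, Finsupp.sum, Finset.sum_apply]
  exact (symbolHom_apply d t.toAdd).symm.trans (h t.toAdd)

/-- The zeros of the symbol of a nonzero operator are nowhere dense. -/
theorem dense_symbolHom_ne_zero {d : AddMonoidAlgebra ℂ V} (hd : d ≠ 0) :
    Dense {t | symbolHom t d ≠ 0} := by
  set e := realCoord (finBasis ℚ (Dual ℚ V))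
  have hes : Continuous e.symm := IsModuleTopology.continuous_of_linearMap e.symm.toLinearMap
  have hec : Continuous e := continuous_realCoord _
  -- the symbol is real analytic, and it does not vanish identically
  have han : AnalyticOnNhd ℝ (fun x => symbolHom (e.symm x) d) Set.univ := by
    have : (fun x => symbolHom (e.symm x) d) = fun x => ∑ w ∈ d.coeff.support, d.coeff w *
        Complex.exp ((-2 * Real.pi * pairing ℝ (e.symm x) (1 ⊗ₜ[ℚ] w) : ℝ) : ℂ) := by
      funext x
      rw [symbolHom_apply, symbol, Finsupp.sum]
      refine Finset.sum_congr rfl fun w _ => ?_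
      rw [realExp_eq, Complex.ofReal_exp]
    rw [this]
    refine Finset.analyticOnNhd_fun_sum _ fun w _ => analyticOnNhd_const.mul ?_
    set ℓ : (Fin (finrank ℚ (Dual ℚ V)) → ℝ) →ₗ[ℝ] ℝ :=
      (LinearMap.flip (pairing ℝ).toLinearMap (1 ⊗ₜ[ℚ] w)).comp e.symm.toLinearMap
    have h1 : AnalyticOnNhd ℝ (fun x => ((-2 * Real.pi * ℓ x : ℝ) : ℂ)) Set.univ := by
      have := (Complex.ofRealCLM.comp ((-2 * Real.pi) • ℓ.toContinuousLinearMap)).analyticOnNhd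
        Set.univ
      exact this
    intro x hx
    have h2 := (analyticAt_cexp (z := ((-2 * Real.pi * ℓ x : ℝ) : ℂ))).restrictScalars
      (𝕜 := ℝ)
    exact AnalyticAt.comp (f := fun x => ((-2 * Real.pi * ℓ x : ℝ) : ℂ)) h2 (h1 x hx)
  intro t
  by_contra hcl
  have hnhd : ∀ᶠ t' in 𝓝 t, symbolHom t' d = 0 := by
    have := isClosed_closure.isOpen_compl.mem_nhds hcl
    filter_upwards [this] with t' ht'
    by_contra hne
    exact ht' (subset_closure hne)
  have h0 : (fun x => symbolHom (e.symm x) d) =ᶠ[𝓝 (e t)] 0 := by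
    have h1 : Filter.Tendsto e.symm (𝓝 (e t)) (𝓝 t) := by
      have := hes.tendsto (e t)
      rwa [LinearEquiv.symm_apply_apply] at this
    exact h1.eventually hnhd
  have hz := han.eqOn_zero_of_preconnected_of_eventuallyEq_zero isPreconnected_univ
    (Set.mem_univ _) h0
  obtain ⟨t', ht'⟩ := exists_symbolHom_ne_zero hd
  apply ht'
  have := hz (Set.mem_univ (e t'))
  simpa using this

/-- Two continuous representatives agree where the product of the two symbols is nonzero, which is
a dense set. -/
theorem Represents.unique {f : V → ℂ} {G G' : RealPts (Dual ℚ V) → ℂ} (h : Represents f G)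
    (h' : Represents f G') (hG : Continuous G) (hG' : Continuous G') : G = G' := by
  obtain ⟨d, hd, h⟩ := represents_iff.1 h
  obtain ⟨d', hd', h'⟩ := represents_iff.1 h'
  have hdd := dense_symbolHom_ne_zero (mul_ne_zero hd' hd)
  refine hG.ext_on hdd hG' fun t ht => ?_
  have h1 := (h.mul_left d').eq t
  have h2 := (h'.mul_left d).eq t
  rw [mul_comm d d', ← h1] at h2
  exact (mul_left_cancel₀ ht h2).symm

end

/-! ### The transform of a step function on a cone -/

section

open Topology

/-- The indicator function on `ℚ` of the arithmetic progression `α + δ ℕ`. -/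
def progression (α δ : ℚ) (x : ℚ) : ℂ :=
  open Classical in if ∃ k : ℕ, x = α + δ * k then 1 else 0

/-- The indicator function on `ℚ` of the point `α`. -/
def pointInd (α : ℚ) (x : ℚ) : ℂ := if x = α then 1 else 0

/-- The difference operator reduces a progression to its first term. -/
theorem progression_sub {α δ : ℚ} (hδ : 0 < δ) (x : ℚ) :
    progression α δ x - progression α δ (x - δ) = pointInd α x := by
  have h : (∃ k : ℕ, x - δ = α + δ * k) ↔ ∃ k : ℕ, x = α + δ * (k + 1 : ℕ) := by
    refine exists_congr fun k => ?_
    push_cast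
    constructor <;> intro h <;> linarith
  unfold progression pointInd
  by_cases hx : x = α
  · have h1 : ∃ k : ℕ, x = α + δ * k := ⟨0, by simp [hx]⟩
    have h2 : ¬∃ k : ℕ, x = α + δ * (k + 1 : ℕ) := by
      rintro ⟨k, hk⟩
      have : 0 < δ * (k + 1 : ℕ) := by positivity
      linarith
    rw [if_pos h1, if_neg (h.not.2 h2), if_pos hx, sub_zero]
  · by_cases h1 : ∃ k : ℕ, x = α + δ * k
    · have h2 : ∃ k : ℕ, x = α + δ * (k + 1 : ℕ) := by
        obtain ⟨k, hk⟩ := h1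
        cases k with
        | zero => exact absurd (by simpa using hk) hx
        | succ k => exact ⟨k, hk⟩
      rw [if_pos h1, if_pos (h.2 h2), if_neg hx, sub_self]
    · have h2 : ¬∃ k : ℕ, x = α + δ * (k + 1 : ℕ) := fun ⟨k, hk⟩ => h1 ⟨k + 1, hk⟩
      rw [if_neg h1, if_neg (h.not.2 h2), if_neg hx, sub_self]

variable {V : Type*} [AddCommGroup V] [Module ℚ V] {n : ℕ}

/-- The product of the operators `1 - Δ_w` with `w = N b_j` over `j ∈ S`. -/
def coneOp (b : Basis (Fin n) ℚ V) (N : ℕ) (S : Finset (Fin n)) : AddMonoidAlgebra ℂ V :=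
  ∏ j ∈ S, (1 - AddMonoidAlgebra.single ((N : ℚ) • b j) 1)

/-- The function which is a point indicator in the coordinates of `S`, and the indicator of a
progression with difference `N` in the other coordinates. -/
def progFun (b : Basis (Fin n) ℚ V) (N : ℕ) (a : Fin n → ℕ) (S : Finset (Fin n)) (v : V) : ℂ :=
  ∏ j, if j ∈ S then pointInd ((a j : ℚ) / N) (b.repr v j)
    else progression ((a j : ℚ) / N) N (b.repr v j)

/-- Each factor `1 - Δ_w` of the operator reduces a lattice cone, in one of the directions, to its
vertex. -/
theorem opHom_progFun (b : Basis (Fin n) ℚ V) {N : ℕ} (hN : N ≠ 0) (a : Fin n → ℕ)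
    (S : Finset (Fin n)) : opHom (coneOp b N S) (progFun b N a ∅) = progFun b N a S := by
  classical
  induction S using Finset.induction_on with
  | empty => simp [coneOp]
  | insert i S hi ih =>
    have hN' : (0 : ℚ) < N := by exact_mod_cast Nat.pos_of_ne_zero hN
    rw [coneOp, Finset.prod_insert hi, map_mul, Module.End.mul_apply]
    rw [coneOp] at ih
    rw [ih, map_sub, map_one, LinearMap.sub_apply, Module.End.one_apply, opHom_single]
    funext v
    simp only [Pi.sub_apply, one_mul, progFun]
    rw [← Finset.mul_prod_erase _ _ (Finset.mem_univ i),
      ← Finset.mul_prod_erase _ _ (Finset.mem_univ i),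
      ← Finset.mul_prod_erase _ _ (Finset.mem_univ i), if_neg hi, if_neg hi,
      if_pos (Finset.mem_insert_self i S)]
    have hrep : ∀ j, b.repr (v - (N : ℚ) • b i) j = b.repr v j - if j = i then (N : ℚ) else 0 := by
      intro j
      rw [map_sub, map_smul, Basis.repr_self, Finsupp.sub_apply, Finsupp.smul_apply,
        Finsupp.single_apply]
      by_cases hj : j = i
      · simp [hj]
      · simp [hj, Ne.symm hj]
    rw [hrep, if_pos rfl, ← progression_sub hN', sub_mul]
    congr 1
    · congr 1
      refine Finset.prod_congr rfl fun j hj => ?_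
      simp [Finset.mem_insert, Finset.ne_of_mem_erase hj]
    · congr 1
      refine Finset.prod_congr rfl fun j hj => ?_
      rw [hrep, if_neg (Finset.ne_of_mem_erase hj), sub_zero]
      simp [Finset.mem_insert, Finset.ne_of_mem_erase hj]

open Classical in
/-- After differencing in all directions only the vertex of the lattice cone remains. -/
theorem progFun_univ (b : Basis (Fin n) ℚ V) (N : ℕ) (a : Fin n → ℕ) :
    progFun b N a Finset.univ = Pi.single (M := fun _ => ℂ) (ratPoint b N a) 1 := by
  funext v
  by_cases hv : v = ratPoint b N a
  · rw [hv, Pi.single_eq_same]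
    refine Finset.prod_eq_one fun j _ => ?_
    rw [if_pos (Finset.mem_univ j), repr_ratPoint, pointInd, if_pos rfl]
  · rw [Pi.single_eq_of_ne hv]
    have : ∃ j, b.repr v j ≠ (a j : ℚ) / N := by
      by_contra! h
      apply hv
      apply b.repr.injective
      ext j
      rw [h, repr_ratPoint]
    obtain ⟨j, hj⟩ := this
    refine Finset.prod_eq_zero (Finset.mem_univ j) ?_
    rw [if_pos (Finset.mem_univ j), pointInd, if_neg hj]

theorem gridPoint_sub_mem_iff {N : ℕ} (hN : N ≠ 0) (b : Basis (Fin n) ℚ V) (v : V)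
    (a : Fin n → Fin (N * N)) :
    (1 : FinAdele) ⊗ₜ[ℚ] v - gridPoint b N a ∈ basisLattice b (N : ℚ) ↔
      ∀ j, ∃ z : ℤ, b.repr v j = ((a j : ℕ) : ℚ) / N + N * z := by
  have hNq : (N : ℚ) ≠ 0 := by exact_mod_cast hN
  rw [mem_basisLattice]
  refine forall_congr' fun j => ?_
  rw [map_sub, Pi.sub_apply, adelicCoord_gridPoint, adelicCoord_one_tmul, ← map_sub, ← map_mul]
  constructor
  · intro h
    obtain ⟨z, hz⟩ := exists_int_of_mem_intAdele h
    refine ⟨z, ?_⟩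
    rw [inv_mul_eq_iff_eq_mul₀ hNq] at hz
    linarith
  · rintro ⟨z, hz⟩
    rw [hz, add_sub_cancel_left, inv_mul_cancel_left₀ hNq, map_intCast]
    exact intCast_mem_intAdele z

open Classical in
/-- The restriction of a regular step function to an open cone is a finite combination of
indicator functions of shifted lattice cones. -/
theorem IsRegularStep.mul_indicator_eq {N : ℕ} (hN : N ≠ 0) {b : Basis (Fin n) ℚ V}
    {Φ : AdelicPts V → ℂ} (h : IsRegularStep b N Φ) :
    (fun v : V => Φ (1 ⊗ₜ[ℚ] v) * if ∀ j, 0 < b.repr v j then 1 else 0) =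
      ∑ a : Fin n → Fin (N * N), Φ (gridPoint b N a) • progFun b N (fun j => a j) ∅ := by
  have hN' : (0 : ℚ) < N := by exact_mod_cast Nat.pos_of_ne_zero hN
  have hpos : ∀ a : Fin n → Fin (N * N), Φ (gridPoint b N a) ≠ 0 → ∀ j, 0 < (a j : ℕ) := by
    intro a ha j
    by_contra h0
    refine ha (h.zero _ ⟨j, ?_⟩)
    rw [adelicCoord_gridPoint, show (a j : ℕ) = 0 by omega]
    simp
  -- a point of the lattice cone is congruent to its vertex
  have hprog : ∀ (a : Fin n → Fin (N * N)) (v : V), progFun b N (fun j => a j) ∅ v ≠ 0 →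
      ∀ j, ∃ k : ℕ, b.repr v j = ((a j : ℕ) : ℚ) / N + N * k := by
    intro a v hv j
    have := Finset.prod_ne_zero_iff.1 hv j (Finset.mem_univ j)
    rw [if_neg (Finset.notMem_empty j), progression] at this
    by_contra hne
    rw [if_neg hne] at this
    exact this rfl
  funext v
  rw [Finset.sum_apply]
  by_cases hv : (∀ j, 0 < b.repr v j) ∧ Φ (1 ⊗ₜ[ℚ] v) ≠ 0
  · obtain ⟨hv, hΦ⟩ := hv
    obtain ⟨a, ha⟩ := exists_gridPoint_sub_mem hN b (h.supp _ hΦ)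
    have hval : Φ (gridPoint b N a) = Φ (1 ⊗ₜ[ℚ] v) := by
      rw [← h.inv _ _ ha, add_sub_cancel]
    rw [if_pos hv, mul_one, Finset.sum_eq_single a]
    · rw [Pi.smul_apply, hval, smul_eq_mul]
      have : progFun b N (fun j => a j) ∅ v = 1 := by
        refine Finset.prod_eq_one fun j _ => ?_
        rw [if_neg (Finset.notMem_empty j), progression, if_pos]
        obtain ⟨z, hz⟩ := (gridPoint_sub_mem_iff hN b v a).1 ha j
        have hz0 : 0 ≤ z := by
          by_contra hneg
          have h1 : (z : ℚ) ≤ -1 := by exact_mod_cast (by omega : z ≤ -1)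
          have h2 : ((a j : ℕ) : ℚ) / N < N := by
            rw [div_lt_iff₀ hN']
            exact_mod_cast (a j).2
          have h3 := hv j
          rw [hz] at h3
          nlinarith
        obtain ⟨k, rfl⟩ := Int.eq_ofNat_of_zero_le hz0
        exact ⟨k, by simpa using hz⟩
      rw [this, mul_one]
    · intro a' _ hne
      rw [Pi.smul_apply, smul_eq_mul]
      by_contra h0
      refine hne (gridPoint_injective hN b ?_)
      have h1 : (1 : FinAdele) ⊗ₜ[ℚ] v - gridPoint b N a' ∈ basisLattice b (N : ℚ) := by
        rw [gridPoint_sub_mem_iff hN]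
        intro j
        obtain ⟨k, hk⟩ := hprog a' v (right_ne_zero_of_mul h0) j
        exact ⟨k, by simpa using hk⟩
      have := sub_mem ha h1
      rwa [sub_sub_sub_cancel_left] at this
    · simp
  · have h0 : (Φ (1 ⊗ₜ[ℚ] v) * if ∀ j, 0 < b.repr v j then (1 : ℂ) else 0) = 0 := by
      rw [not_and_or, not_not] at hv
      rcases hv with hv | hv
      · rw [if_neg hv, mul_zero]
      · rw [hv, zero_mul]
    rw [h0]
    symm
    refine Finset.sum_eq_zero fun a _ => ?_
    rw [Pi.smul_apply, smul_eq_mul]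
    by_contra hne
    have hp := hprog a v (right_ne_zero_of_mul hne)
    have h1 : (1 : FinAdele) ⊗ₜ[ℚ] v - gridPoint b N a ∈ basisLattice b (N : ℚ) := by
      rw [gridPoint_sub_mem_iff hN]
      intro j
      obtain ⟨k, hk⟩ := hp j
      exact ⟨k, by simpa using hk⟩
    apply hv
    refine ⟨fun j => ?_, ?_⟩
    · obtain ⟨k, hk⟩ := hp j
      rw [hk]
      have := hpos a (left_ne_zero_of_mul hne) j
      have : (0 : ℚ) < ((a j : ℕ) : ℚ) := by exact_mod_cast this
      positivity
    · have := h.inv (gridPoint b N a) _ h1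
      rw [add_sub_cancel] at this
      rw [this]
      exact left_ne_zero_of_mul hne

variable [FiniteDimensional ℚ V]

/-- `q(y) = exp(-2πy / N)`. -/
def qExp (N : ℕ) (y : ℝ) : ℝ := Real.exp (-2 * Real.pi * y / N)

theorem realExp_ratPoint (b : Basis (Fin n) ℚ V) (N : ℕ) (a : Fin n → ℕ)
    (t : RealPts (Dual ℚ V)) :
    realExp t (ratPoint b N a) = ∏ j, (qExp N (pairing ℝ t (1 ⊗ₜ[ℚ] b j)) : ℂ) ^ a j := by
  rw [realExp_eq, ratPoint, TensorProduct.tmul_sum, map_sum, Finset.mul_sum, Real.exp_sum,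
    Complex.ofReal_prod]
  refine Finset.prod_congr rfl fun j _ => ?_
  rw [← Complex.ofReal_pow, qExp, ← Real.exp_nat_mul]
  congr 2
  have : (1 : ℝ) ⊗ₜ[ℚ] (((a j : ℚ) / N) • b j) = ((a j : ℝ) / N) • ((1 : ℝ) ⊗ₜ[ℚ] b j) := by
    rw [← TensorProduct.smul_tmul, TensorProduct.smul_tmul', Algebra.smul_def]
    simp
  rw [this, map_smul, smul_eq_mul]
  ring

open Classical in
/-- A function whose product with `∏ (1 - q_j^M)` is the exponential polynomial attached to the
values of `Φ` represents the transform of the restriction of `Φ` to the cone. -/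
theorem IsRegularStep.represents {N : ℕ} (hN : N ≠ 0) {b : Basis (Fin n) ℚ V}
    {Φ : AdelicPts V → ℂ} (h : IsRegularStep b N Φ) (G : RealPts (Dual ℚ V) → ℂ)
    (hG : ∀ t, (∏ j, (1 - (qExp N (pairing ℝ t (1 ⊗ₜ[ℚ] b j)) : ℂ) ^ (N * N))) * G t =
      ∑ a : Fin n → Fin (N * N), Φ (gridPoint b N a) *
        ∏ j, (qExp N (pairing ℝ t (1 ⊗ₜ[ℚ] b j)) : ℂ) ^ (a j : ℕ)) :
    Represents (fun v : V => Φ (1 ⊗ₜ[ℚ] v) *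
      if ∀ j, 0 < b.repr v j then 1 else 0) G := by
  have hNq : (N : ℚ) ≠ 0 := by exact_mod_cast hN
  rw [h.mul_indicator_eq hN, represents_iff]
  have hop : opHom (coneOp b N Finset.univ)
      (∑ a : Fin n → Fin (N * N), Φ (gridPoint b N a) • progFun b N (fun j => a j) ∅) =
      ∑ a : Fin n → Fin (N * N), Φ (gridPoint b N a) •
        Pi.single (M := fun _ => ℂ) (ratPoint b N fun j => a j) 1 := by
    rw [map_sum]
    refine Finset.sum_congr rfl fun a _ => ?_
    rw [map_smul, opHom_progFun b hN, progFun_univ]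
  have hfs : ∀ a : Fin n → Fin (N * N), (Function.support
      (Pi.single (M := fun _ => ℂ) (ratPoint b N fun j => a j) 1)).Finite := fun a =>
    (Set.finite_singleton _).subset Pi.support_single_subset
  have hsum : ∀ (s : Finset (Fin n → Fin (N * N))),
      (Function.support (∑ a ∈ s, Φ (gridPoint b N a) •
        Pi.single (M := fun _ => ℂ) (ratPoint b N fun j => a j) 1)).Finite ∧
      ∀ t, expSum (∑ a ∈ s, Φ (gridPoint b N a) •
        Pi.single (M := fun _ => ℂ) (ratPoint b N fun j => a j) 1) t =
        ∑ a ∈ s, Φ (gridPoint b N a) * realExp t (ratPoint b N fun j => a j) := by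
    intro s
    induction s using Finset.induction_on with
    | empty => simp [expSum]
    | insert a s ha ih =>
      have hf : (Function.support (Φ (gridPoint b N a) •
          Pi.single (M := fun _ => ℂ) (ratPoint b N fun j => a j) 1)).Finite :=
        (hfs a).subset (Function.support_const_smul_subset _ _)
      refine ⟨?_, fun t => ?_⟩
      · rw [Finset.sum_insert ha]
        exact (hf.union ih.1).subset (Function.support_add _ _)
      · rw [Finset.sum_insert ha, Finset.sum_insert ha, expSum_add hf ih.1, ih.2,
          expSum_smul _ (hfs a), expSum, finsum_eq_single _ (ratPoint b N fun j => a j)]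
        · rw [Pi.single_eq_same, one_mul]
        · intro v hv
          rw [Pi.single_eq_of_ne hv, zero_mul]
  refine ⟨coneOp b N Finset.univ, ?_, ?_, fun t => ?_⟩
  · refine Finset.prod_ne_zero_iff.2 fun j _ h0 => ?_
    rw [sub_eq_zero, AddMonoidAlgebra.one_def] at h0
    have h1 := congrArg (fun x => AddMonoidAlgebra.coeff x 0) h0
    have h2 : (N : ℚ) • b j ≠ 0 := smul_ne_zero hNq (b.ne_zero j)
    simp [h2] at h1
  · rw [hop]
    exact (hsum _).1
  · rw [hop, (hsum _).2, coneOp, map_prod]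
    have hsym : ∀ j, symbolHom t (1 - AddMonoidAlgebra.single ((N : ℚ) • b j) 1) =
        1 - (qExp N (pairing ℝ t (1 ⊗ₜ[ℚ] b j)) : ℂ) ^ (N * N) := by
      intro j
      rw [map_sub, map_one, symbolHom_single, one_mul, realExp_eq, ← Complex.ofReal_pow, qExp,
        ← Real.exp_nat_mul]
      congr 3
      have : (1 : ℝ) ⊗ₜ[ℚ] ((N : ℚ) • b j) = (N : ℝ) • ((1 : ℝ) ⊗ₜ[ℚ] b j) := by
        rw [← TensorProduct.smul_tmul, TensorProduct.smul_tmul', Algebra.smul_def]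
        simp
      rw [this, map_smul, smul_eq_mul]
      have : (N : ℝ) ≠ 0 := by exact_mod_cast hN
      push_cast
      field_simp
    simp_rw [hsym]
    rw [hG t]
    refine Finset.sum_congr rfl fun a _ => ?_
    rw [realExp_ratPoint]

end

/-! ### Schwartz functions built from exponentials -/

section

open Topology

theorem qExp_pos (N : ℕ) (y : ℝ) : 0 < qExp N y := Real.exp_pos _

theorem hasDerivAt_qExp (N : ℕ) (y : ℝ) :
    HasDerivAt (qExp N) (-2 * Real.pi / N * qExp N y) y := by
  have h : HasDerivAt (fun y : ℝ => -2 * Real.pi * y / N) (-2 * Real.pi / N) y := by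
    have := ((hasDerivAt_id y).const_mul (-2 * Real.pi)).div_const (N : ℝ)
    simpa using this
  exact h.exp.congr_deriv (mul_comm _ _)

/-- The ratio `q^k / (1 + q + ⋯ + q^(M-1))` as a function of `y`. -/
def qRatio (N M k : ℕ) (y : ℝ) : ℂ :=
  ((qExp N y ^ k / ∑ i ∈ Finset.range M, qExp N y ^ i : ℝ) : ℂ)

theorem sum_qExp_pos (N : ℕ) {M : ℕ} (hM : M ≠ 0) (y : ℝ) :
    0 < ∑ i ∈ Finset.range M, qExp N y ^ i :=
  Finset.sum_pos (fun _ _ => pow_pos (qExp_pos N y) _) (Finset.nonempty_range_iff.2 hM)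

/-- The logarithmic derivative of a ratio is a linear combination of ratios. -/
theorem hasDerivAt_qRatio (N : ℕ) {M : ℕ} (hM : M ≠ 0) (k : ℕ) (y : ℝ) :
    HasDerivAt (qRatio N M k) (((-2 * Real.pi / N : ℝ) : ℂ) * qRatio N M k y *
      (k - ∑ i ∈ Finset.range M, (i : ℂ) * qRatio N M i y)) y := by
  have hpow : ∀ i : ℕ, HasDerivAt (fun y => qExp N y ^ i)
      (-2 * Real.pi / N * i * qExp N y ^ i) y := by
    intro i
    refine ((hasDerivAt_qExp N y).fun_pow i).congr_deriv ?_
    rcases i with _ | i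
    · simp
    · rw [Nat.add_sub_cancel, pow_succ]; ring
  have hsum : HasDerivAt (fun y => ∑ i ∈ Finset.range M, qExp N y ^ i)
      (∑ i ∈ Finset.range M, -2 * Real.pi / N * i * qExp N y ^ i) y :=
    HasDerivAt.fun_sum fun i _ => hpow i
  have hD := (sum_qExp_pos N hM y).ne'
  refine ((hpow k).fun_div hsum hD).ofReal_comp.congr_deriv ?_
  have h1 : (∑ i ∈ Finset.range M, -2 * Real.pi / N * i * qExp N y ^ i) =
      -2 * Real.pi / N * ∑ i ∈ Finset.range M, i * qExp N y ^ i := by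
    rw [Finset.mul_sum]; simp only [mul_assoc]
  have h2 : (∑ i ∈ Finset.range M, (i : ℂ) * qRatio N M i y) =
      (((∑ i ∈ Finset.range M, i * qExp N y ^ i) / ∑ i ∈ Finset.range M, qExp N y ^ i : ℝ) : ℂ) := by
    rw [Finset.sum_div, Complex.ofReal_sum]
    refine Finset.sum_congr rfl fun i _ => ?_
    rw [qRatio]; push_cast; ring
  rw [h1, h2, qRatio, ← Complex.ofReal_natCast, ← Complex.ofReal_sub, ← Complex.ofReal_mul,
    ← Complex.ofReal_mul]
  congr 1
  field_simp
  ring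

theorem norm_qRatio_le_one (N : ℕ) {M k : ℕ} (hk : k < M) (y : ℝ) : ‖qRatio N M k y‖ ≤ 1 := by
  have hD := sum_qExp_pos N (show M ≠ 0 by omega) y
  rw [qRatio, Complex.norm_real, Real.norm_of_nonneg
    (div_nonneg (pow_pos (qExp_pos N y) _).le hD.le), div_le_one hD]
  exact Finset.single_le_sum (f := fun i => qExp N y ^ i)
    (fun i _ => (pow_pos (qExp_pos N y) i).le) (Finset.mem_range.2 hk)

/-- The ratio decays exponentially: by `q` where `q ≤ 1`, since `k ≥ 1`, and by `q⁻¹` where `q ≥ 1`,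
since `k + 1` is at most the degree `M - 1` of the denominator. -/
theorem norm_qRatio_le_exp (N : ℕ) {M k : ℕ} (hk : 1 ≤ k) (hkM : k + 2 ≤ M) (y : ℝ) :
    ‖qRatio N M k y‖ ≤ Real.exp (-(2 * Real.pi / N * |y|)) := by
  have hD := sum_qExp_pos N (show M ≠ 0 by omega) y
  have hq := qExp_pos N y
  rw [qRatio, Complex.norm_real, Real.norm_of_nonneg
    (div_nonneg (pow_pos (qExp_pos N y) _).le hD.le), div_le_iff₀ hD]
  have hle : ∀ i < M, qExp N y ^ i ≤ ∑ i ∈ Finset.range M, qExp N y ^ i := fun i hi =>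
    Finset.single_le_sum (f := fun i => qExp N y ^ i)
      (fun i _ => (pow_pos hq i).le) (Finset.mem_range.2 hi)
  have hc : 0 ≤ 2 * Real.pi / N := by positivity
  rcases le_total 0 y with hy | hy
  · have hq1 : qExp N y ≤ 1 := by
      rw [qExp, Real.exp_le_one_iff]
      have : -2 * Real.pi * y / N = -(2 * Real.pi / N * y) := by ring
      rw [this]
      exact neg_nonpos.2 (mul_nonneg hc hy)
    have h1 : Real.exp (-(2 * Real.pi / N * |y|)) = qExp N y := by
      rw [abs_of_nonneg hy, qExp]; congr 1; ring
    rw [h1]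
    calc qExp N y ^ k ≤ qExp N y ^ 1 := pow_le_pow_of_le_one hq.le hq1 hk
      _ = qExp N y * qExp N y ^ 0 := by simp
      _ ≤ _ := mul_le_mul_of_nonneg_left (hle 0 (by omega)) hq.le
  · have hq1 : 1 ≤ qExp N y := by
      rw [qExp, Real.one_le_exp_iff]
      have : -2 * Real.pi * y / N = 2 * Real.pi / N * (-y) := by ring
      rw [this]
      exact mul_nonneg hc (neg_nonneg.2 hy)
    have h1 : Real.exp (-(2 * Real.pi / N * |y|)) = (qExp N y)⁻¹ := by
      rw [abs_of_nonpos hy, qExp, ← Real.exp_neg]; congr 1; ring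
    rw [h1, ← div_eq_inv_mul, le_div_iff₀ hq, ← pow_succ]
    exact (pow_le_pow_right₀ hq1 (by omega : k + 1 ≤ M - 1)).trans (hle (M - 1) (by omega))

/-- The algebra of functions generated by the ratios `q^k / (1 + q + ⋯ + q^(M-1))`. It consists of
bounded functions and is closed under differentiation. -/
def qAlgebra (N M : ℕ) : Subalgebra ℂ (ℝ → ℂ) :=
  Algebra.adjoin ℂ (Set.range fun k : Fin M => qRatio N M k)

theorem qRatio_mem (N : ℕ) {M k : ℕ} (hk : k < M) : qRatio N M k ∈ qAlgebra N M :=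
  Algebra.subset_adjoin ⟨⟨k, hk⟩, rfl⟩

theorem logDeriv_mem (N M k : ℕ) :
    (fun y => ((-2 * Real.pi / N : ℝ) : ℂ) * (k - ∑ i ∈ Finset.range M, (i : ℂ) * qRatio N M i y)) ∈
      qAlgebra N M := by
  have h : (fun y => ((-2 * Real.pi / N : ℝ) : ℂ) *
      (k - ∑ i ∈ Finset.range M, (i : ℂ) * qRatio N M i y)) =
      algebraMap ℂ (ℝ → ℂ) ((-2 * Real.pi / N : ℝ) : ℂ) * (algebraMap ℂ (ℝ → ℂ) k -
        ∑ i ∈ Finset.range M, algebraMap ℂ (ℝ → ℂ) i * qRatio N M i) := by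
    funext y
    simp [Finset.sum_apply]
  rw [h]
  refine mul_mem (Subalgebra.algebraMap_mem _ _) (sub_mem (Subalgebra.algebraMap_mem _ _)
    (sum_mem fun i hi => mul_mem (Subalgebra.algebraMap_mem _ _)
      (qRatio_mem N (Finset.mem_range.1 hi))))

theorem qAlgebra_bounded {N M : ℕ} {f : ℝ → ℂ} (hf : f ∈ qAlgebra N M) :
    ∃ C, ∀ y, ‖f y‖ ≤ C := by
  induction hf using Algebra.adjoin_induction with
  | mem f hf =>
    obtain ⟨k, rfl⟩ := hf
    exact ⟨1, norm_qRatio_le_one N k.2⟩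
  | algebraMap c => exact ⟨‖c‖, fun y => le_rfl⟩
  | add f g _ _ hf hg =>
    obtain ⟨C, hC⟩ := hf
    obtain ⟨D, hD⟩ := hg
    exact ⟨C + D, fun y => (norm_add_le _ _).trans (add_le_add (hC y) (hD y))⟩
  | mul f g _ _ hf hg =>
    obtain ⟨C, hC⟩ := hf
    obtain ⟨D, hD⟩ := hg
    refine ⟨C * D, fun y => ?_⟩
    rw [Pi.mul_apply, norm_mul]
    exact mul_le_mul (hC y) (hD y) (norm_nonneg _) ((norm_nonneg _).trans (hC y))

theorem qAlgebra_deriv {N M : ℕ} {f : ℝ → ℂ} (hf : f ∈ qAlgebra N M) :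
    ∃ f' ∈ qAlgebra N M, ∀ y, HasDerivAt f (f' y) y := by
  induction hf using Algebra.adjoin_induction with
  | mem f hf =>
    obtain ⟨k, rfl⟩ := hf
    have hM : M ≠ 0 := by have := k.2; omega
    refine ⟨_, mul_mem (qRatio_mem N k.2) (logDeriv_mem N M k), fun y => ?_⟩
    refine (hasDerivAt_qRatio N hM k y).congr_deriv ?_
    simp only [Pi.mul_apply]
    ring
  | algebraMap c => exact ⟨0, zero_mem _, fun y => hasDerivAt_const y c⟩
  | add f g _ _ hf hg =>
    obtain ⟨f', hf', h⟩ := hf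
    obtain ⟨g', hg', h'⟩ := hg
    exact ⟨_, add_mem hf' hg', fun y => (h y).add (h' y)⟩
  | mul f g hfm hgm hf hg =>
    obtain ⟨f', hf', h⟩ := hf
    obtain ⟨g', hg', h'⟩ := hg
    exact ⟨_, add_mem (mul_mem hf' hgm) (mul_mem hfm hg'), fun y => (h y).mul (h' y)⟩

/-- All derivatives of a ratio are products of the ratio with bounded functions, so that they decay
as fast as the ratio does. -/
theorem iteratedDeriv_qRatio (N : ℕ) {M k : ℕ} (hk : k < M) (m : ℕ) :
    ∃ p ∈ qAlgebra N M, iteratedDeriv m (qRatio N M k) = qRatio N M k * p ∧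
      Differentiable ℝ (iteratedDeriv m (qRatio N M k)) := by
  have hmain : ∀ m, ∃ p ∈ qAlgebra N M, iteratedDeriv m (qRatio N M k) = qRatio N M k * p := by
    intro m
    induction m with
    | zero => exact ⟨1, one_mem _, by simp⟩
    | succ m ih =>
      obtain ⟨p, hp, h⟩ := ih
      obtain ⟨p', hp', hd⟩ := qAlgebra_deriv hp
      refine ⟨_, add_mem (mul_mem (logDeriv_mem N M k) hp) hp', ?_⟩
      rw [iteratedDeriv_succ, h]
      funext y
      rw [((hasDerivAt_qRatio N (show M ≠ 0 by omega) k y).mul (hd y)).deriv]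
      simp only [Pi.mul_apply, Pi.add_apply]
      ring
  obtain ⟨p, hp, h⟩ := hmain m
  refine ⟨p, hp, h, ?_⟩
  rw [h]
  obtain ⟨f', -, hd⟩ := qAlgebra_deriv (mul_mem (qRatio_mem N hk) hp)
  exact fun y => (hd y).differentiableAt

theorem pow_mul_exp_neg_le {c : ℝ} (hc : 0 < c) (k : ℕ) (x : ℝ) :
    |x| ^ k * Real.exp (-(c * |x|)) ≤ k.factorial / c ^ k := by
  have h := Real.pow_div_factorial_le_exp (c * |x|) (by positivity) k
  rw [Real.exp_neg, ← div_eq_mul_inv, div_le_div_iff₀ (Real.exp_pos _) (pow_pos hc k)]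
  rw [div_le_iff₀ (by positivity), mul_pow] at h
  linarith

/-- The ratio `q^k / (1 + q + ⋯ + q^(M-1))` with `0 < k < M - 1` is a Schwartz function. -/
def qRatioSchwartz (N : ℕ) (hN : N ≠ 0) {M k : ℕ} (hk : 1 ≤ k) (hkM : k + 2 ≤ M) :
    SchwartzMap ℝ ℂ where
  toFun := qRatio N M k
  smooth' := contDiff_of_differentiable_iteratedDeriv fun m _ =>
    (iteratedDeriv_qRatio N (show k < M by omega) m).choose_spec.2.2
  decay' := by
    intro p m
    obtain ⟨f, hf, h, -⟩ := iteratedDeriv_qRatio N (show k < M by omega) m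
    obtain ⟨C, hC⟩ := qAlgebra_bounded hf
    have hc : 0 < 2 * Real.pi / N := by
      have : (0 : ℝ) < N := by exact_mod_cast Nat.pos_of_ne_zero hN
      positivity
    refine ⟨p.factorial / (2 * Real.pi / N) ^ p * C, fun y => ?_⟩
    rw [norm_iteratedFDeriv_eq_norm_iteratedDeriv, h, Pi.mul_apply, norm_mul, ← mul_assoc,
      Real.norm_eq_abs]
    refine mul_le_mul (le_trans ?_ (pow_mul_exp_neg_le hc p y)) (hC y) (norm_nonneg _)
      (by positivity)
    exact mul_le_mul_of_nonneg_left (norm_qRatio_le_exp N hk hkM y) (by positivity)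

/-- `(q^a - q) / (1 - q^M)` is a Schwartz function for `0 < a < M`: after cancelling `1 - q`, it is
`-(q + ⋯ + q^(a-1)) / (1 + q + ⋯ + q^(M-1))`. For `a = 0` nothing is claimed. -/
theorem exists_schwartz_qDiff {N M : ℕ} (hN : N ≠ 0) (a : Fin M) : ∃ g : SchwartzMap ℝ ℂ,
    (a : ℕ) ≠ 0 → ∀ y, (1 - (qExp N y : ℂ) ^ M) * g y = (qExp N y : ℂ) ^ (a : ℕ) - qExp N y := by
  refine ⟨-∑ k : Fin ((a : ℕ) - 1), qRatioSchwartz N hN (M := M) (k := k + 1) (by omega)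
    (by have := k.2; have := a.2; omega), fun ha y => ?_⟩
  have hD := (sum_qExp_pos N (show M ≠ 0 by have := a.2; omega) y).ne'
  set q := qExp N y with hq
  have h1 : (-∑ k : Fin ((a : ℕ) - 1), qRatioSchwartz N hN (M := M) (k := k + 1) (by omega)
      (by have := k.2; have := a.2; omega)) y =
      ((-(q * ∑ k ∈ Finset.range ((a : ℕ) - 1), q ^ k) / ∑ i ∈ Finset.range M, q ^ i : ℝ) : ℂ) := by
    rw [neg_apply, sum_apply]
    change -∑ k : Fin ((a : ℕ) - 1), qRatio N M (k + 1) y = _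
    simp only [qRatio]
    rw [← Complex.ofReal_sum, ← Complex.ofReal_neg]
    congr 1
    rw [← Finset.sum_div, neg_div, Fin.sum_univ_eq_sum_range (fun k => qExp N y ^ (k + 1)),
      Finset.mul_sum]
    simp only [pow_succ']
    rfl
  rw [h1]
  norm_cast
  rw [← mul_neg_geom_sum q M, mul_comm (1 - q) (∑ i ∈ Finset.range M, q ^ i)]
  have h2 := mul_neg_geom_sum q ((a : ℕ) - 1)
  have h3 : q * q ^ ((a : ℕ) - 1) = q ^ (a : ℕ) := by
    rw [← pow_succ', Nat.sub_add_cancel (Nat.one_le_iff_ne_zero.2 ha)]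
  field_simp
  linear_combination -q * h2 + h3

end

/-! ### Fourier transforms in one variable -/

section

open Topology

/-- Termwise integration of the geometric series of `1 / (1 - exp(-δ y))`. The difference in the
numerator makes the integrand bounded at `0` and the series absolutely convergent. -/
theorem hasSum_integral_exp_ratio {α β δ : ℝ} (hα : 0 < α) (hαβ : α ≤ β) (hδ : 0 < δ) (ω : ℝ) :
    HasSum (fun k : ℕ => 1 / ((α + k * δ : ℝ) + ω * Complex.I : ℂ) -
        1 / ((β + k * δ : ℝ) + ω * Complex.I : ℂ))
      (∫ y in Set.Ioi (0 : ℝ), (((Real.exp (-α * y) - Real.exp (-β * y)) /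
        (1 - Real.exp (-δ * y)) : ℝ) : ℂ) * Complex.exp (-ω * Complex.I * y)) := by
  have hre : ∀ γ : ℝ, (-((γ : ℂ) + ω * Complex.I)).re = -γ := fun γ => by simp
  have hint : ∀ γ : ℝ, 0 < γ → IntegrableOn
      (fun y : ℝ => Complex.exp (-((γ : ℂ) + ω * Complex.I) * y)) (Set.Ioi 0) := fun γ hγ =>
    integrableOn_exp_mul_complex_Ioi (by rw [hre]; linarith) 0
  have hval : ∀ γ : ℝ, 0 < γ → ∫ y in Set.Ioi (0 : ℝ),
      Complex.exp (-((γ : ℂ) + ω * Complex.I) * y) = 1 / ((γ : ℂ) + ω * Complex.I) := fun γ hγ => by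
    rw [integral_exp_mul_complex_Ioi (by rw [hre]; linarith) 0]
    rw [Complex.ofReal_zero, mul_zero, Complex.exp_zero, neg_div_neg_eq]
  have hpos : ∀ γ : ℝ, 0 < γ → ∀ k : ℕ, 0 < γ + k * δ := fun γ hγ k => by positivity
  have hβ : 0 < β := hα.trans_le hαβ
  set F : ℕ → ℝ → ℂ := fun k y => Complex.exp (-(((α + k * δ : ℝ) : ℂ) + ω * Complex.I) * y) -
    Complex.exp (-(((β + k * δ : ℝ) : ℂ) + ω * Complex.I) * y) with hF
  have hFint : ∀ k, IntegrableOn (F k) (Set.Ioi 0) := fun k =>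
    (hint _ (hpos α hα k)).sub (hint _ (hpos β hβ k))
  have hFval : ∀ k, ∫ y in Set.Ioi (0 : ℝ), F k y = 1 / ((α + k * δ : ℝ) + ω * Complex.I : ℂ) -
        1 / ((β + k * δ : ℝ) + ω * Complex.I : ℂ) := fun k => by
    rw [hF, integral_sub (hint _ (hpos α hα k)) (hint _ (hpos β hβ k)), hval _ (hpos α hα k),
      hval _ (hpos β hβ k)]
  have hFeq : ∀ k y, F k y = ((Real.exp (-α * y) - Real.exp (-β * y) : ℝ) : ℂ) *
      Complex.exp (-ω * Complex.I * y) * ((Real.exp (-δ * y) : ℝ) : ℂ) ^ k := by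
    intro k y
    rw [hF, Complex.ofReal_sub, Complex.ofReal_exp, Complex.ofReal_exp, Complex.ofReal_exp,
      ← Complex.exp_nat_mul, sub_mul, sub_mul, ← Complex.exp_add, ← Complex.exp_add,
      ← Complex.exp_add, ← Complex.exp_add]
    push_cast
    congr 2 <;> ring
  have hnorm : ∀ k, ∀ y ∈ Set.Ioi (0 : ℝ), ‖F k y‖ =
      Real.exp (-(α + k * δ) * y) - Real.exp (-(β + k * δ) * y) := by
    intro k y hy
    have hle : Real.exp (-β * y) ≤ Real.exp (-α * y) := by
      rw [Real.exp_le_exp]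
      exact mul_le_mul_of_nonneg_right (neg_le_neg hαβ) (le_of_lt hy)
    rw [hFeq, norm_mul, norm_mul, norm_pow, Complex.norm_real, Complex.norm_real, Complex.norm_exp,
      Real.norm_of_nonneg (sub_nonneg.2 hle), Real.norm_of_nonneg (Real.exp_pos _).le,
      show (-(ω : ℂ) * Complex.I * y).re = 0 by simp, Real.exp_zero, mul_one,
      ← Real.exp_nat_mul, sub_mul, ← Real.exp_add, ← Real.exp_add]
    congr 2 <;> ring
  have hnormint : ∀ k, ∫ y in Set.Ioi (0 : ℝ), ‖F k y‖ = 1 / (α + k * δ) - 1 / (β + k * δ) := by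
    intro k
    rw [setIntegral_congr_fun measurableSet_Ioi (hnorm k), integral_sub
      (integrableOn_exp_mul_Ioi (neg_lt_zero.2 (hpos α hα k)) 0)
      (integrableOn_exp_mul_Ioi (neg_lt_zero.2 (hpos β hβ k)) 0),
      integral_exp_mul_Ioi (neg_lt_zero.2 (hpos α hα k)) 0,
      integral_exp_mul_Ioi (neg_lt_zero.2 (hpos β hβ k)) 0]
    rw [mul_zero, mul_zero, Real.exp_zero, neg_div_neg_eq, neg_div_neg_eq]
  have hsummable : Summable fun k => ∫ y in Set.Ioi (0 : ℝ), ‖F k y‖ := by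
    simp_rw [hnormint]
    rw [← summable_nat_add_iff 1]
    have hs : Summable fun k : ℕ => (β - α) / δ ^ 2 * (1 / (((k + 1 : ℕ) : ℝ)) ^ 2) :=
      ((summable_nat_add_iff 1).2 (Real.summable_one_div_nat_pow.2 one_lt_two)).mul_left _
    refine hs.of_nonneg_of_le (fun k => ?_) fun k => ?_
    · rw [sub_nonneg]
      exact one_div_le_one_div_of_le (hpos α hα _) (by linarith)
    · have h1 := hpos α hα (k + 1)
      have h2 := hpos β hβ (k + 1)
      have h3 : (0 : ℝ) < ((k + 1 : ℕ) : ℝ) := by positivity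
      rw [div_sub_div _ _ h1.ne' h2.ne', div_mul_div_comm]
      refine div_le_div₀ (by nlinarith [sub_nonneg.2 hαβ]) (by linarith) (by positivity) ?_
      rw [← mul_pow, sq, mul_comm δ]
      exact mul_le_mul (by linarith) (by linarith) (by positivity) h1.le
  have := hasSum_integral_of_summable_integral_norm hFint hsummable
  simp_rw [hFval] at this
  refine (setIntegral_congr_fun measurableSet_Ioi fun y hy => ?_ :
    (∫ y in Set.Ioi (0 : ℝ), ∑' k, F k y) = _) ▸ this
  have hlt : Real.exp (-δ * y) < 1 := by
    rw [Real.exp_lt_one_iff]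
    nlinarith [mul_pos hδ hy]
  simp only [hFeq]
  rw [tsum_mul_left, tsum_geometric_of_norm_lt_one (by
    rwa [Complex.norm_real, Real.norm_of_nonneg (Real.exp_pos _).le])]
  push_cast
  ring

/-- The partial fractions of the cotangent at two points, with the terms of positive and of
negative index collected in two separate series. -/
theorem cot_pi_mul_sub_of_hasSum {z w : ℂ} (hz : z ∈ Complex.integerComplement)
    (hw : w ∈ Complex.integerComplement) {c S T : ℂ}
    (hS : HasSum (fun k : ℕ => c * (1 / (w + k) - 1 / (z + k))) S)
    (hT : HasSum (fun k : ℕ => c * (1 / (w - (k + 1)) - 1 / (z - (k + 1)))) T) :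
    S + T = c * (Real.pi * Complex.cot (Real.pi * w) - Real.pi * Complex.cot (Real.pi * z)) := by
  have hcot : ∀ {x : ℂ}, x ∈ Complex.integerComplement →
      HasSum (fun k : ℕ => 1 / (x - (k + 1)) + 1 / (x + (k + 1)))
        (Real.pi * Complex.cot (Real.pi * x) - 1 / x) := by
    intro x hx
    rw [cot_series_rep' hx]
    exact (summable_cotTerm hx).hasSum
  have h1 := ((hcot hw).sub (hcot hz)).mul_left c
  have h2 := ((hasSum_nat_add_iff' 1).2 hS).add hT
  have h3 := h1.unique (h2.congr_fun ?_)
  · rw [Finset.sum_range_one] at h3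
    simp only [Nat.cast_zero, add_zero] at h3
    linear_combination -h3
  · intro k
    push_cast
    ring

/-- The one-variable Fourier transform of the Schwartz functions `(q^a - q) / (1 - q^M)` with
`M = N²`: up to constants, it is a difference of two geometric sums divided by `1 - q^M`. This is
the partial fraction expansion of the cotangent. -/
theorem integral_qDiff {N : ℕ} (hN : N ≠ 0) {a : ℕ} (ha : a ≠ 0) (haM : a < N * N) {g : ℝ → ℂ}
    (hgi : Integrable g)
    (hg : ∀ y, (1 - (qExp N y : ℂ) ^ (N * N)) * g y = (qExp N y : ℂ) ^ a - qExp N y) (ξ : ℝ) :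
    (1 - (qExp N ξ : ℂ) ^ (N * N)) * ∫ y, g y * Complex.exp (-2 * Real.pi * Complex.I * (y * ξ)) =
      -(Complex.I / N) *
        (∑ m ∈ Finset.range (N * N), (expTwoPiI ((a : ℂ) / (N * N)) * qExp N ξ) ^ m -
          ∑ m ∈ Finset.range (N * N), (expTwoPiI (1 / (N * N)) * qExp N ξ) ^ m) := by
  have hN0 : (0 : ℝ) < N := by exact_mod_cast Nat.pos_of_ne_zero hN
  have hNc : (N : ℂ) ≠ 0 := by exact_mod_cast hN
  have hpi := Real.pi_pos
  have hpic : (Real.pi : ℂ) ≠ 0 := by exact_mod_cast hpi.ne'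
  set c : ℝ := 2 * Real.pi / N with hc
  have hc0 : 0 < c := by positivity
  set M := N * N with hM
  have hM1 : 1 < M := by omega
  have hqe : ∀ (k : ℕ) (y : ℝ), qExp N y ^ k = Real.exp (-(c * k) * y) := by
    intro k y
    rw [qExp, ← Real.exp_nat_mul, hc]
    congr 1
    field_simp
  -- `g` on the two half-lines; on the negative one, multiply numerator and denominator by `q ^ M`
  have hg1 : ∀ y : ℝ, 0 < y → g y = -(((Real.exp (-(c * (1 : ℕ)) * y) - Real.exp (-(c * a) * y)) /
      (1 - Real.exp (-(c * M) * y)) : ℝ) : ℂ) := by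
    intro y hy
    have hlt : qExp N y ^ M < 1 := by
      rw [hqe, Real.exp_lt_one_iff]
      have : 0 < c * M * y := by positivity
      linarith
    have hne : (1 - (qExp N y : ℂ) ^ M) ≠ 0 := by
      rw [← Complex.ofReal_pow, ← Complex.ofReal_one, ← Complex.ofReal_sub]
      exact_mod_cast (sub_pos.2 hlt).ne'
    apply mul_left_cancel₀ hne
    rw [hg, ← hqe, ← hqe, ← hqe]
    push_cast
    field_simp
    ring
  have hg2 : ∀ y : ℝ, 0 < y → g (-y) =
      -(((Real.exp (-(c * (M - a : ℕ)) * y) - Real.exp (-(c * (M - 1 : ℕ)) * y)) /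
      (1 - Real.exp (-(c * M) * y)) : ℝ) : ℂ) := by
    intro y hy
    have hlt : qExp N y ^ M < 1 := by
      rw [hqe, Real.exp_lt_one_iff]
      have : 0 < c * M * y := by positivity
      linarith
    have hne : (1 - (qExp N y : ℂ) ^ M) ≠ 0 := by
      rw [← Complex.ofReal_pow, ← Complex.ofReal_one, ← Complex.ofReal_sub]
      exact_mod_cast (sub_pos.2 hlt).ne'
    have hinv : qExp N (-y) = (qExp N y)⁻¹ := by
      rw [qExp, qExp, ← Real.exp_neg]; congr 1; ring
    have hq0 : (qExp N y : ℂ) ≠ 0 := by exact_mod_cast (qExp_pos N y).ne'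
    have h1 := hg (-y)
    rw [hinv] at h1
    push_cast at h1
    have hA : (qExp N y : ℂ) ^ M = qExp N y ^ (M - a) * qExp N y ^ a := by
      rw [← pow_add, Nat.sub_add_cancel haM.le]
    have hB : (qExp N y : ℂ) ^ M = qExp N y ^ (M - 1) * qExp N y := by
      rw [← pow_succ, Nat.sub_add_cancel hM1.le]
    apply mul_left_cancel₀ hne
    rw [← hqe, ← hqe, ← hqe]
    push_cast
    have h2 : (1 - (qExp N y : ℂ) ^ M) * g (-y) = -((qExp N y : ℂ) ^ (M - a) -
        qExp N y ^ (M - 1)) := by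
      have h3 := congrArg (fun x => -(qExp N y : ℂ) ^ M * x) h1
      have h4 : -(qExp N y : ℂ) ^ M * ((1 - ((qExp N y : ℂ)⁻¹) ^ M) * g (-y)) =
          (1 - (qExp N y : ℂ) ^ M) * g (-y) := by
        rw [inv_pow]
        field_simp
        ring
      rw [← h4, h3, mul_sub]
      nth_rewrite 1 [hA]
      rw [hB, inv_pow]
      field_simp
      ring
    rw [h2]
    field_simp
  set z : ℂ := (a + N * ξ * Complex.I) / M with hz
  set w : ℂ := (1 + N * ξ * Complex.I) / M with hw
  have hMc : (M : ℂ) = N * N := by rw [hM]; push_cast; rfl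
  have hcc : (c : ℂ) = 2 * Real.pi / N := by rw [hc]; push_cast; rfl
  have hnonint : ∀ k : ℕ, 0 < k → k < M →
      ((k : ℂ) + N * ξ * Complex.I) / M ∈ Complex.integerComplement := by
    rintro k hk hkM ⟨m, hm⟩
    have hMne : (M : ℂ) ≠ 0 := by rw [hMc]; exact mul_ne_zero hNc hNc
    rw [eq_div_iff hMne] at hm
    have := congrArg Complex.re hm
    simp only [Complex.mul_re, Complex.intCast_re, Complex.natCast_re, Complex.intCast_im,
      Complex.natCast_im, Complex.add_re, Complex.mul_im, Complex.I_re, Complex.I_im,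
      Complex.ofReal_re, Complex.ofReal_im, mul_zero, zero_mul, sub_zero, add_zero, mul_one] at this
    have h1 : m * (M : ℤ) = k := by exact_mod_cast this
    rcases le_or_gt m 0 with h | h
    · nlinarith
    · nlinarith
  have hzi : z ∈ Complex.integerComplement := hnonint a (Nat.pos_of_ne_zero ha) haM
  have hwi : w ∈ Complex.integerComplement := by simpa using hnonint 1 one_pos hM1
  have hdiv : ∀ x y : ℂ, x = c * M * y → 1 / x = 1 / (c * M) * (1 / y) := by
    intro x y h
    rw [h, one_div_mul_one_div]
  -- after scaling, the terms of the two series are those of the cotangent at `w` and `z`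
  have hS := hasSum_integral_exp_ratio (α := c * (1 : ℕ)) (β := c * a) (δ := c * M)
    (by positivity) (mul_le_mul_of_nonneg_left (by exact_mod_cast Nat.one_le_iff_ne_zero.2 ha)
      hc0.le) (by positivity) (2 * Real.pi * ξ)
  have hT := hasSum_integral_exp_ratio (α := c * (M - a : ℕ)) (β := c * (M - 1 : ℕ)) (δ := c * M)
    (mul_pos hc0 (by exact_mod_cast Nat.sub_pos_of_lt haM)) (mul_le_mul_of_nonneg_left
      (by exact_mod_cast (by omega : M - a ≤ M - 1)) hc0.le) (by positivity) (-(2 * Real.pi * ξ))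
  have hMne : (M : ℂ) ≠ 0 := by rw [hMc]; exact mul_ne_zero hNc hNc
  have key := cot_pi_mul_sub_of_hasSum (c := 1 / (c * M)) hzi hwi (hS.congr_fun ?_)
    (hT.congr_fun ?_)
  rotate_left
  · intro k
    rw [mul_sub]
    congr 1
    · symm
      apply hdiv
      push_cast
      rw [hw, hcc, hMc]
      field_simp
      ring
    · symm
      apply hdiv
      push_cast
      rw [hz, hcc, hMc]
      field_simp
      ring
  · intro k
    have e1 : 1 / (w - (k + 1)) = -(1 / (-(w - (k + 1)))) := by
      rw [one_div_neg_eq_neg_one_div, neg_neg]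
    have e2 : 1 / (z - (k + 1)) = -(1 / (-(z - (k + 1)))) := by
      rw [one_div_neg_eq_neg_one_div, neg_neg]
    rw [e1, e2, neg_sub_neg, mul_sub]
    congr 1
    · symm
      apply hdiv
      rw [Nat.cast_sub haM.le]
      push_cast
      rw [hz, hcc, hMc]
      field_simp
      ring
    · symm
      apply hdiv
      rw [Nat.cast_sub hM1.le]
      push_cast
      rw [hw, hcc, hMc]
      field_simp
      ring
  have hphase : Continuous fun y : ℝ => Complex.exp (-2 * Real.pi * Complex.I * (y * ξ)) := by
    fun_prop
  have hint : Integrable fun y => g y * Complex.exp (-2 * Real.pi * Complex.I * (y * ξ)) := by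
    refine hgi.mul_bdd (c := 1) hphase.aestronglyMeasurable (.of_forall fun y => ?_)
    rw [Complex.norm_exp]
    simp
  have hsplit : ∫ y, g y * Complex.exp (-2 * Real.pi * Complex.I * (y * ξ)) =
      -(1 / (c * M) * (Real.pi * Complex.cot (Real.pi * w) -
        Real.pi * Complex.cot (Real.pi * z))) := by
    rw [← key, ← intervalIntegral.integral_Iic_add_Ioi hint.integrableOn hint.integrableOn (b := 0),
      ← neg_zero, ← integral_comp_neg_Ioi, neg_zero, neg_add, add_comm]
    congr 1
    · rw [← integral_neg]
      refine setIntegral_congr_fun measurableSet_Ioi fun y hy => ?_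
      rw [hg1 y hy, neg_mul]
      congr 2
      push_cast
      ring_nf
    · rw [← integral_neg]
      refine setIntegral_congr_fun measurableSet_Ioi fun y hy => ?_
      rw [hg2 y hy, neg_mul]
      congr 2
      push_cast
      ring_nf
  -- `cot x` in terms of `u = exp (2 i x)`; multiplied by `1 - u ^ M` it becomes a geometric sum
  have hexp : ∀ k : ℂ, Complex.exp (2 * Complex.I * (Real.pi * ((k + N * ξ * Complex.I) / M))) =
      expTwoPiI (k / (N * N)) * qExp N ξ := by
    intro k
    rw [expTwoPiI, qExp, Complex.ofReal_exp, ← Complex.exp_add, hMc]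
    congr 1
    push_cast
    field_simp
    linear_combination (ξ * N) * Complex.I_sq
  have hroot : ∀ k : ℕ, (expTwoPiI (k / (N * N)) * qExp N ξ) ^ M = (qExp N ξ : ℂ) ^ M := by
    intro k
    rw [mul_pow, expTwoPiI, ← Complex.exp_nat_mul, hMc]
    have : (N * N : ℂ) * (2 * Real.pi * Complex.I * (k / (N * N))) =
        k * (2 * Real.pi * Complex.I) := by
      field_simp
    rw [this, Complex.exp_nat_mul_two_pi_mul_I, one_mul]
  have hcot : ∀ k : ℕ, 0 < k → k < M → (1 - (qExp N ξ : ℂ) ^ M) *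
      Complex.cot (Real.pi * ((k + N * ξ * Complex.I) / M)) =
      -Complex.I * (2 * ∑ m ∈ Finset.range M, (expTwoPiI (k / (N * N)) * qExp N ξ) ^ m -
        (1 - (qExp N ξ : ℂ) ^ M)) := by
    intro k hk hkM
    rw [Complex.cot_eq_exp_ratio, hexp, ← hroot k]
    set u : ℂ := expTwoPiI (k / (N * N)) * qExp N ξ with hu
    have hu1 : 1 - u ≠ 0 := by
      intro h0
      rw [hu, ← hexp, sub_eq_zero, eq_comm, Complex.exp_eq_one_iff] at h0
      obtain ⟨m, hm⟩ := h0
      refine hnonint k hk hkM ⟨m, ?_⟩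
      have h2 : (2 * Complex.I * Real.pi : ℂ) ≠ 0 :=
        mul_ne_zero (mul_ne_zero two_ne_zero Complex.I_ne_zero) hpic
      apply mul_left_cancel₀ h2
      linear_combination -hm
    have hgeom := mul_neg_geom_sum u M
    rw [← hgeom]
    have hI := Complex.I_ne_zero
    field_simp
    linear_combination ((u + 1) * ∑ m ∈ Finset.range M, u ^ m) * Complex.I_sq
  have hA := hcot a (Nat.pos_of_ne_zero ha) haM
  have hB := hcot 1 one_pos hM1
  rw [Nat.cast_one] at hB
  rw [hsplit]
  have h2 : (1 : ℂ) / (c * M) * Real.pi = 1 / (2 * N) := by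
    rw [hcc, hMc]; field_simp
  calc (1 - (qExp N ξ : ℂ) ^ M) * -(1 / (c * M) * (Real.pi * Complex.cot (Real.pi * w) -
        Real.pi * Complex.cot (Real.pi * z)))
      = 1 / (c * M) * Real.pi * ((1 - (qExp N ξ : ℂ) ^ M) * Complex.cot (Real.pi * z) -
        (1 - (qExp N ξ : ℂ) ^ M) * Complex.cot (Real.pi * w)) := by ring
    _ = _ := by
      rw [hA, hB, h2]
      field_simp
      ring

end

/-! ### Products of Schwartz functions and the transform of a cone -/

section

open Topology

/-- The tensor product of Schwartz functions of one variable, with the derivatives bounded by the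
Leibniz rule. -/
theorem exists_schwartz_prod {ι : Type*} [Fintype ι] (g : ι → SchwartzMap ℝ ℂ) :
    ∃ G : SchwartzMap (ι → ℝ) ℂ, ∀ y, G y = ∏ j, g j (y j) := by
  classical
  have hcd : ∀ j, ContDiff ℝ (⊤ : ℕ∞) fun y : ι → ℝ => g j (y j) := fun j =>
    (g j).smooth'.comp (contDiff_apply ℝ ℝ j)
  have hder : ∀ (j : ι) (m : ℕ) (y : ι → ℝ),
      ‖iteratedFDeriv ℝ m (fun y : ι → ℝ => g j (y j)) y‖ ≤ ‖iteratedFDeriv ℝ m (g j) (y j)‖ := by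
    intro j m y
    have h := (ContinuousLinearMap.proj (R := ℝ) (φ := fun _ : ι => ℝ) j).iteratedFDeriv_comp_right
      (g j).smooth' y (i := m) (by exact_mod_cast le_top)
    change ‖iteratedFDeriv ℝ m ((g j).toFun ∘
      (ContinuousLinearMap.proj (R := ℝ) (φ := fun _ : ι => ℝ) j)) y‖ ≤ _
    rw [h]
    refine (ContinuousMultilinearMap.norm_compContinuousLinearMap_le _ _).trans ?_
    refine mul_le_of_le_one_right (norm_nonneg _) (Finset.prod_le_one (fun _ _ => norm_nonneg _)
      fun _ _ => ?_)
    refine ContinuousLinearMap.opNorm_le_bound _ zero_le_one fun x => ?_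
    rw [one_mul]
    exact norm_le_pi_norm x j
  refine ⟨⟨fun y => ∏ j, g j (y j), contDiff_prod fun j _ => hcd j, fun k m => ?_⟩, fun y => rfl⟩
  set C : ι → ℝ := fun j => 2 ^ k *
    (Finset.Iic (k, m)).sup (fun m => SchwartzMap.seminorm ℝ m.1 m.2) (g j)
  have hC : ∀ j, ∀ i ≤ m, ∀ y : ℝ, (1 + ‖y‖) ^ k * ‖iteratedFDeriv ℝ i (g j) y‖ ≤ C j :=
    fun j i hi y => SchwartzMap.one_add_le_sup_seminorm_apply (m := (k, m)) le_rfl hi (g j) y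
  refine ⟨∑ p ∈ (Finset.univ : Finset ι).sym m, ((p : Multiset ι).countPerms : ℝ) * ∏ j, C j,
    fun y => ?_⟩
  have hnorm : ‖y‖ ^ k ≤ ∏ j, (1 + ‖y j‖) ^ k := by
    rw [Finset.prod_pow]
    refine pow_le_pow_left₀ (norm_nonneg _) ?_ k
    refine (pi_norm_le_iff_of_nonneg (Finset.prod_nonneg fun _ _ => by positivity)).2 fun j => ?_
    rw [← Finset.mul_prod_erase _ _ (Finset.mem_univ j)]
    have h1 : (1 : ℝ) ≤ ∏ i ∈ Finset.univ.erase j, (1 + ‖y i‖) :=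
      Finset.one_le_prod fun i _ => by simp
    nlinarith [norm_nonneg (y j)]
  calc ‖y‖ ^ k * ‖iteratedFDeriv ℝ m (fun y => ∏ j, g j (y j)) y‖
      ≤ (∏ j, (1 + ‖y j‖) ^ k) * ∑ p ∈ (Finset.univ : Finset ι).sym m,
        ((p : Multiset ι).countPerms : ℝ) *
          ∏ j, ‖iteratedFDeriv ℝ ((p : Multiset ι).count j) (fun y : ι → ℝ => g j (y j)) y‖ :=
        mul_le_mul hnorm (norm_iteratedFDeriv_prod_le (N := (⊤ : ℕ∞)) (fun j _ => hcd j)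
          (by exact_mod_cast le_top)) (norm_nonneg _)
          (Finset.prod_nonneg fun _ _ => by positivity)
    _ ≤ _ := by
      rw [Finset.mul_sum]
      refine Finset.sum_le_sum fun p _ => ?_
      rw [mul_left_comm, ← Finset.prod_mul_distrib]
      refine mul_le_mul_of_nonneg_left (Finset.prod_le_prod (fun j _ => by positivity)
        fun j _ => ?_) (Nat.cast_nonneg _)
      refine (mul_le_mul_of_nonneg_left (hder j _ y) (by positivity)).trans (hC j _ ?_ _)
      have := Multiset.count_le_card j (p : Multiset ι)
      rwa [Sym.card_coe] at this

/-- In a sum against a function with vanishing partial sums, the factors of a product may be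
changed by constants. -/
theorem sum_mul_prod_add_const {ι β : Type*} [Fintype ι] [DecidableEq ι] [Fintype β]
    (φ : (ι → β) → ℂ) (hφ : ∀ a j, ∑ m, φ (Function.update a j m) = 0) (E : ι → β → ℂ)
    (c : ι → ℂ) : ∑ a, φ a * ∏ j, (E j (a j) + c j) = ∑ a, φ a * ∏ j, E j (a j) := by
  have key : ∀ S : Finset ι, ∑ a, φ a * ∏ j, (E j (a j) + if j ∈ S then c j else 0) =
      ∑ a, φ a * ∏ j, E j (a j) := by
    intro S
    induction S using Finset.induction_on with
    | empty => simp
    | insert i S hi ih =>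
      rw [← ih, ← sub_eq_zero, ← Finset.sum_sub_distrib]
      have h1 : ∀ a : ι → β, φ a * ∏ j, (E j (a j) + if j ∈ insert i S then c j else 0) -
          φ a * ∏ j, (E j (a j) + if j ∈ S then c j else 0) =
          φ a * (c i * ∏ j ∈ Finset.univ.erase i, (E j (a j) + if j ∈ S then c j else 0)) := by
        intro a
        rw [← Finset.mul_prod_erase _ _ (Finset.mem_univ i),
          ← Finset.mul_prod_erase _ _ (Finset.mem_univ i), if_pos (Finset.mem_insert_self i S),
          if_neg hi]
        have h2 : ∏ j ∈ Finset.univ.erase i, (E j (a j) + if j ∈ insert i S then c j else 0) =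
            ∏ j ∈ Finset.univ.erase i, (E j (a j) + if j ∈ S then c j else 0) :=
          Finset.prod_congr rfl fun j hj => by
            simp [Finset.mem_insert, Finset.ne_of_mem_erase hj]
        rw [h2]
        ring
      simp_rw [h1]
      refine sum_eq_zero_of_sum_update _ i fun a => ?_
      have h3 : ∀ m, ∏ j ∈ Finset.univ.erase i, (E j (Function.update a i m j) +
          if j ∈ S then c j else 0) =
          ∏ j ∈ Finset.univ.erase i, (E j (a j) + if j ∈ S then c j else 0) := fun m =>
        Finset.prod_congr rfl fun j hj => by
          rw [Function.update_of_ne (Finset.ne_of_mem_erase hj)]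
      simp_rw [h3]
      rw [← Finset.sum_mul, hφ, zero_mul]
  simpa using key Finset.univ

variable {V : Type*} [AddCommGroup V] [Module ℚ V] {n : ℕ}

theorem realCoord_dualBasis [FiniteDimensional ℚ V] (b : Basis (Fin n) ℚ V)
    (t : RealPts (Dual ℚ V)) (j : Fin n) :
    realCoord b.dualBasis t j = pairing ℝ t (1 ⊗ₜ[ℚ] b j) := by
  obtain ⟨x, rfl⟩ := (realCoord b.dualBasis).symm.surjective t
  rw [LinearEquiv.apply_symm_apply, realCoord_symm_apply, map_sum, LinearMap.sum_apply]
  simp [pairing_tmul, Finsupp.single_apply]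

theorem pairing_realCoord [FiniteDimensional ℚ V] (b : Basis (Fin n) ℚ V)
    (t : RealPts (Dual ℚ V)) (v : RealPts V) :
    pairing ℝ t v = ∑ j, realCoord b.dualBasis t j * realCoord b v j := by
  obtain ⟨x, rfl⟩ := (realCoord b).symm.surjective v
  simp_rw [LinearEquiv.apply_symm_apply, realCoord_dualBasis]
  rw [realCoord_symm_apply, map_sum]
  refine Finset.sum_congr rfl fun j _ => ?_
  rw [map_smul, smul_eq_mul, mul_comm]

/-- The linear map taking the coordinates `ρ*` on `V*(ℝ)` to those of a dual basis. -/
def coordChange [FiniteDimensional ℚ V] (ρ : RealPts V ≃ₗ[ℝ] (Fin n → ℝ))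
    (b : Basis (Fin n) ℚ V) : (Fin n → ℝ) ≃L[ℝ] (Fin n → ℝ) :=
  ((dualIso ρ).symm.trans (realCoord b.dualBasis)).toContinuousLinearEquiv

theorem coordChange_apply [FiniteDimensional ℚ V] (ρ : RealPts V ≃ₗ[ℝ] (Fin n → ℝ))
    (b : Basis (Fin n) ℚ V) (t : Fin n → ℝ) :
    coordChange ρ b t = realCoord b.dualBasis ((dualIso ρ).symm t) := rfl

theorem det_coordChange [FiniteDimensional ℚ V] (ρ : RealPts V ≃ₗ[ℝ] (Fin n → ℝ))
    (b : Basis (Fin n) ℚ V) :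
    LinearMap.det ((coordChange ρ b : (Fin n → ℝ) →L[ℝ] (Fin n → ℝ)) :
      (Fin n → ℝ) →ₗ[ℝ] (Fin n → ℝ)) = (periodMatrix ρ b).det := by
  rw [← LinearMap.det_toLin']
  congr 1
  refine LinearMap.ext fun t => ?_
  funext j
  change realCoord b.dualBasis ((dualIso ρ).symm t) j = _
  rw [realCoord_dualBasis, pairing_eq_sum_dualIso ρ, LinearEquiv.apply_symm_apply]
  simp [Matrix.mulVec, dotProduct, periodMatrix, mul_comm]

/-- Change of variables from the coordinates `ρ*` to those of a dual basis. -/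
theorem integral_comp_coordChange [FiniteDimensional ℚ V] (ρ : RealPts V ≃ₗ[ℝ] (Fin n → ℝ))
    (b : Basis (Fin n) ℚ V) (f : (Fin n → ℝ) → ℂ) :
    |(periodMatrix ρ b).det| * ∫ t, f (coordChange ρ b t) = ∫ y, f y := by
  have hd := det_periodMatrix_ne_zero ρ b
  have hm := Measure.map_linearMap_addHaar_eq_smul_addHaar (volume : Measure (Fin n → ℝ))
    (f := ((coordChange ρ b : (Fin n → ℝ) →L[ℝ] (Fin n → ℝ)) : (Fin n → ℝ) →ₗ[ℝ] (Fin n → ℝ)))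
    (by rw [det_coordChange]; exact hd)
  have h1 := (coordChange ρ b).toHomeomorph.measurableEmbedding.integral_map (μ := volume) f
  change ∫ y, f y ∂(Measure.map (coordChange ρ b) volume) = ∫ t, f (coordChange ρ b t) at h1
  rw [← h1]
  change Measure.map (coordChange ρ b) volume = _ at hm
  rw [hm, det_coordChange, integral_smul_measure, ENNReal.toReal_ofReal (abs_nonneg _), abs_inv,
    Complex.real_smul, ← mul_assoc, ← Complex.ofReal_mul, mul_inv_cancel₀ (abs_ne_zero.2 hd),
    Complex.ofReal_one, one_mul]

open Classical in
/-- The transforms attached to a regular function on a cone, and to its Fourier transform on the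
dual cone, are Schwartz functions which are Fourier transforms of each other up to a power of
`i`. -/
theorem IsRegularStep.exists_transform_pair [FiniteDimensional ℚ V] {N : ℕ} (hN : N ≠ 0)
    {b : Basis (Fin n) ℚ V} {Φ : AdelicPts V → ℂ} (h : IsRegularStep b N Φ)
    {ρ : RealPts V ≃ₗ[ℝ] (Fin n → ℝ)} {ν : Measure (AdelicPts V)} [ν.IsAddHaarMeasure]
    (hν : IsCompatible ρ ν) :
    ∃ g g' : SchwartzMap (Fin n → ℝ) ℂ,
      Represents (fun v : V => Φ (1 ⊗ₜ[ℚ] v) * if ∀ j, 0 < b.repr v j then 1 else 0)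
        (fun t => g (dualIso ρ t)) ∧
      Represents (fun v : Dual ℚ V => Shintani.adelicFourier ν Φ (1 ⊗ₜ[ℚ] v) *
        if ∀ j, 0 < b.dualBasis.repr v j then 1 else 0) (fun t => g' (dualIso (dualIso ρ) t)) ∧
      ∀ ξ, g' ξ = Complex.I ^ n *
        ∫ t, g t * Complex.exp (-2 * Real.pi * Complex.I * ∑ μ, (t μ * ξ μ : ℂ)) := by
  choose u hu using fun a : Fin (N * N) => exists_schwartz_qDiff hN a
  set u' : Fin (N * N) → SchwartzMap ℝ ℂ := fun a => FourierTransform.fourier (u a) with hu'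
  have hu'int : ∀ a ξ, u' a ξ = ∫ y, u a y * Complex.exp (-2 * Real.pi * Complex.I * (y * ξ)) := by
    intro a ξ
    rw [hu', SchwartzMap.fourier_coe, Real.fourier_real_eq_integral_exp_smul]
    refine integral_congr_ae (.of_forall fun y => ?_)
    simp only [smul_eq_mul]
    rw [mul_comm]
    congr 2
    push_cast
    ring
  set φ : (Fin n → Fin (N * N)) → ℂ := fun a => Φ (gridPoint b N a) with hφ
  have hφ0 : ∀ a, φ a ≠ 0 → ∀ j, (a j : ℕ) ≠ 0 := by
    intro a ha j h0
    refine ha (h.zero _ ⟨j, ?_⟩)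
    rw [adelicCoord_gridPoint, h0]
    simp
  have hφs : ∀ a j, ∑ m, φ (Function.update a j m) = 0 := h.sum
  choose P hP using fun a : Fin n → Fin (N * N) => exists_schwartz_prod fun j => u (a j)
  choose P' hP' using fun a : Fin n → Fin (N * N) => exists_schwartz_prod fun j => u' (a j)
  set κ : ℂ := (ν.real (basisLattice b (N : ℚ)) : ℂ) with hκ
  set c : ℂ := κ * (N * Complex.I) ^ n with hc
  have hNc : (N : ℂ) ≠ 0 := by exact_mod_cast hN
  -- the numerators of the two transforms, as sums over the grid
  have h1 : ∀ y : Fin n → ℝ, (∏ j, (1 - (qExp N (y j) : ℂ) ^ (N * N))) *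
      ∑ a, φ a * P a y = ∑ a, φ a * ∏ j, (qExp N (y j) : ℂ) ^ (a j : ℕ) := by
    intro y
    rw [← sum_mul_prod_add_const φ hφs (fun j a => (qExp N (y j) : ℂ) ^ (a : ℕ))
      (fun j => -(qExp N (y j) : ℂ)), Finset.mul_sum]
    refine Finset.sum_congr rfl fun a _ => ?_
    by_cases ha : φ a = 0
    · rw [ha]; simp
    · rw [hP, mul_left_comm, ← Finset.prod_mul_distrib]
      congr 1
      refine Finset.prod_congr rfl fun j _ => ?_
      rw [hu _ (hφ0 a ha j), sub_eq_add_neg]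
  have h2 : ∀ y : Fin n → ℝ, (∏ j, (1 - (qExp N (y j) : ℂ) ^ (N * N))) *
      (c * ∑ a, φ a * P' a y) = ∑ m : Fin n → Fin (N * N),
        Shintani.adelicFourier ν Φ (gridPoint b.dualBasis N m) *
          ∏ j, (qExp N (y j) : ℂ) ^ (m j : ℕ) := by
    intro y
    set E : Fin n → Fin (N * N) → ℂ := fun j a => ∑ m ∈ Finset.range (N * N),
      (expTwoPiI ((a : ℕ) / (N * N)) * qExp N (y j)) ^ m with hE
    have hR : ∑ m : Fin n → Fin (N * N), Shintani.adelicFourier ν Φ (gridPoint b.dualBasis N m) *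
          ∏ j, (qExp N (y j) : ℂ) ^ (m j : ℕ) = κ * ∑ a, φ a * ∏ j, E j (a j) := by
      simp_rw [adelicFourier_gridPoint hN h.toIsStepFun, mul_assoc, ← Finset.mul_sum,
        Finset.sum_mul]
      rw [Finset.sum_comm]
      congr 1
      refine Finset.sum_congr rfl fun a _ => ?_
      simp_rw [mul_assoc, ← Finset.mul_sum]
      congr 1
      have : ∀ j, E j (a j) = ∑ m : Fin (N * N),
          (expTwoPiI (((a j : ℕ) : ℂ) / (N * N)) * qExp N (y j)) ^ (m : ℕ) := fun j =>
        (Fin.sum_univ_eq_sum_range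
          (fun m => (expTwoPiI (((a j : ℕ) : ℂ) / (N * N)) * qExp N (y j)) ^ m) _).symm
      simp_rw [this]
      rw [Finset.prod_univ_sum, Fintype.piFinset_univ]
      refine Finset.sum_congr rfl fun m _ => ?_
      rw [gridChar, ← Finset.prod_mul_distrib]
      refine Finset.prod_congr rfl fun j _ => ?_
      rw [mul_pow, expTwoPiI, expTwoPiI, ← Complex.exp_nat_mul]
      congr 2
      push_cast
      ring
    rw [hR, mul_left_comm, Finset.mul_sum,
      ← sum_mul_prod_add_const φ hφs E (fun j => -∑ m ∈ Finset.range (N * N),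
      (expTwoPiI (1 / (N * N)) * qExp N (y j)) ^ m), Finset.mul_sum, Finset.mul_sum]
    refine Finset.sum_congr rfl fun a _ => ?_
    by_cases ha : φ a = 0
    · rw [ha]; simp
    · rw [hP', mul_left_comm _ (φ a), ← Finset.prod_mul_distrib]
      have : ∀ j, (1 - (qExp N (y j) : ℂ) ^ (N * N)) * u' (a j) (y j) =
          -(Complex.I / N) * (E j (a j) + -∑ m ∈ Finset.range (N * N),
            (expTwoPiI (1 / (N * N)) * qExp N (y j)) ^ m) := by
        intro j
        rw [hu'int, integral_qDiff hN (hφ0 a ha j) (a j).2 (u (a j)).integrable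
          (hu _ (hφ0 a ha j)), sub_eq_add_neg]
      simp_rw [this]
      rw [Finset.prod_mul_distrib, Finset.prod_const, Finset.card_univ, Fintype.card_fin, hc]
      have hI : (N * Complex.I) ^ n * (-(Complex.I / N)) ^ n = 1 := by
        rw [← mul_pow]
        have : (N * Complex.I) * (-(Complex.I / N)) = 1 := by
          field_simp
          linear_combination -Complex.I_sq
        rw [this, one_pow]
      linear_combination (κ * φ a * ∏ j, (E j (a j) + -∑ m ∈ Finset.range (N * N),
            (expTwoPiI (1 / (N * N)) * qExp N (y j)) ^ m)) * hI
  -- the constant `κ N ^ n`, with the determinant of the change of coordinates, is `1` by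
  -- `measure_basisLattice`
  set H : SchwartzMap (Fin n → ℝ) ℂ := ∑ a, φ a • P a with hH
  set H' : SchwartzMap (Fin n → ℝ) ℂ := c • ∑ a, φ a • P' a with hH'
  have hHv : ∀ y, H y = ∑ a, φ a * P a y := fun y => by
    rw [hH, sum_apply]; rfl
  have hHv' : ∀ y, H' y = c * ∑ a, φ a * P' a y := fun y => by
    rw [hH', smul_apply, sum_apply]; rfl
  refine ⟨SchwartzMap.compCLMOfContinuousLinearEquiv ℂ (coordChange ρ b) H,
    SchwartzMap.compCLMOfContinuousLinearEquiv ℂ (coordChange (dualIso ρ) b.dualBasis) H',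
    h.represents hN _ fun t => ?_, (h.adelicFourier hN ν).represents hN _ fun t => ?_, fun ξ => ?_⟩
  · rw [SchwartzMap.compCLMOfContinuousLinearEquiv_apply, Function.comp_apply, coordChange_apply,
      LinearEquiv.symm_apply_apply, hHv]
    have := h1 (realCoord b.dualBasis t)
    simp_rw [realCoord_dualBasis] at this ⊢
    exact this
  · rw [SchwartzMap.compCLMOfContinuousLinearEquiv_apply, Function.comp_apply, coordChange_apply,
      LinearEquiv.symm_apply_apply, hHv']
    have := h2 (realCoord b.dualBasis.dualBasis t)
    simp_rw [realCoord_dualBasis b.dualBasis] at this ⊢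
    exact this
  · rw [SchwartzMap.compCLMOfContinuousLinearEquiv_apply, Function.comp_apply, hHv']
    set ξ' := coordChange (dualIso ρ) b.dualBasis ξ with hξ'
    have hdot : ∀ t : Fin n → ℝ, ∑ μ, (t μ * ξ μ : ℂ) =
        ∑ j, (coordChange ρ b t j * ξ' j : ℂ) := by
      intro t
      have h3 := pairing_eq_sum_dualIso (dualIso ρ) ((dualIso (dualIso ρ)).symm ξ)
        ((dualIso ρ).symm t)
      rw [pairing_realCoord b.dualBasis, LinearEquiv.apply_symm_apply,
        LinearEquiv.apply_symm_apply] at h3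
      have h4 : ∑ μ, t μ * ξ μ = ∑ j, coordChange ρ b t j * ξ' j := by
        simp_rw [hξ', coordChange_apply, mul_comm _ (ξ _), ← h3]
        exact Finset.sum_congr rfl fun j _ => mul_comm _ _
      exact_mod_cast h4
    have hint : ∀ a, Integrable fun y : Fin n → ℝ =>
        P a y * Complex.exp (-2 * Real.pi * Complex.I * ∑ j, (y j * ξ' j : ℂ)) := by
      intro a
      have hphase : Continuous fun y : Fin n → ℝ =>
        Complex.exp (-2 * Real.pi * Complex.I * ∑ j, (y j * ξ' j : ℂ)) := by fun_prop
      refine (P a).integrable.mul_bdd (c := 1) hphase.aestronglyMeasurable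
        (.of_forall fun y => ?_)
      have : (-2 * Real.pi * Complex.I * ∑ j, (y j * ξ' j : ℂ)) =
          ((-2 * Real.pi * ∑ j, y j * ξ' j : ℝ) : ℂ) * Complex.I := by push_cast; ring
      rw [this, Complex.norm_exp_ofReal_mul_I]
    have hF : ∀ a, P' a ξ' = ∫ y : Fin n → ℝ,
        P a y * Complex.exp (-2 * Real.pi * Complex.I * ∑ j, (y j * ξ' j : ℂ)) := by
      intro a
      rw [hP']
      simp_rw [hu'int]
      rw [← integral_fintype_prod_volume_eq_prod
        (fun (j : Fin n) (y : ℝ) =>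
          u (a j) y * Complex.exp (-2 * Real.pi * Complex.I * (y * ξ' j)))]
      refine integral_congr_ae (.of_forall fun y => ?_)
      simp only
      rw [hP, Finset.prod_mul_distrib, ← Complex.exp_sum, Finset.mul_sum]
    have hvol := measure_basisLattice hν b hN
    have hvol' : (N : ℂ) ^ n * (|(periodMatrix ρ b).det| : ℝ) * κ = 1 := by
      rw [hκ]; exact_mod_cast hvol
    have hcv := integral_comp_coordChange ρ b fun y =>
      H y * Complex.exp (-2 * Real.pi * Complex.I * ∑ j, (y j * ξ' j : ℂ))
    simp_rw [SchwartzMap.compCLMOfContinuousLinearEquiv_apply, Function.comp_apply, hdot]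
    have hsum : ∑ a, φ a * P' a ξ' = ∫ y : Fin n → ℝ,
        H y * Complex.exp (-2 * Real.pi * Complex.I * ∑ j, (y j * ξ' j : ℂ)) := by
      have hsplit : ∀ y : Fin n → ℝ,
          H y * Complex.exp (-2 * Real.pi * Complex.I * ∑ j, (y j * ξ' j : ℂ)) =
          ∑ a, φ a * (P a y *
            Complex.exp (-2 * Real.pi * Complex.I * ∑ j, (y j * ξ' j : ℂ))) := fun y => by
        rw [hHv, Finset.sum_mul]
        exact Finset.sum_congr rfl fun a _ => mul_assoc _ _ _
      simp_rw [hsplit]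
      rw [integral_finsetSum _ fun a _ => (hint a).const_mul (φ a)]
      refine Finset.sum_congr rfl fun a _ => ?_
      rw [integral_const_mul, hF]
    rw [hsum, ← hcv, hc, mul_pow]
    linear_combination (Complex.I ^ n * ∫ t, H (coordChange ρ b t) *
      Complex.exp (-2 * Real.pi * Complex.I * ∑ j, (coordChange ρ b t j * ξ' j : ℂ))) * hvol'

end

/-! ### Mellin transforms of Schwartz functions -/

section

open Topology

/-- The homogeneous function `sgn(t)^e |t|^(s-1)`. -/
def homKernel (e : ℕ) (s : ℂ) (t : ℝ) : ℂ :=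
  ((t / |t| : ℝ) : ℂ) ^ e * ((|t| : ℝ) : ℂ) ^ (s - 1)

@[fun_prop]
theorem measurable_homKernel (e : ℕ) (s : ℂ) : Measurable (homKernel e s) := by
  unfold homKernel
  have h1 : Measurable fun t : ℝ => ((t / |t| : ℝ) : ℂ) := by fun_prop
  have h2 : Measurable fun t : ℝ => ((|t| : ℝ) : ℂ) := by fun_prop
  exact (h1.pow_const e).mul (h2.pow_const _)

theorem norm_homKernel (e : ℕ) (s : ℂ) {t : ℝ} (ht : t ≠ 0) :
    ‖homKernel e s t‖ = |t| ^ (s.re - 1) := by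
  rw [homKernel, norm_mul, norm_pow, Complex.norm_real, Real.norm_eq_abs, abs_div, abs_abs,
    div_self (abs_ne_zero.2 ht), one_pow, one_mul,
    Complex.norm_cpow_eq_rpow_re_of_pos (abs_pos.2 ht)]
  simp

theorem ae_forall_ne_zero {ι : Type*} [Fintype ι] : ∀ᵐ t : ι → ℝ, ∀ μ, t μ ≠ 0 :=
  ae_all_iff.2 fun μ => Measure.ae_eval_ne (μ := fun _ : ι => (volume : Measure ℝ)) μ 0

/-- Integrability at `0` uses `a > 0`, and at infinity `a < m`. -/
theorem integrable_abs_rpow_mul {a : ℝ} {m : ℕ} (ha : 0 < a) (ham : a < m) :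
    Integrable fun t : ℝ => ((1 + |t|) ^ m)⁻¹ * |t| ^ (a - 1) := by
  have hmeas : Measurable fun t : ℝ => ((1 + |t|) ^ m)⁻¹ * |t| ^ (a - 1) := by fun_prop
  have h1 : IntegrableOn (fun t : ℝ => ((1 + |t|) ^ m)⁻¹ * |t| ^ (a - 1)) (Set.Ioi 0) := by
    rw [← Set.Ioc_union_Ioi_eq_Ioi zero_le_one]
    refine IntegrableOn.union ?_ ?_
    · have : IntegrableOn (fun t : ℝ => t ^ (a - 1)) (Set.Ioc 0 1) :=
        (intervalIntegrable_iff_integrableOn_Ioc_of_le zero_le_one).1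
          (intervalIntegral.intervalIntegrable_rpow' (by linarith))
      refine this.mono' hmeas.aestronglyMeasurable ?_
      refine (ae_restrict_iff' measurableSet_Ioc).2 (.of_forall fun t ht => ?_)
      have ht0 : 0 < t := ht.1
      rw [Real.norm_of_nonneg (by positivity), abs_of_pos ht0]
      refine mul_le_of_le_one_left (by positivity) (inv_le_one_of_one_le₀ (one_le_pow₀ ?_))
      linarith
    · have : IntegrableOn (fun t : ℝ => t ^ (a - 1 - m)) (Set.Ioi 1) :=
        integrableOn_Ioi_rpow_of_lt (by linarith) one_pos
      refine this.mono' hmeas.aestronglyMeasurable ?_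
      refine (ae_restrict_iff' measurableSet_Ioi).2 (.of_forall fun t ht => ?_)
      have ht0 : 0 < t := one_pos.trans ht
      rw [Real.norm_of_nonneg (by positivity), abs_of_pos ht0, Real.rpow_sub ht0 (a - 1),
        Real.rpow_natCast, div_eq_inv_mul]
      refine mul_le_mul_of_nonneg_right ?_ (by positivity)
      exact inv_anti₀ (by positivity) (pow_le_pow_left₀ ht0.le (by linarith) m)
  rw [← integrableOn_univ, ← Set.Iio_union_Ici (a := (0 : ℝ))]
  refine IntegrableOn.union ?_ ((integrableOn_Ici_iff_integrableOn_Ioi (by simp)).2 h1)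
  have h2 := IntegrableOn.comp_neg_Iio (c := (0 : ℝ)) (by rwa [neg_zero])
  simpa using h2

variable {ι : Type*} [Fintype ι]

/-- A Schwartz function decays rapidly in all coordinates simultaneously. -/
theorem schwartz_bound (h : SchwartzMap (ι → ℝ) ℂ) (m : ℕ) :
    ∃ C, ∀ t, ‖(∏ μ, (1 + |t μ|) ^ m : ℝ) * h t‖ ≤ C := by
  refine ⟨_, fun t => le_trans ?_ (SchwartzMap.one_add_le_sup_seminorm_apply (𝕜 := ℝ)
    (m := (m * Fintype.card ι, 0)) le_rfl le_rfl h t)⟩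
  have h0 : 0 ≤ ∏ μ, (1 + |t μ|) ^ m := Finset.prod_nonneg fun _ _ => by positivity
  rw [norm_iteratedFDeriv_zero, norm_mul, Complex.norm_real, Real.norm_of_nonneg h0]
  refine mul_le_mul_of_nonneg_right ?_ (norm_nonneg _)
  rw [pow_mul, ← Finset.card_univ, ← Finset.prod_const]
  refine Finset.prod_le_prod (fun _ _ => by positivity) fun μ _ => ?_
  refine pow_le_pow_left₀ (by positivity) ?_ m
  have := norm_le_pi_norm t μ
  rw [Real.norm_eq_abs] at this
  linarith

/-- Integrability against a product reduces to integrability in each variable, where the Schwartz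
function may be replaced by `(1 + |t|)^(-m)`. -/
theorem integrable_schwartz_mul_prod (h : SchwartzMap (ι → ℝ) ℂ) {f : ι → ℝ → ℂ}
    (hf : ∃ m : ℕ, ∀ μ, Integrable fun t : ℝ => ((((1 + |t|) ^ m)⁻¹ : ℝ) : ℂ) * f μ t) :
    Integrable fun t => h t * ∏ μ, f μ (t μ) := by
  obtain ⟨m, hm⟩ := hf
  obtain ⟨C, hC⟩ := schwartz_bound h m
  have h1 : Integrable fun t : ι → ℝ =>
      ∏ μ, ((((1 + |t μ|) ^ m)⁻¹ : ℝ) : ℂ) * f μ (t μ) :=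
    Integrable.fintype_prod fun μ => hm μ
  have hcont : Continuous fun t : ι → ℝ => ((∏ μ, (1 + |t μ|) ^ m : ℝ) : ℂ) * h t := by
    have := h.continuous
    fun_prop
  have h2 := h1.bdd_mul hcont.aestronglyMeasurable (.of_forall hC)
  refine h2.congr (.of_forall fun t => ?_)
  simp only
  have h0 : ((∏ μ, (1 + |t μ|) ^ m : ℝ) : ℂ) ≠ 0 := by
    exact_mod_cast (Finset.prod_pos fun μ _ => by positivity).ne'
  rw [Finset.prod_mul_distrib, ← Complex.ofReal_prod, Finset.prod_inv_distrib, Complex.ofReal_inv]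
  field_simp

theorem integrable_schwartz_mul_of_le (h : SchwartzMap (ι → ℝ) ℂ) {f : ι → ℝ → ℂ}
    (hfm : ∀ μ, Measurable (f μ)) {a b : ι → ℝ} (ha : ∀ μ, 0 < a μ) (hb : ∀ μ, 0 < b μ) {C : ι → ℝ}
    (hle : ∀ μ t, t ≠ 0 → ‖f μ t‖ ≤ C μ * (|t| ^ (a μ - 1) + |t| ^ (b μ - 1))) :
    Integrable fun t => h t * ∏ μ, f μ (t μ) := by
  obtain ⟨A, hA⟩ := (Set.finite_range a).bddAbove
  obtain ⟨B, hB⟩ := (Set.finite_range b).bddAbove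
  obtain ⟨m, hm⟩ := exists_nat_gt (max A B)
  refine integrable_schwartz_mul_prod h ⟨m, fun μ => ?_⟩
  have h1 : Integrable fun t : ℝ => C μ * (((1 + |t|) ^ m)⁻¹ * |t| ^ (a μ - 1) +
      ((1 + |t|) ^ m)⁻¹ * |t| ^ (b μ - 1)) :=
    ((integrable_abs_rpow_mul (ha μ) (((hA ⟨μ, rfl⟩).trans (le_max_left _ _)).trans_lt hm)).add
      (integrable_abs_rpow_mul (hb μ)
        (((hB ⟨μ, rfl⟩).trans (le_max_right _ _)).trans_lt hm))).const_mul _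
  refine h1.mono' ?_ ?_
  · have := hfm μ
    exact (by fun_prop : Measurable fun t : ℝ =>
      ((((1 + |t|) ^ m)⁻¹ : ℝ) : ℂ) * f μ t).aestronglyMeasurable
  · filter_upwards [Measure.ae_ne volume (0 : ℝ)] with t ht
    have h0 : 0 ≤ ((1 + |t|) ^ m)⁻¹ := by positivity
    rw [norm_mul, Complex.norm_real, Real.norm_of_nonneg h0]
    calc _ ≤ ((1 + |t|) ^ m)⁻¹ * (C μ * (|t| ^ (a μ - 1) + |t| ^ (b μ - 1))) :=
          mul_le_mul_of_nonneg_left (hle μ t ht) h0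
      _ = _ := by ring

theorem integrable_schwartz_mul_homKernel (h : SchwartzMap (ι → ℝ) ℂ) (e : ι → ℕ) {s : ι → ℂ}
    (hs : ∀ μ, 0 < (s μ).re) : Integrable fun t => h t * ∏ μ, homKernel (e μ) (s μ) (t μ) :=
  integrable_schwartz_mul_of_le h (fun μ => measurable_homKernel _ _) hs hs (C := fun _ => 1)
    fun μ t ht => by
      rw [norm_homKernel _ _ ht, one_mul]
      have : 0 ≤ |t| ^ ((s μ).re - 1) := by positivity
      linarith

/-- The Mellin transform `∫ h(t) ∏ sgn(t_μ)^(e_μ) |t_μ|^(s_μ - 1) dt`. -/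
def mellinZ (h : SchwartzMap (ι → ℝ) ℂ) (e : ι → ℕ) (s : ι → ℂ) : ℂ :=
  ∫ t, h t * ∏ μ, homKernel (e μ) (s μ) (t μ)

/-- A bound for the derivative of `t^(x-1)` in `x` which is uniform for `x` in a compact set, and a
sum of two powers. -/
theorem one_add_abs_log_mul_rpow_le {δ x t : ℝ} (hδ : 0 < δ) (h1 : δ < x) (h2 : x < 3 * δ)
    (ht : 0 < t) : (1 + |Real.log t|) * t ^ (x - 1) ≤
      (1 + 2 / δ) * (t ^ (δ / 2 - 1) + t ^ (4 * δ - 1)) := by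
  have hlog : |Real.log t| ≤ 2 / δ * max (t ^ (δ / 2)) (t ^ (-(δ / 2))) := by
    have key : ∀ y : ℝ, 0 < y → Real.log y ≤ 2 / δ * y ^ (δ / 2) := fun y hy => by
      have := Real.log_le_rpow_div hy.le (half_pos hδ)
      rwa [div_div_eq_mul_div, mul_comm, ← div_mul_eq_mul_div] at this
    rcases le_total 0 (Real.log t) with h | h
    · rw [abs_of_nonneg h]
      exact (key t ht).trans (mul_le_mul_of_nonneg_left (le_max_left _ _) (by positivity))
    · rw [abs_of_nonpos h, ← Real.log_inv]
      refine (key _ (inv_pos.2 ht)).trans (mul_le_mul_of_nonneg_left ?_ (by positivity))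
      rw [Real.inv_rpow ht.le, ← Real.rpow_neg ht.le]
      exact le_max_right _ _
  have hpow : ∀ y, δ / 2 ≤ y → y ≤ 4 * δ → t ^ (y - 1) ≤ t ^ (δ / 2 - 1) + t ^ (4 * δ - 1) := by
    intro y hy1 hy2
    have e1 : 0 ≤ t ^ (δ / 2 - 1) := by positivity
    have e2 : 0 ≤ t ^ (4 * δ - 1) := by positivity
    rcases le_total t 1 with h | h
    · have := Real.rpow_le_rpow_of_exponent_ge ht h (by linarith : δ / 2 - 1 ≤ y - 1)
      linarith
    · have := Real.rpow_le_rpow_of_exponent_le h (by linarith : y - 1 ≤ 4 * δ - 1)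
      linarith
  have hmax : max (t ^ (δ / 2)) (t ^ (-(δ / 2))) * t ^ (x - 1) ≤
      t ^ (δ / 2 - 1) + t ^ (4 * δ - 1) := by
    rcases max_choice (t ^ (δ / 2)) (t ^ (-(δ / 2))) with h | h
    · rw [h, ← Real.rpow_add ht, show δ / 2 + (x - 1) = (δ / 2 + x) - 1 by ring]
      exact hpow _ (by linarith) (by linarith)
    · rw [h, ← Real.rpow_add ht, show -(δ / 2) + (x - 1) = (x - δ / 2) - 1 by ring]
      exact hpow _ (by linarith) (by linarith)
  have h3 := hpow x (by linarith) (by linarith)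
  have h4 : |Real.log t| * t ^ (x - 1) ≤ 2 / δ * (t ^ (δ / 2 - 1) + t ^ (4 * δ - 1)) := by
    refine (mul_le_mul_of_nonneg_right hlog (by positivity)).trans ?_
    rw [mul_assoc]
    exact mul_le_mul_of_nonneg_left hmax (by positivity)
  linarith

theorem sum_le_prod_one_add {f : ι → ℝ} (hf : ∀ μ, 0 ≤ f μ) : ∑ μ, f μ ≤ ∏ μ, (1 + f μ) := by
  classical
  have key : ∀ S : Finset ι, ∑ μ ∈ S, f μ ≤ ∏ μ ∈ S, (1 + f μ) := by
    intro S
    induction S using Finset.induction_on with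
    | empty => simp
    | insert i S hi ih =>
      rw [Finset.sum_insert hi, Finset.prod_insert hi]
      have h1 : 1 ≤ ∏ μ ∈ S, (1 + f μ) := Finset.one_le_prod fun μ _ => by simpa using hf μ
      nlinarith [hf i]
  exact key Finset.univ

theorem isOpen_re_gt (c : ℝ) : IsOpen {s : ι → ℂ | ∀ μ, c < (s μ).re} := by
  simp only [Set.ofPred_forall]
  exact isOpen_iInter_of_finite fun μ =>
    isOpen_lt continuous_const (Complex.continuous_re.comp (continuous_apply μ))

/-- Differentiation under the integral sign. The derivative is dominated locally uniformly in `s`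
because a factor `log |t_μ|` costs only an arbitrarily small power of `|t_μ|`. -/
theorem differentiableOn_mellinZ (h : SchwartzMap (ι → ℝ) ℂ) (e : ι → ℕ) :
    DifferentiableOn ℂ (mellinZ h e) {s | ∀ μ, 0 < (s μ).re} := by
  classical
  intro s₀ hs₀
  refine DifferentiableAt.differentiableWithinAt ?_
  set δ : ι → ℝ := fun μ => (s₀ μ).re / 2 with hδ
  have hδ0 : ∀ μ, 0 < δ μ := fun μ => half_pos (hs₀ μ)
  -- a neighbourhood of `s₀` on which the powers are uniformly dominated
  set U : Set (ι → ℂ) := {s | ∀ μ, δ μ < (s μ).re ∧ (s μ).re < 3 * δ μ} with hU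
  have hUo : IsOpen U := by
    rw [hU]
    simp only [Set.ofPred_forall]
    refine isOpen_iInter_of_finite fun μ => IsOpen.inter ?_ ?_
    · exact isOpen_lt continuous_const (Complex.continuous_re.comp (continuous_apply μ))
    · exact isOpen_lt (Complex.continuous_re.comp (continuous_apply μ)) continuous_const
  have hUn : U ∈ 𝓝 s₀ := hUo.mem_nhds fun μ => by
    have := hδ0 μ
    simp only [hδ] at this ⊢
    constructor <;> linarith
  set ℓ : (ι → ℝ) → (ι → ℂ) →L[ℂ] ℂ := fun t =>
    ∑ μ, ((Real.log |t μ| : ℝ) : ℂ) • ContinuousLinearMap.proj (R := ℂ) (φ := fun _ : ι => ℂ) μ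
  set K' : ι → ℝ → ℂ := fun μ t => (((1 + 2 / δ μ) * (|t| ^ (δ μ / 2 - 1) +
    |t| ^ (4 * δ μ - 1)) : ℝ) : ℂ) with hK'
  have hbound : Integrable fun t => h t * ∏ μ, K' μ (t μ) := by
    refine integrable_schwartz_mul_of_le h (fun μ => ?_) (a := fun μ => δ μ / 2)
      (b := fun μ => 4 * δ μ) (fun μ => half_pos (hδ0 μ))
      (fun μ => by have := hδ0 μ; positivity) (C := fun μ => 1 + 2 / δ μ) fun μ t ht => ?_
    · exact (by fun_prop : Measurable (K' μ))
    · have := hδ0 μ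
      rw [hK', Complex.norm_real, Real.norm_of_nonneg (by positivity)]
  have hmeas : ∀ s : ι → ℂ, Measurable fun t : ι → ℝ => h t * ∏ μ, homKernel (e μ) (s μ) (t μ) := by
    intro s
    have := h.continuous.measurable
    have h2 : Measurable fun t : ι → ℝ => ∏ μ, homKernel (e μ) (s μ) (t μ) :=
      Finset.measurable_fun_prod _ fun μ _ =>
        (measurable_homKernel _ _).comp (measurable_pi_apply μ)
    exact this.mul h2
  refine (hasFDerivAt_integral_of_dominated_of_fderiv_le (𝕜 := ℂ) (s := U)
    (F := fun s t => h t * ∏ μ, homKernel (e μ) (s μ) (t μ))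
    (F' := fun s t => (h t * ∏ μ, homKernel (e μ) (s μ) (t μ)) • ℓ t)
    (bound := fun t => ‖h t * ∏ μ, K' μ (t μ)‖) hUn
    (.of_forall fun s => (hmeas s).aestronglyMeasurable)
    (integrable_schwartz_mul_homKernel h e hs₀) ?_ ?_ hbound.norm ?_).differentiableAt
  · have hℓ : Measurable ℓ := by
      refine Finset.measurable_fun_sum _ fun μ _ => ?_
      have : Measurable fun t : ι → ℝ => ((Real.log |t μ| : ℝ) : ℂ) := by fun_prop
      exact this.smul_const _
    exact ((hmeas s₀).smul hℓ).aestronglyMeasurable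
  · filter_upwards [ae_forall_ne_zero] with t ht s hs
    rw [norm_smul, norm_mul, norm_mul, mul_assoc]
    refine mul_le_mul_of_nonneg_left ?_ (norm_nonneg _)
    have hℓ : ‖ℓ t‖ ≤ ∏ μ, (1 + |Real.log (|t μ|)|) := by
      have h1 : ‖ℓ t‖ ≤ ∑ μ, |Real.log (|t μ|)| := by
        refine (norm_sum_le _ _).trans (Finset.sum_le_sum fun μ _ => ?_)
        rw [norm_smul, Complex.norm_real, Real.norm_eq_abs]
        refine mul_le_of_le_one_right (abs_nonneg _) ?_
        refine ContinuousLinearMap.opNorm_le_bound _ zero_le_one fun x => ?_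
        rw [one_mul]
        exact norm_le_pi_norm x μ
      refine h1.trans ?_
      exact sum_le_prod_one_add fun μ => abs_nonneg _
    rw [norm_prod, norm_prod]
    refine (mul_le_mul_of_nonneg_left hℓ (Finset.prod_nonneg fun _ _ => norm_nonneg _)).trans ?_
    rw [← Finset.prod_mul_distrib]
    refine Finset.prod_le_prod (fun _ _ => by positivity) fun μ _ => ?_
    have := hδ0 μ
    rw [norm_homKernel _ _ (ht μ), hK', Complex.norm_real, Real.norm_of_nonneg (by positivity),
      mul_comm]
    exact one_add_abs_log_mul_rpow_le (hδ0 μ) (hs μ).1 (hs μ).2 (abs_pos.2 (ht μ))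
  · filter_upwards [ae_forall_ne_zero] with t ht s hs
    have hexp : (fun s : ι → ℂ => h t * ∏ μ, homKernel (e μ) (s μ) (t μ)) = fun s =>
        (h t * ∏ μ, ((t μ / |t μ| : ℝ) : ℂ) ^ e μ * Complex.exp (-(Real.log |t μ| : ℝ))) *
          Complex.exp (ℓ t s) := by
      funext s
      rw [mul_assoc]
      congr 1
      have : ℓ t s = ∑ μ, ((Real.log |t μ| : ℝ) : ℂ) * s μ := by
        simp [ℓ]
      rw [this, Complex.exp_sum, ← Finset.prod_mul_distrib]
      refine Finset.prod_congr rfl fun μ _ => ?_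
      rw [homKernel, Complex.cpow_def_of_ne_zero
        (by exact_mod_cast (abs_pos.2 (ht μ)).ne'), ← Complex.ofReal_log (abs_nonneg _),
        mul_assoc, ← Complex.exp_add]
      congr 2
      ring
    have hd : HasFDerivAt (fun s : ι → ℂ => Complex.exp (ℓ t s)) (Complex.exp (ℓ t s) • ℓ t) s :=
      (ℓ t).hasFDerivAt.cexp
    have h3 := hd.const_mul
      (h t * ∏ μ, ((t μ / |t μ| : ℝ) : ℂ) ^ e μ * Complex.exp (-(Real.log |t μ| : ℝ)))
    have h4 := congrFun hexp s
    rw [hexp, h4, mul_smul]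
    exact h3

end

/-! ### Entire continuation -/

section

open Topology

variable {ι : Type} [Fintype ι]

/-- The identity theorem for holomorphic functions of several variables on a convex open set. -/
theorem eqOn_of_convex_of_eventuallyEq {U : Set (ι → ℂ)} (hU : Convex ℝ U) (hUo : IsOpen U)
    {f g : (ι → ℂ) → ℂ} (hf : DifferentiableOn ℂ f U) (hg : DifferentiableOn ℂ g U)
    {p : ι → ℂ} (hp : p ∈ U) (h : f =ᶠ[𝓝 p] g) : Set.EqOn f g U := by
  intro s hs
  -- restrict to the complex line through `p` and `s`
  set φ : ℂ → ι → ℂ := fun z => p + z • (s - p) with hφ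
  have hφd : Differentiable ℂ φ := by fun_prop
  have hWo : IsOpen (φ ⁻¹' U) := hUo.preimage hφd.continuous
  have hWc : Convex ℝ (φ ⁻¹' U) := by
    intro z hz w hw a b ha hb hab
    have h1 : φ (a • z + b • w) = a • φ z + b • φ w := by
      funext μ
      have hab' : (a : ℂ) + b = 1 := by exact_mod_cast hab
      simp only [hφ, Pi.add_apply, Pi.smul_apply, Pi.sub_apply, smul_eq_mul, Complex.real_smul]
      linear_combination (-p μ) * hab'
    rw [Set.mem_preimage, h1]
    exact hU hz hw ha hb hab
  have h0 : (0 : ℂ) ∈ φ ⁻¹' U := by simpa [hφ] using hp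
  have h1 : (1 : ℂ) ∈ φ ⁻¹' U := by simpa [hφ] using hs
  have hfa : AnalyticOnNhd ℂ (f ∘ φ) (φ ⁻¹' U) :=
    (hf.comp hφd.differentiableOn (Set.mapsTo_preimage φ U)).analyticOnNhd hWo
  have hga : AnalyticOnNhd ℂ (g ∘ φ) (φ ⁻¹' U) :=
    (hg.comp hφd.differentiableOn (Set.mapsTo_preimage φ U)).analyticOnNhd hWo
  have hev : f ∘ φ =ᶠ[𝓝 0] g ∘ φ := by
    have ht : Filter.Tendsto φ (𝓝 0) (𝓝 p) := by
      have := hφd.continuous.tendsto 0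
      simpa [hφ] using this
    exact ht.eventually h
  have := hfa.eqOn_of_preconnected_of_eventuallyEq hga hWc.isPreconnected h0 hev h1
  simpa [hφ] using this

/-- `sgn(t)^(e+1) |t|^s` is differentiable also at `0`, because `Re s > 1`. -/
theorem hasDerivAt_homKernel (e : ℕ) {s : ℂ} (hs : 1 < s.re) (t : ℝ) :
    HasDerivAt (homKernel (e + 1) (s + 1)) (s * homKernel e s t) t := by
  have hs0 : s ≠ 0 := by rintro rfl; simp at hs; linarith
  have hs1 : s - 1 ≠ 0 := by
    intro h
    rw [sub_eq_zero.1 h] at hs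
    simp at hs
  have hpos : ∀ y : ℝ, 0 < y → HasDerivAt (fun y : ℝ => (y : ℂ) ^ s) (s * (y : ℂ) ^ (s - 1)) y :=
    fun y hy => hasDerivAt_ofReal_cpow_const hy.ne' hs0
  have hval : ∀ (y : ℝ) (ε : ℝ), ε * ε = 1 → 0 < ε * y → ∀ (k : ℕ) (w : ℂ),
      homKernel k w y = (ε : ℂ) ^ k * ((ε * y : ℝ) : ℂ) ^ (w - 1) := by
    intro y ε hε hy k w
    have habs : |y| = ε * y := by
      rcases mul_self_eq_one_iff.1 hε with rfl | rfl
      · rw [one_mul] at hy ⊢; exact abs_of_pos hy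
      · rw [neg_one_mul] at hy ⊢; exact abs_of_neg (neg_pos.1 hy)
    have hy0 : y ≠ 0 := right_ne_zero_of_mul hy.ne'
    rw [homKernel, habs]
    congr 3
    rw [div_eq_iff hy.ne', ← mul_assoc, hε, one_mul]
  have hmain : ∀ ε : ℝ, ε * ε = 1 → 0 < ε * t →
      HasDerivAt (homKernel (e + 1) (s + 1)) (s * homKernel e s t) t := by
    intro ε hε ht
    have hεc : (ε : ℂ) * ε = 1 := by exact_mod_cast hε
    have hlin : HasDerivAt (fun y : ℝ => ε * y) ε t := by
      simpa using (hasDerivAt_id t).const_mul ε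
    have h1 := ((hpos _ ht).scomp t hlin).const_mul ((ε : ℂ) ^ (e + 1))
    have hev : ∀ᶠ y in 𝓝 t, 0 < ε * y := hlin.continuousAt.eventually (lt_mem_nhds ht)
    refine (h1.congr_of_eventuallyEq ?_).congr_deriv ?_
    · filter_upwards [hev] with y hy
      rw [hval y ε hε hy, add_sub_cancel_right]
      rfl
    · rw [hval t ε hε ht, Complex.real_smul, pow_succ]
      linear_combination ((ε : ℂ) ^ e * s * ((ε * t : ℝ) : ℂ) ^ (s - 1)) * hεc
  rcases lt_trichotomy t 0 with ht | rfl | ht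
  · exact hmain (-1) (by norm_num) (by linarith)
  · have h0 : ∀ k w, homKernel (k + 1) w 0 = 0 := fun k w => by simp [homKernel]
    have h00 : homKernel e s 0 = 0 := by
      rw [homKernel, abs_zero, Complex.ofReal_zero, Complex.zero_cpow hs1, mul_zero]
    rw [h00, mul_zero, hasDerivAt_iff_tendsto_slope_zero]
    refine squeeze_zero_norm' (a := fun y : ℝ => |y| ^ (s.re - 1)) ?_ ?_
    · filter_upwards [self_mem_nhdsWithin] with y hy
      have hy' : (0 : ℝ) < |y| := abs_pos.2 hy
      rw [zero_add, h0, sub_zero, norm_smul, norm_homKernel _ _ hy, norm_inv, Real.norm_eq_abs,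
        Complex.add_re, Complex.one_re, add_sub_cancel_right, Real.rpow_sub_one hy'.ne',
        div_eq_inv_mul]
    · have hc : Continuous fun y : ℝ => |y| ^ (s.re - 1) :=
        continuous_abs.rpow_const fun _ => Or.inr (by linarith)
      have := hc.tendsto 0
      rw [abs_zero, Real.zero_rpow (by linarith)] at this
      exact this.mono_left nhdsWithin_le_nhds
  · exact hmain 1 (by norm_num) (by linarith)

theorem hasLineDerivAt_prod_homKernel [DecidableEq ι] (e : ι → ℕ) {s : ι → ℂ} {μ : ι}
    (hμ : 1 < (s μ).re) (t : ι → ℝ) :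
    HasLineDerivAt ℝ (fun t : ι → ℝ => ∏ ν, homKernel ((e + Pi.single μ 1 : ι → ℕ) ν)
      ((s + Pi.single μ 1 : ι → ℂ) ν) (t ν)) (s μ * ∏ ν, homKernel (e ν) (s ν) (t ν)) t
      (Pi.single μ (1 : ℝ)) := by
  have h2 : (fun x : ℝ => ∏ ν, homKernel ((e + Pi.single μ 1 : ι → ℕ) ν)
      ((s + Pi.single μ 1 : ι → ℂ) ν) ((t + x • (Pi.single μ (1 : ℝ) : ι → ℝ)) ν)) = fun x =>
      homKernel (e μ + 1) (s μ + 1) (t μ + x) *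
        ∏ ν ∈ Finset.univ.erase μ, homKernel (e ν) (s ν) (t ν) := by
    funext x
    rw [← Finset.mul_prod_erase _ _ (Finset.mem_univ μ)]
    congr 1
    · simp
    · refine Finset.prod_congr rfl fun ν hν => ?_
      simp [Finset.ne_of_mem_erase hν]
  rw [HasLineDerivAt, h2, ← Finset.mul_prod_erase _ _ (Finset.mem_univ μ), ← mul_assoc]
  refine HasDerivAt.mul_const ?_ _
  have h3 := hasDerivAt_homKernel (e μ) hμ (t μ)
  have h5 : HasDerivAt (homKernel (e μ + 1) (s μ + 1)) (s μ * homKernel (e μ) (s μ) (t μ))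
      (t μ + 0) := by rwa [add_zero]
  exact h5.comp_const_add (t μ) 0

open LineDeriv in
/-- Integration by parts in the variable `t_μ`. -/
theorem mellinZ_by_parts [DecidableEq ι] (h : SchwartzMap (ι → ℝ) ℂ) (e : ι → ℕ) {s : ι → ℂ}
    (hs : ∀ ν, 0 < (s ν).re) {μ : ι} (hμ : 1 < (s μ).re) :
    s μ * mellinZ h e s =
      -mellinZ (lineDerivOp (Pi.single μ (1 : ℝ) : ι → ℝ) h) (e + Pi.single μ 1)
        (s + Pi.single μ 1) := by
  have hs' : ∀ ν, 0 < ((s + Pi.single μ 1 : ι → ℂ) ν).re := by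
    intro ν
    by_cases hν : ν = μ
    · subst hν
      have := hs ν
      simp only [Pi.add_apply, Pi.single_eq_same, Complex.add_re, Complex.one_re]
      linarith
    · simpa [hν] using hs ν
  set h' : SchwartzMap (ι → ℝ) ℂ := lineDerivOp (Pi.single μ (1 : ℝ) : ι → ℝ) h with hh'
  set g : (ι → ℝ) → ℂ := fun t => ∏ ν, homKernel ((e + Pi.single μ 1 : ι → ℕ) ν)
    ((s + Pi.single μ 1 : ι → ℂ) ν) (t ν) with hg
  set g' : (ι → ℝ) → ℂ := fun t => s μ * ∏ ν, homKernel (e ν) (s ν) (t ν) with hg'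
  have i1 : Integrable fun t => ContinuousLinearMap.mul ℝ ℂ (h' t) (g t) :=
    integrable_schwartz_mul_homKernel h' _ hs'
  have i2 : Integrable fun t => ContinuousLinearMap.mul ℝ ℂ (h t) (g' t) :=
    ((integrable_schwartz_mul_homKernel h e hs).const_mul (s μ)).congr
      (.of_forall fun t => mul_left_comm _ _ _)
  have i3 : Integrable fun t => ContinuousLinearMap.mul ℝ ℂ (h t) (g t) :=
    integrable_schwartz_mul_homKernel h _ hs'
  have d1 : ∀ t, HasLineDerivAt ℝ h (h' t) t (Pi.single μ (1 : ℝ)) := fun t => by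
    rw [hh', SchwartzMap.lineDerivOp_apply_eq_fderiv]
    exact h.differentiableAt.hasFDerivAt.hasLineDerivAt _
  have d2 : ∀ t, HasLineDerivAt ℝ g (g' t) t (Pi.single μ (1 : ℝ)) := fun t =>
    hasLineDerivAt_prod_homKernel e hμ t
  have h1 := integral_bilinear_hasLineDerivAt_right_eq_neg_left_of_integrable i1 i2 i3
    (fun t _ => d1 t) fun t _ => d2 t
  rw [mellinZ, mellinZ, ← integral_const_mul]
  refine Eq.trans (integral_congr_ae (.of_forall fun t => ?_)) h1
  exact (mul_left_comm _ _ _).symm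

theorem differentiable_prod_comp_apply {f : ι → ℂ → ℂ} (hf : ∀ μ, Differentiable ℂ (f μ)) :
    Differentiable ℂ fun s : ι → ℂ => ∏ μ, f μ (s μ) := by
  classical
  have key : ∀ S : Finset ι, Differentiable ℂ fun s : ι → ℂ => ∏ μ ∈ S, f μ (s μ) := by
    intro S
    induction S using Finset.induction_on with
    | empty => simp
    | insert i S hi ih =>
      simp only [Finset.prod_insert hi]
      exact ((hf i).comp (differentiable_apply i)).mul ih
  exact key Finset.univ

/-- The Mellin transform divided by the complex Gamma factors. -/
def normMellinZ (h : SchwartzMap (ι → ℝ) ℂ) (e : ι → ℕ) (s : ι → ℂ) : ℂ :=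
  mellinZ h e s * ∏ μ, (Complex.Gammaℂ (s μ))⁻¹

theorem differentiableOn_normMellinZ (h : SchwartzMap (ι → ℝ) ℂ) (e : ι → ℕ) :
    DifferentiableOn ℂ (normMellinZ h e) {s | ∀ μ, 0 < (s μ).re} := by
  refine (differentiableOn_mellinZ h e).mul (Differentiable.differentiableOn ?_)
  exact differentiable_prod_comp_apply fun _ => Complex.differentiable_Gammaℂ_inv

open LineDeriv in
/-- The factor `s_μ` of the integration by parts is absorbed by the Gamma factor. -/
theorem normMellinZ_by_parts [DecidableEq ι] (h : SchwartzMap (ι → ℝ) ℂ) (e : ι → ℕ) {s : ι → ℂ}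
    (hs : ∀ ν, 0 < (s ν).re) {μ : ι} (hμ : 1 < (s μ).re) :
    normMellinZ h e s = -(1 / (2 * Real.pi)) *
      normMellinZ (lineDerivOp (Pi.single μ (1 : ℝ) : ι → ℝ) h) (e + Pi.single μ 1)
        (s + Pi.single μ 1) := by
  have hs0 : s μ ≠ 0 := by
    intro h0
    have := hs μ
    rw [h0] at this
    simp at this
  have hpi : (Real.pi : ℂ) ≠ 0 := by exact_mod_cast Real.pi_ne_zero
  rw [normMellinZ, normMellinZ, ← Finset.mul_prod_erase _ _ (Finset.mem_univ μ),
    ← Finset.mul_prod_erase _ _ (Finset.mem_univ μ)]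
  have h1 : ∏ ν ∈ Finset.univ.erase μ, (Complex.Gammaℂ ((s + Pi.single μ 1 : ι → ℂ) ν))⁻¹ =
      ∏ ν ∈ Finset.univ.erase μ, (Complex.Gammaℂ (s ν))⁻¹ :=
    Finset.prod_congr rfl fun ν hν => by simp [Finset.ne_of_mem_erase hν]
  have h2 : Complex.Gammaℂ ((s + Pi.single μ 1 : ι → ℂ) μ) =
      Complex.Gammaℂ (s μ) * s μ / 2 / Real.pi := by
    simpa using Complex.Gammaℂ_add_one hs0
  have h3 := mellinZ_by_parts h e hs hμ
  rw [h1, h2, ← neg_eq_iff_eq_neg.2 h3]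
  rw [inv_div, div_div_eq_mul_div]
  field_simp

/-- Integration by parts in all variables at once moves the argument to the right by `1`. -/
theorem exists_shift (h : SchwartzMap (ι → ℝ) ℂ) : ∃ h' : SchwartzMap (ι → ℝ) ℂ,
    ∀ (e : ι → ℕ) (s : ι → ℂ), (∀ μ, 1 < (s μ).re) →
      normMellinZ h e s = (-(1 / (2 * Real.pi)) : ℂ) ^ Fintype.card ι *
        normMellinZ h' (e + 1) (s + 1) := by
  classical
  have key : ∀ S : Finset ι, ∃ h' : SchwartzMap (ι → ℝ) ℂ,
      ∀ (e : ι → ℕ) (s : ι → ℂ), (∀ μ, 1 < (s μ).re) →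
        normMellinZ h e s = (-(1 / (2 * Real.pi)) : ℂ) ^ S.card *
          normMellinZ h' (e + fun μ => if μ ∈ S then 1 else 0)
            (s + fun μ => if μ ∈ S then 1 else 0) := by
    intro S
    induction S using Finset.induction_on with
    | empty =>
      refine ⟨h, fun e s _ => ?_⟩
      have h1 : (e + fun μ => if μ ∈ (∅ : Finset ι) then 1 else 0) = e := by funext μ; simp
      have h2 : (s + fun μ => if μ ∈ (∅ : Finset ι) then 1 else 0) = s := by funext μ; simp
      rw [h1, h2]; simp
    | insert i S hi ih =>
      obtain ⟨h', hh⟩ := ih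
      refine ⟨LineDeriv.lineDerivOp (Pi.single i (1 : ℝ) : ι → ℝ) h', fun e s hs => ?_⟩
      have hs1 : ∀ ν, 1 < ((s + fun μ => if μ ∈ S then (1 : ℂ) else 0) ν).re := by
        intro ν
        have := hs ν
        by_cases hν : ν ∈ S
        · simp only [Pi.add_apply, hν, if_true, Complex.add_re, Complex.one_re]; linarith
        · simpa [hν] using this
      rw [hh e s hs, normMellinZ_by_parts h' _ (fun ν => one_pos.trans (hs1 ν)) (hs1 i),
        ← mul_assoc, ← pow_succ, Finset.card_insert_of_notMem hi]
      congr 2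
      · rw [add_assoc]
        congr 1
        funext μ
        by_cases hμ : μ = i
        · subst hμ; simp [hi]
        · simp [hμ]
      · rw [add_assoc]
        congr 1
        funext μ
        by_cases hμ : μ = i
        · subst hμ; simp [hi]
        · simp [hμ]
  obtain ⟨h', hh⟩ := key Finset.univ
  refine ⟨h', fun e s hs => ?_⟩
  rw [hh e s hs]
  simp only [Finset.mem_univ, if_true]
  rfl

/-- Repeated integration by parts continues the normalized Mellin transform to an entire
function. -/
theorem exists_entire_normMellinZ (h : SchwartzMap (ι → ℝ) ℂ) (e : ι → ℕ) :
    ∃ G : (ι → ℂ) → ℂ, Differentiable ℂ G ∧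
      ∀ s, (∀ μ, 0 < (s μ).re) → G s = normMellinZ h e s := by
  choose D hD using exists_shift (ι := ι)
  set c : ℂ := (-(1 / (2 * Real.pi)) : ℂ) ^ Fintype.card ι
  -- `L k` is holomorphic for `Re s > -k`, and `L k` and `L (k + 1)` agree for `Re s > 1 - k`
  set L : ℕ → (ι → ℂ) → ℂ := fun k s => c ^ k * normMellinZ (D^[k] h) (e + k) (s + k) with hL
  have hstep : ∀ (k : ℕ) (s : ι → ℂ), (∀ μ, 1 - (k : ℝ) < (s μ).re) → L k s = L (k + 1) s := by
    intro k s hs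
    simp only [hL]
    rw [hD (D^[k] h) (e + k) (s + k) fun μ => ?_, ← mul_assoc, ← pow_succ,
      Function.iterate_succ_apply']
    · congr 2
      push_cast
      rw [add_assoc]
    · have := hs μ
      simp only [Pi.add_apply, Pi.natCast_apply, Complex.add_re, Complex.natCast_re]
      linarith
  have hmono : ∀ (k m : ℕ) (s : ι → ℂ), k ≤ m → (∀ μ, 1 - (k : ℝ) < (s μ).re) →
      L k s = L m s := by
    intro k m s hkm hs
    induction m, hkm using Nat.le_induction with
    | base => rfl
    | succ m hkm ih =>
      rw [ih]
      refine hstep m s fun μ => ?_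
      have h1 : (k : ℝ) ≤ m := by exact_mod_cast hkm
      linarith [hs μ]
  have hK : ∀ s : ι → ℂ, ∃ k : ℕ, ∀ μ, 1 - (k : ℝ) < (s μ).re := by
    intro s
    obtain ⟨k, hk⟩ := exists_nat_gt (1 + ∑ μ, |(s μ).re|)
    refine ⟨k, fun μ => ?_⟩
    have h1 := Finset.single_le_sum (f := fun μ => |(s μ).re|) (fun _ _ => abs_nonneg _)
      (Finset.mem_univ μ)
    have h2 := neg_abs_le (s μ).re
    linarith
  choose K hK using hK
  set G : (ι → ℂ) → ℂ := fun s => L (K s) s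
  have hG : ∀ (k : ℕ) (s : ι → ℂ), (∀ μ, 1 - (k : ℝ) < (s μ).re) → G s = L k s := by
    intro k s hs
    rw [hmono k (max k (K s)) s (le_max_left _ _) hs]
    exact hmono (K s) _ s (le_max_right _ _) (hK s)
  have hLd : ∀ k, DifferentiableOn ℂ (L k) {s | ∀ μ, -(k : ℝ) < (s μ).re} := by
    intro k
    refine ((differentiableOn_normMellinZ (D^[k] h) (e + k)).comp (g := normMellinZ _ _)
      (f := fun s : ι → ℂ => s + k) (by fun_prop) fun s hs μ => ?_).const_mul _
    have := hs μ
    simp only [Pi.add_apply, Pi.natCast_apply, Complex.add_re, Complex.natCast_re]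
    linarith
  have hGd : Differentiable ℂ G := by
    intro s
    have h1 : {s' : ι → ℂ | ∀ μ, 1 - (K s : ℝ) < (s' μ).re} ∈ 𝓝 s :=
      (isOpen_re_gt _).mem_nhds (hK s)
    have h2 : {s' : ι → ℂ | ∀ μ, -(K s : ℝ) < (s' μ).re} ∈ 𝓝 s :=
      Filter.mem_of_superset h1 fun s' hs' μ => by linarith [hs' μ]
    refine ((hLd (K s)).differentiableAt h2).congr_of_eventuallyEq ?_
    filter_upwards [h1] with s' hs'
    exact hG _ s' hs'
  refine ⟨G, hGd, ?_⟩
  have hconv : Convex ℝ {s : ι → ℂ | ∀ μ, 0 < (s μ).re} := by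
    intro z hz w hw a b ha hb hab μ
    have h1 := hz μ
    have h2 := hw μ
    simp only [Pi.add_apply, Pi.smul_apply, Complex.add_re, Complex.real_smul,
      Complex.re_ofReal_mul]
    rcases ha.eq_or_lt with rfl | ha
    · rw [zero_add] at hab
      rw [hab]; linarith
    · nlinarith [mul_pos ha h1, mul_nonneg hb h2.le]
  -- `G` is the given function for `Re s > 1` by construction, and for `Re s > 0` by the identity
  -- theorem
  have h1 : (fun _ => 2 : ι → ℂ) ∈ {s : ι → ℂ | ∀ μ, 1 < (s μ).re} := fun μ => by norm_num
  have hev : G =ᶠ[𝓝 (fun _ => 2)] normMellinZ h e := by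
    filter_upwards [(isOpen_re_gt 1).mem_nhds h1] with s hs
    rw [hG 0 s fun μ => by simpa using hs μ]
    simp [hL]
  exact eqOn_of_convex_of_eventuallyEq hconv (isOpen_re_gt 0) hGd.differentiableOn
    (differentiableOn_normMellinZ h e) (fun μ => by norm_num) hev

end

/-! ### The functional equation of Mellin transforms -/

section

open Topology

/-- The Gaussian family `t^a exp(-π u t²)`, weighted so that its integral over `u` is homogeneous
in `t`. -/
def gaussKernel (a : ℕ) (s : ℂ) (t u : ℝ) : ℂ :=
  (t : ℂ) ^ a * (Complex.exp (-(Real.pi * t ^ 2 * u)) * (u : ℂ) ^ ((1 - s + a) / 2 - 1))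

/-- The Gaussian family of `gaussKernel` with inverted parameter. -/
def gaussKernelInv (a : ℕ) (s : ℂ) (t u : ℝ) : ℂ :=
  (t : ℂ) ^ a * (Complex.exp (-(Real.pi * t ^ 2 * u⁻¹)) * (u : ℂ) ^ (-((1 - s + a) / 2) - 1))

/-- The homogeneous kernel is a superposition of Gaussians. -/
theorem integral_gaussKernel (a : ℕ) {s : ℂ} (hs : s.re < 1) {t : ℝ} (ht : t ≠ 0) :
    ∫ u in Set.Ioi (0 : ℝ), gaussKernel a s t u =
      Complex.Gammaℝ (1 - s + a) * homKernel a s t := by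
  have ht2 : 0 < Real.pi * t ^ 2 := by positivity
  have habs : (0 : ℝ) < |t| := abs_pos.2 ht
  have habsc : ((|t| : ℝ) : ℂ) ≠ 0 := by exact_mod_cast habs.ne'
  have hw : 0 < ((1 - s + a) / 2).re := by
    have : (0 : ℝ) ≤ a := Nat.cast_nonneg a
    simp
    linarith
  have h1 := Complex.integral_cpow_mul_exp_neg_mul_Ioi hw ht2
  unfold gaussKernel
  rw [integral_const_mul]
  have h2 : ∫ u in Set.Ioi (0 : ℝ), Complex.exp (-(Real.pi * t ^ 2 * u)) *
      (u : ℂ) ^ ((1 - s + a) / 2 - 1) = (1 / (Real.pi * t ^ 2 : ℝ)) ^ ((1 - s + a) / 2) *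
        Complex.Gamma ((1 - s + a) / 2) := by
    rw [← h1]
    refine setIntegral_congr_fun measurableSet_Ioi fun u _ => ?_
    rw [mul_comm]
    push_cast
    rfl
  have h3 : (1 / (Real.pi * t ^ 2 : ℝ) : ℂ) ^ ((1 - s + a) / 2) =
      (Real.pi : ℂ) ^ (-(1 - s + a) / 2) * ((|t| : ℝ) : ℂ) ^ (s - 1 - a) := by
    have e1 : (1 / ((Real.pi * t ^ 2 : ℝ) : ℂ)) = ((Real.pi * t ^ 2 : ℝ) : ℂ)⁻¹ := one_div _
    rw [e1, Complex.inv_cpow _ _ (by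
      rw [Complex.arg_ofReal_of_nonneg ht2.le]; exact Real.pi_pos.ne), ← Complex.cpow_neg,
      Complex.ofReal_mul, Complex.mul_cpow_ofReal_nonneg Real.pi_pos.le (by positivity)]
    congr 1
    · congr 1
      ring
    · rw [← sq_abs, sq, Complex.ofReal_mul, Complex.mul_cpow_ofReal_nonneg habs.le habs.le,
        ← Complex.cpow_add _ _ habsc]
      congr 1
      ring
  have h4 : (t : ℂ) ^ a = ((t / |t| : ℝ) : ℂ) ^ a * ((|t| : ℝ) : ℂ) ^ (a : ℂ) := by
    rw [Complex.cpow_natCast, ← mul_pow, ← Complex.ofReal_mul, div_mul_cancel₀ _ habs.ne']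
  have h5 : ((|t| : ℝ) : ℂ) ^ (s - 1) = ((|t| : ℝ) : ℂ) ^ (a : ℂ) *
      ((|t| : ℝ) : ℂ) ^ (s - 1 - a) := by
    rw [← Complex.cpow_add _ _ habsc, add_sub_cancel]
  rw [h2, h3, h4, Complex.Gammaℝ_def, homKernel, h5]
  ring

/-- The substitution `u ↦ u⁻¹` in `integral_gaussKernel`. -/
theorem integral_gaussKernelInv (a : ℕ) {s : ℂ} (hs : s.re < 1) {t : ℝ} (ht : t ≠ 0) :
    ∫ u in Set.Ioi (0 : ℝ), gaussKernelInv a s t u =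
      Complex.Gammaℝ (1 - s + a) * homKernel a s t := by
  rw [← integral_gaussKernel a hs ht]
  unfold gaussKernel gaussKernelInv
  rw [integral_const_mul, integral_const_mul]
  congr 1
  have h := mellin_comp_inv (fun u : ℝ => Complex.exp (-(Real.pi * t ^ 2 * u)))
    (-((1 - s + a) / 2))
  rw [neg_neg, mellin, mellin] at h
  simp only [smul_eq_mul] at h
  refine Eq.trans ?_ (h.trans ?_)
  · refine setIntegral_congr_fun measurableSet_Ioi fun u _ => ?_
    rw [mul_comm, Complex.ofReal_inv]
  · exact setIntegral_congr_fun measurableSet_Ioi fun u _ => mul_comm _ _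

/-- The norm of the kernel is the kernel with real parameters, so that the integral of the norm is
known as well. -/
theorem norm_gaussKernel (a : ℕ) (s : ℂ) (t : ℝ) {u : ℝ} (hu : 0 < u) :
    (‖gaussKernel a s t u‖ : ℂ) = gaussKernel a s.re |t| u := by
  have h : (1 - (s.re : ℂ) + a) / 2 - 1 = (((1 - s.re + a) / 2 - 1 : ℝ) : ℂ) := by push_cast; ring
  have h' : ((1 - s + a) / 2 - 1).re = (1 - s.re + a) / 2 - 1 := by simp
  rw [gaussKernel, gaussKernel, norm_mul, norm_mul, norm_pow, Complex.norm_real, Real.norm_eq_abs,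
    Complex.norm_cpow_eq_rpow_re_of_pos hu, h, h', ← Complex.ofReal_cpow hu.le, Complex.norm_exp]
  push_cast
  congr 3
  rw [← Complex.ofReal_pow |t|, sq_abs]
  norm_cast

theorem norm_gaussKernelInv (a : ℕ) (s : ℂ) (t : ℝ) {u : ℝ} (hu : 0 < u) :
    (‖gaussKernelInv a s t u‖ : ℂ) = gaussKernelInv a s.re |t| u := by
  have h : -((1 - (s.re : ℂ) + a) / 2) - 1 = ((-((1 - s.re + a) / 2) - 1 : ℝ) : ℂ) := by
    push_cast; ring
  have h' : (-((1 - s + a) / 2) - 1).re = -((1 - s.re + a) / 2) - 1 := by simp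
  rw [gaussKernelInv, gaussKernelInv, norm_mul, norm_mul, norm_pow, Complex.norm_real,
    Real.norm_eq_abs, Complex.norm_cpow_eq_rpow_re_of_pos hu, h, h', ← Complex.ofReal_cpow hu.le,
    Complex.norm_exp]
  push_cast
  congr 3
  rw [← Complex.ofReal_pow |t|, sq_abs]
  norm_cast

theorem integral_norm_eq_norm_integral {F G : ℝ → ℂ} (h : ∀ u, 0 < u → (‖F u‖ : ℂ) = G u) :
    ∫ u in Set.Ioi (0 : ℝ), ‖F u‖ = ‖∫ u in Set.Ioi (0 : ℝ), G u‖ := by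
  have h1 : ∫ u in Set.Ioi (0 : ℝ), G u = ((∫ u in Set.Ioi (0 : ℝ), ‖F u‖ : ℝ) : ℂ) := by
    refine Eq.trans ?_ integral_ofReal
    exact setIntegral_congr_fun measurableSet_Ioi fun u hu => (h u hu).symm
  rw [h1, Complex.norm_real, Real.norm_of_nonneg (integral_nonneg fun _ => norm_nonneg _)]

theorem integral_norm_gaussKernel (a : ℕ) {s : ℂ} (hs : s.re < 1) {t : ℝ} (ht : t ≠ 0) :
    ∫ u in Set.Ioi (0 : ℝ), ‖gaussKernel a s t u‖ =
      ‖Complex.Gammaℝ (1 - s.re + a)‖ * |t| ^ (s.re - 1) := by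
  rw [integral_norm_eq_norm_integral fun u hu => norm_gaussKernel a s t hu,
    integral_gaussKernel a (by simpa using hs) (abs_ne_zero.2 ht), norm_mul,
    norm_homKernel _ _ (abs_ne_zero.2 ht), abs_abs, Complex.ofReal_re]

theorem integral_norm_gaussKernelInv (a : ℕ) {s : ℂ} (hs : s.re < 1) {t : ℝ} (ht : t ≠ 0) :
    ∫ u in Set.Ioi (0 : ℝ), ‖gaussKernelInv a s t u‖ =
      ‖Complex.Gammaℝ (1 - s.re + a)‖ * |t| ^ (s.re - 1) := by
  rw [integral_norm_eq_norm_integral fun u hu => norm_gaussKernelInv a s t hu,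
    integral_gaussKernelInv a (by simpa using hs) (abs_ne_zero.2 ht), norm_mul,
    norm_homKernel _ _ (abs_ne_zero.2 ht), abs_abs, Complex.ofReal_re]

theorem measurable_gaussKernel (a : ℕ) (s : ℂ) :
    Measurable (Function.uncurry (gaussKernel a s)) := by
  have h1 : Measurable fun p : ℝ × ℝ => (p.2 : ℂ) := by fun_prop
  have h2 : Measurable fun p : ℝ × ℝ => (p.1 : ℂ) ^ a *
      Complex.exp (-(Real.pi * p.1 ^ 2 * p.2)) := by fun_prop
  have h3 := h2.mul (h1.pow_const ((1 - s + a) / 2 - 1))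
  convert h3 using 1
  funext p
  exact (mul_assoc _ _ _).symm

theorem measurable_gaussKernelInv (a : ℕ) (s : ℂ) :
    Measurable (Function.uncurry (gaussKernelInv a s)) := by
  have h1 : Measurable fun p : ℝ × ℝ => (p.2 : ℂ) := by fun_prop
  have h2 : Measurable fun p : ℝ × ℝ => (p.1 : ℂ) ^ a *
      Complex.exp (-(Real.pi * p.1 ^ 2 * (p.2 : ℂ)⁻¹)) := by fun_prop
  have h3 := h2.mul (h1.pow_const (-((1 - s + a) / 2) - 1))
  convert h3 using 1
  funext p
  simp only [Function.uncurry, gaussKernelInv, Pi.mul_apply, Complex.ofReal_inv, mul_assoc]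

theorem integrable_gaussKernelInv {a : ℕ} (ha : a ≤ 1) (s : ℂ) {u : ℝ} (hu : 0 < u) :
    Integrable fun x => gaussKernelInv a s x u := by
  have hb : 0 < (Real.pi * u⁻¹ : ℂ).re := by
    rw [← Complex.ofReal_mul, Complex.ofReal_re]
    positivity
  have h1 : Integrable fun x : ℝ => (x : ℂ) ^ a * Complex.exp (-(Real.pi * u⁻¹ : ℂ) * x ^ 2) := by
    interval_cases a
    · simpa using integrable_cexp_neg_mul_sq hb
    · simpa using integrable_mul_cexp_neg_mul_sq hb
  refine (h1.mul_const ((u : ℂ) ^ (-((1 - s + a) / 2) - 1))).congr (.of_forall fun x => ?_)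
  simp only [gaussKernelInv]
  rw [mul_assoc]
  congr 3
  ring

/-- The Fourier transform of `x^a exp(-π x² / u)` for `a ≤ 1`. -/
theorem integral_pow_mul_gauss {a : ℕ} (ha : a ≤ 1) {u : ℝ} (hu : 0 < u) (t : ℝ) :
    ∫ x : ℝ, Complex.exp (-2 * Real.pi * Complex.I * (x * t)) *
      ((x : ℂ) ^ a * Complex.exp (-(Real.pi * x ^ 2 * (u : ℂ)⁻¹))) =
      (-Complex.I) ^ a * (u : ℂ) ^ (1 / 2 + a : ℂ) *
        ((t : ℂ) ^ a * Complex.exp (-(Real.pi * t ^ 2 * u))) := by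
  have huc : (u : ℂ) ≠ 0 := by exact_mod_cast hu.ne'
  have hpi : (Real.pi : ℂ) ≠ 0 := by exact_mod_cast Real.pi_ne_zero
  have hb : 0 < ((u : ℂ)⁻¹).re := by
    rw [← Complex.ofReal_inv, Complex.ofReal_re]
    positivity
  have hb' : 0 < ((Real.pi : ℂ) * (u : ℂ)⁻¹).re := by
    rw [← Complex.ofReal_inv, ← Complex.ofReal_mul, Complex.ofReal_re]
    positivity
  have h0 := fourier_gaussian_pi hb
  have hval : (1 / ((u : ℂ)⁻¹) ^ (1 / 2 : ℂ)) = (u : ℂ) ^ (1 / 2 : ℂ) := by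
    rw [Complex.inv_cpow _ _ (by
      rw [Complex.arg_ofReal_of_nonneg hu.le]; exact Real.pi_pos.ne), one_div, inv_inv]
  rw [hval] at h0
  set f : ℝ → ℂ := fun x => Complex.exp (-Real.pi * (u : ℂ)⁻¹ * x ^ 2) with hf
  have hint : ∀ g : ℝ → ℂ, ∫ x : ℝ, Complex.exp (-2 * Real.pi * Complex.I * (x * t)) * g x =
      FourierTransform.fourier g t := by
    intro g
    rw [Real.fourier_real_eq_integral_exp_smul]
    refine integral_congr_ae (.of_forall fun x => ?_)
    simp only [smul_eq_mul]
    congr 2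
    push_cast
    ring
  have hexp : ∀ x : ℝ, Complex.exp (-(Real.pi * x ^ 2 * (u : ℂ)⁻¹)) = f x := by
    intro x
    simp only [hf]
    congr 1
    ring
  simp_rw [hexp]
  rw [hint]
  have hpow : Complex.exp (-(Real.pi * t ^ 2 * u)) =
      Complex.exp (-Real.pi / (u : ℂ)⁻¹ * t ^ 2) := by
    congr 1
    rw [div_inv_eq_mul]
    ring
  interval_cases a
  · simp only [pow_zero, one_mul, Nat.cast_zero, add_zero]
    rw [show (fun x => f x) = f from rfl, h0, hpow]
  · have hfi : Integrable f := by
      simpa [hf] using integrable_cexp_neg_mul_sq hb'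
    have hd : ∀ x : ℝ, HasDerivAt f (-(2 * Real.pi * (u : ℂ)⁻¹) * (x * f x)) x := by
      intro x
      have h1 : HasDerivAt (fun z : ℂ => Complex.exp (-Real.pi * (u : ℂ)⁻¹ * z ^ 2))
          (Complex.exp (-Real.pi * (u : ℂ)⁻¹ * (x : ℂ) ^ 2) *
            (-Real.pi * (u : ℂ)⁻¹ * (((2 : ℕ) : ℂ) * (x : ℂ) ^ (2 - 1)))) (x : ℂ) :=
        ((hasDerivAt_pow 2 (x : ℂ)).const_mul _).cexp
      refine h1.comp_ofReal.congr_deriv ?_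
      simp only [hf]
      push_cast
      ring
    have hderiv : deriv f = fun x : ℝ => -(2 * Real.pi * (u : ℂ)⁻¹) * (x * f x) :=
      funext fun x => (hd x).deriv
    have hxi : Integrable fun x : ℝ => (x : ℂ) * f x := by
      simpa [hf] using integrable_mul_cexp_neg_mul_sq hb'
    have h1 := Real.fourier_deriv hfi (fun x => (hd x).differentiableAt)
      (by rw [hderiv]; exact hxi.const_mul _)
    have h2 := congrFun h1 t
    rw [hderiv, ← hint] at h2
    simp_rw [mul_left_comm (Complex.exp _) (-(2 * Real.pi * (u : ℂ)⁻¹))] at h2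
    rw [integral_const_mul, hint, h0] at h2
    simp only [pow_one, Nat.cast_one, smul_eq_mul] at h2 ⊢
    rw [Complex.cpow_add _ _ huc, Complex.cpow_one, hpow]
    have h3 : (-(2 * Real.pi * (u : ℂ)⁻¹)) ≠ 0 :=
      neg_ne_zero.2 (mul_ne_zero (mul_ne_zero two_ne_zero hpi) (inv_ne_zero huc))
    refine mul_left_cancel₀ h3 (h2.trans ?_)
    field_simp

/-- The two Gaussian families, at `s` and at `1 - s`, are Fourier transforms of each other for each
value of the parameter `u`. -/
theorem gaussKernel_eq_integral {a : ℕ} (ha : a ≤ 1) (s : ℂ) {u : ℝ} (hu : 0 < u) (t : ℝ) :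
    gaussKernel a s t u = Complex.I ^ a * ∫ x : ℝ,
      Complex.exp (-2 * Real.pi * Complex.I * (x * t)) * gaussKernelInv a (1 - s) x u := by
  have huc : (u : ℂ) ≠ 0 := by exact_mod_cast hu.ne'
  have h0 : ∀ x : ℝ, Complex.exp (-2 * Real.pi * Complex.I * (x * t)) *
      gaussKernelInv a (1 - s) x u = Complex.exp (-2 * Real.pi * Complex.I * (x * t)) *
      ((x : ℂ) ^ a * Complex.exp (-(Real.pi * x ^ 2 * (u : ℂ)⁻¹))) *
        (u : ℂ) ^ (-((1 - (1 - s) + a) / 2) - 1) := fun x => by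
    rw [gaussKernelInv, Complex.ofReal_inv]
    simp only [mul_assoc]
  simp_rw [h0]
  rw [integral_mul_const, integral_pow_mul_gauss ha hu, gaussKernel]
  have h1 : (u : ℂ) ^ ((1 - s + a) / 2 - 1) = (u : ℂ) ^ (1 / 2 + a : ℂ) *
      (u : ℂ) ^ (-((1 - (1 - s) + a) / 2) - 1) := by
    rw [← Complex.cpow_add _ _ huc]
    congr 1
    ring
  have h2 : Complex.I ^ a * (-Complex.I) ^ a = 1 := by
    rw [← mul_pow]; simp
  rw [h1]
  linear_combination (-((t : ℂ) ^ a * Complex.exp (-(Real.pi * t ^ 2 * u)) *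
    ((u : ℂ) ^ (1 / 2 + a : ℂ) * (u : ℂ) ^ (-((1 - (1 - s) + a) / 2) - 1)))) * h2

variable {ι : Type} [Fintype ι]

/-- Fubini's theorem for a superposition of test functions whose integral is homogeneous. -/
theorem prod_mul_mellinZ_eq_integral (h : SchwartzMap (ι → ℝ) ℂ) (a : ι → ℕ) {s : ι → ℂ}
    (hs : ∀ μ, 0 < (s μ).re) {k : ι → ℝ → ℝ → ℂ} (hk : ∀ μ, Measurable (Function.uncurry (k μ)))
    {c : ι → ℂ} (hc : ∀ μ, c μ ≠ 0)
    (hint : ∀ μ, ∀ t ≠ 0, ∫ u in Set.Ioi (0 : ℝ), k μ t u = c μ * homKernel (a μ) (s μ) t)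
    {C : ι → ℝ} (hnorm : ∀ μ, ∀ t ≠ 0,
      ∫ u in Set.Ioi (0 : ℝ), ‖k μ t u‖ = C μ * |t| ^ ((s μ).re - 1)) :
    (∏ μ, c μ) * mellinZ h a s =
      ∫ u : ι → ℝ, (∫ t : ι → ℝ, h t * ∏ μ, k μ (t μ) (u μ))
        ∂(Measure.pi fun _ : ι => (volume : Measure ℝ).restrict (Set.Ioi 0)) := by
  set κ : Measure (ι → ℝ) := Measure.pi fun _ : ι => (volume : Measure ℝ).restrict (Set.Ioi 0)
  have hC : ∀ μ, 0 ≤ C μ := fun μ => by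
    have h1 := hnorm μ 1 one_ne_zero
    rw [abs_one, Real.one_rpow, mul_one] at h1
    rw [← h1]
    exact integral_nonneg fun _ => norm_nonneg _
  have hki : ∀ μ, ∀ t ≠ 0, Integrable (k μ t) (volume.restrict (Set.Ioi (0 : ℝ))) := by
    intro μ t ht
    refine Integrable.of_integral_ne_zero ?_
    rw [hint μ t ht]
    refine mul_ne_zero (hc μ) (norm_ne_zero_iff.1 ?_)
    rw [norm_homKernel _ _ ht]
    have := abs_pos.2 ht
    positivity
  have hmeas : Measurable fun p : (ι → ℝ) × (ι → ℝ) => h p.1 * ∏ μ, k μ (p.1 μ) (p.2 μ) := by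
    refine (h.continuous.measurable.comp measurable_fst).mul
      (Finset.measurable_fun_prod _ fun μ _ => ?_)
    have h1 : Measurable fun p : (ι → ℝ) × (ι → ℝ) => (p.1 μ, p.2 μ) := by fun_prop
    exact (hk μ).comp h1
  have hI : Integrable (Function.uncurry fun t u : ι → ℝ => h t * ∏ μ, k μ (t μ) (u μ))
      (volume.prod κ) := by
    refine (integrable_prod_iff hmeas.aestronglyMeasurable).2 ⟨?_, ?_⟩
    · filter_upwards [ae_forall_ne_zero] with t ht
      exact (Integrable.fintype_prod (f := fun μ => k μ (t μ)) fun μ =>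
        hki μ (t μ) (ht μ)).const_mul _
    · have h1 : Integrable fun t => h t * ∏ μ, (C μ * homKernel (a μ) (s μ) (t μ)) := by
        refine integrable_schwartz_mul_of_le h
          (f := fun μ t => (C μ : ℂ) * homKernel (a μ) (s μ) t)
          (fun μ => (measurable_homKernel _ _).const_mul _) hs hs (C := C) ?_
        intro μ t ht
        rw [norm_mul, norm_homKernel _ _ ht, Complex.norm_real, Real.norm_of_nonneg (hC μ)]
        have : 0 ≤ |t| ^ ((s μ).re - 1) := by positivity
        exact mul_le_mul_of_nonneg_left (by linarith) (hC μ)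
      refine h1.norm.congr ?_
      filter_upwards [ae_forall_ne_zero] with t ht
      simp only [norm_mul, norm_prod]
      rw [integral_const_mul, integral_fintype_prod_eq_prod (fun μ u => ‖k μ (t μ) u‖)]
      congr 1
      refine Finset.prod_congr rfl fun μ _ => ?_
      rw [norm_homKernel _ _ (ht μ), Complex.norm_real, Real.norm_of_nonneg (hC μ),
        hnorm μ _ (ht μ)]
  rw [← integral_integral_swap hI, mellinZ, ← integral_const_mul]
  refine integral_congr_ae ?_
  filter_upwards [ae_forall_ne_zero] with t ht
  rw [integral_const_mul, integral_fintype_prod_eq_prod (fun μ u => k μ (t μ) u),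
    mul_left_comm, ← Finset.prod_mul_distrib]
  congr 1
  exact Finset.prod_congr rfl fun μ _ => (hint μ _ (ht μ)).symm

/-- The multiplication formula `∫ h ĝ = ∫ ĥ g` for a product `g` of Gaussians. -/
theorem integral_mul_prod_gaussKernel (h h' : SchwartzMap (ι → ℝ) ℂ)
    (hh : ∀ ξ, h' ξ = ∫ t, h t *
      Complex.exp (-2 * Real.pi * Complex.I * ∑ μ, (t μ * ξ μ : ℂ)))
    {a : ι → ℕ} (ha : ∀ μ, a μ ≤ 1) (s : ι → ℂ) {u : ι → ℝ} (hu : ∀ μ, 0 < u μ) :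
    ∫ t, h t * ∏ μ, gaussKernel (a μ) (s μ) (t μ) (u μ) =
      (∏ μ, Complex.I ^ a μ) *
        ∫ x, h' x * ∏ μ, gaussKernelInv (a μ) (1 - s μ) (x μ) (u μ) := by
  have hK : Integrable fun x : ι → ℝ => ∏ μ, gaussKernelInv (a μ) (1 - s μ) (x μ) (u μ) :=
    Integrable.fintype_prod (f := fun μ x => gaussKernelInv (a μ) (1 - s μ) x (u μ)) fun μ =>
      integrable_gaussKernelInv (ha μ) _ (hu μ)
  have hI : Integrable (Function.uncurry fun t x : ι → ℝ =>
      Complex.exp (-2 * Real.pi * Complex.I * ∑ μ, (t μ * x μ : ℂ)) *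
        (h t * ∏ μ, gaussKernelInv (a μ) (1 - s μ) (x μ) (u μ))) (volume.prod volume) := by
    refine Integrable.bdd_mul (c := 1) (h.integrable.mul_prod hK) ?_ (.of_forall fun p => ?_)
    · exact Continuous.aestronglyMeasurable (by fun_prop)
    · have h1 : -2 * Real.pi * Complex.I * ∑ μ, (p.1 μ * p.2 μ : ℂ) =
          ((-2 * Real.pi * ∑ μ, p.1 μ * p.2 μ : ℝ) : ℂ) * Complex.I := by
        push_cast
        ring
      rw [h1, Complex.norm_exp_ofReal_mul_I]
  have h1 : ∀ t : ι → ℝ, h t * ∏ μ, gaussKernel (a μ) (s μ) (t μ) (u μ) =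
      (∏ μ, Complex.I ^ a μ) * ∫ x : ι → ℝ,
        Complex.exp (-2 * Real.pi * Complex.I * ∑ μ, (t μ * x μ : ℂ)) *
        (h t * ∏ μ, gaussKernelInv (a μ) (1 - s μ) (x μ) (u μ)) := by
    intro t
    have h2 : ∀ x : ι → ℝ, Complex.exp (-2 * Real.pi * Complex.I * ∑ μ, (t μ * x μ : ℂ)) *
        (h t * ∏ μ, gaussKernelInv (a μ) (1 - s μ) (x μ) (u μ)) =
        h t * ∏ μ, (Complex.exp (-2 * Real.pi * Complex.I * (x μ * t μ)) *
          gaussKernelInv (a μ) (1 - s μ) (x μ) (u μ)) := by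
      intro x
      rw [Finset.prod_mul_distrib, ← Complex.exp_sum, ← Finset.mul_sum, mul_left_comm]
      simp_rw [mul_comm (t _ : ℂ)]
    simp_rw [h2]
    rw [integral_const_mul, integral_fintype_prod_volume_eq_prod (fun μ (x : ℝ) =>
      Complex.exp (-2 * Real.pi * Complex.I * (x * t μ)) *
          gaussKernelInv (a μ) (1 - s μ) x (u μ)), mul_left_comm, ← Finset.prod_mul_distrib]
    congr 1
    exact Finset.prod_congr rfl fun μ _ => gaussKernel_eq_integral (ha μ) _ (hu μ) _
  simp_rw [h1]
  rw [integral_const_mul, integral_integral_swap hI]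
  congr 1
  refine integral_congr_ae (.of_forall fun x => ?_)
  simp only
  rw [hh, ← integral_mul_const]
  refine integral_congr_ae (.of_forall fun t => ?_)
  simp only
  ring

/-- The functional equation of the Mellin transforms of a Schwartz function and of its Fourier
transform, in the strip where both integrals converge. -/
theorem mellinZ_functional_equation (h h' : SchwartzMap (ι → ℝ) ℂ)
    (hh : ∀ ξ, h' ξ = ∫ t, h t *
      Complex.exp (-2 * Real.pi * Complex.I * ∑ μ, (t μ * ξ μ : ℂ)))
    {a : ι → ℕ} (ha : ∀ μ, a μ ≤ 1) {s : ι → ℂ} (hs0 : ∀ μ, 0 < (s μ).re)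
    (hs1 : ∀ μ, (s μ).re < 1) :
    (∏ μ, Complex.Gammaℝ (1 - s μ + a μ)) * mellinZ h a s =
      (∏ μ, Complex.I ^ a μ) *
        ((∏ μ, Complex.Gammaℝ (s μ + a μ)) * mellinZ h' a (fun μ => 1 - s μ)) := by
  have hr : ∀ μ, (1 - s μ).re < 1 := fun μ => by
    have := hs0 μ
    rw [Complex.sub_re, Complex.one_re]
    linarith
  have hr0 : ∀ μ, 0 < (1 - s μ).re := fun μ => by
    have := hs1 μ
    rw [Complex.sub_re, Complex.one_re]
    linarith
  have hG : ∀ (z : ℂ) (k : ℕ), 0 < z.re → Complex.Gammaℝ (z + k) ≠ 0 := fun z k hz =>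
    Complex.Gammaℝ_ne_zero_of_re_pos (by
      have : (0 : ℝ) ≤ k := Nat.cast_nonneg k
      rw [Complex.add_re, Complex.natCast_re]
      linarith)
  have h1 := prod_mul_mellinZ_eq_integral h a hs0 (k := fun μ => gaussKernel (a μ) (s μ))
    (fun μ => measurable_gaussKernel _ _) (fun μ => hG _ (a μ) (hr0 μ))
    (fun μ t ht => integral_gaussKernel _ (hs1 μ) ht)
    (fun μ t ht => integral_norm_gaussKernel _ (hs1 μ) ht)
  have h2 := prod_mul_mellinZ_eq_integral h' a (s := fun μ => 1 - s μ) hr0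
    (k := fun μ => gaussKernelInv (a μ) (1 - s μ))
    (fun μ => measurable_gaussKernelInv _ _) (c := fun μ => Complex.Gammaℝ (s μ + a μ))
    (fun μ => hG _ (a μ) (hs0 μ))
    (fun μ t ht => by rw [integral_gaussKernelInv _ (hr μ) ht, sub_sub_cancel])
    (fun μ t ht => integral_norm_gaussKernelInv _ (hr μ) ht)
  rw [h1, h2, ← integral_const_mul]
  refine integral_congr_ae ?_
  have hpos : ∀ᵐ u ∂(Measure.pi fun _ : ι => (volume : Measure ℝ).restrict (Set.Ioi 0)),
      ∀ μ, 0 < u μ := by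
    refine ae_all_iff.2 fun μ => ?_
    exact (Measure.quasiMeasurePreserving_eval
      (fun _ : ι => (volume : Measure ℝ).restrict (Set.Ioi 0)) μ).ae
        (ae_restrict_mem measurableSet_Ioi)
  filter_upwards [hpos] with u hu
  exact integral_mul_prod_gaussKernel h h' hh ha s hu

end

/-! ### The functional equation of the entire continuations -/

section

open Topology

variable {ι : Type} [Fintype ι]

/-- Only the parity of the exponent of the sign matters. -/
theorem homKernel_add_one {σ : ℕ} (hσ : σ ≤ 1) (s : ℂ) {t : ℝ} (ht : t ≠ 0) :
    homKernel (σ + 1) s t = homKernel (1 - σ) s t := by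
  interval_cases σ
  · rfl
  · have h : (t / |t|) ^ (1 + 1) = 1 := by
      rw [div_pow, one_add_one_eq_two, sq_abs, div_self (pow_ne_zero 2 ht)]
    rw [homKernel, homKernel, ← Complex.ofReal_pow, h, Nat.sub_self, pow_zero, Complex.ofReal_one]

theorem mellinZ_add_one (h : SchwartzMap (ι → ℝ) ℂ) {σ : ι → ℕ} (hσ : ∀ μ, σ μ ≤ 1) (s : ι → ℂ) :
    mellinZ h (σ + 1) s = mellinZ h (1 - σ) s := by
  refine integral_congr_ae ?_
  filter_upwards [ae_forall_ne_zero] with t ht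
  congr 1
  exact Finset.prod_congr rfl fun μ _ => homKernel_add_one (hσ μ) _ (ht μ)

/-- The Gamma factors for the two parities multiply to `Γ_ℂ`, by the duplication formula. -/
theorem Gammaℝ_mul_Gammaℝ_of_le_one {σ : ℕ} (hσ : σ ≤ 1) (s : ℂ) :
    Complex.Gammaℝ (σ + s) * Complex.Gammaℝ (s + ((1 - σ : ℕ) : ℂ)) = Complex.Gammaℂ s := by
  rw [← Complex.Gammaℝ_mul_Gammaℝ_add_one]
  interval_cases σ
  · simp
  · simp [add_comm, mul_comm]

/-- The functional equation of the completed normalized Mellin transforms in the critical strip. -/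
theorem normMellinZ_functional_equation (g g' : SchwartzMap (ι → ℝ) ℂ)
    (hg : ∀ ξ, g' ξ = Complex.I ^ Fintype.card ι * ∫ t, g t *
      Complex.exp (-2 * Real.pi * Complex.I * ∑ μ, (t μ * ξ μ : ℂ)))
    {σ : ι → ℕ} (hσ : ∀ μ, σ μ ≤ 1) {s : ι → ℂ} (hs0 : ∀ μ, 0 < (s μ).re)
    (hs1 : ∀ μ, (s μ).re < 1) :
    (∏ μ, Complex.Gammaℝ (σ μ + s μ)) * normMellinZ g (σ + 1) s =
      (∏ μ, Complex.I ^ σ μ)⁻¹ * ((∏ μ, Complex.Gammaℝ (σ μ + (1 - s μ))) *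
        normMellinZ g' (σ + 1) (fun μ => 1 - s μ)) := by
  set c : ℂ := Complex.I ^ Fintype.card ι
  have hc : c ≠ 0 := pow_ne_zero _ Complex.I_ne_zero
  set h' : SchwartzMap (ι → ℝ) ℂ := c⁻¹ • g' with hh'
  have hh : ∀ ξ, h' ξ = ∫ t, g t *
      Complex.exp (-2 * Real.pi * Complex.I * ∑ μ, (t μ * ξ μ : ℂ)) := fun ξ => by
    rw [hh', _root_.smul_apply, hg, smul_eq_mul, inv_mul_cancel_left₀ hc]
  have hM : ∀ z, mellinZ h' (1 - σ) z = c⁻¹ * mellinZ g' (1 - σ) z := fun z => by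
    rw [mellinZ, mellinZ, ← integral_const_mul]
    refine integral_congr_ae (.of_forall fun t => ?_)
    simp only [hh', _root_.smul_apply, smul_eq_mul, mul_assoc]
  have hFE := mellinZ_functional_equation g h' hh (a := 1 - σ) (fun μ => Nat.sub_le _ _) hs0 hs1
  rw [hM] at hFE
  have hI : (∏ μ, Complex.I ^ σ μ) * ∏ μ, Complex.I ^ (1 - σ : ι → ℕ) μ = c := by
    rw [← Finset.prod_mul_distrib, Finset.prod_congr rfl fun μ _ => ?_, Finset.prod_const,
      Finset.card_univ]
    rw [← pow_add, Pi.sub_apply, Pi.one_apply, Nat.add_sub_cancel' (hσ μ), pow_one]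
  have hr0 : ∀ μ, 0 < (1 - s μ).re := fun μ => by
    have := hs1 μ
    rw [Complex.sub_re, Complex.one_re]
    linarith
  have hne : ∀ (z : ι → ℂ), (∀ μ, 0 < (z μ).re) → ∀ k : ι → ℕ,
      ∏ μ, Complex.Gammaℝ (z μ + k μ) ≠ 0 := fun z hz k => Finset.prod_ne_zero_iff.2 fun μ _ =>
    Complex.Gammaℝ_ne_zero_of_re_pos (by
      have : (0 : ℝ) ≤ k μ := Nat.cast_nonneg (k μ)
      have := hz μ
      rw [Complex.add_re, Complex.natCast_re]
      linarith)
  have hG : ∀ z : ι → ℂ, ∏ μ, (Complex.Gammaℂ (z μ))⁻¹ = (∏ μ, Complex.Gammaℝ (σ μ + z μ))⁻¹ *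
      (∏ μ, Complex.Gammaℝ (z μ + (1 - σ : ι → ℕ) μ))⁻¹ := fun z => by
    rw [Finset.prod_inv_distrib, ← mul_inv, ← Finset.prod_mul_distrib]
    congr 1
    exact Finset.prod_congr rfl fun μ _ => (Gammaℝ_mul_Gammaℝ_of_le_one (hσ μ) _).symm
  have hne' : ∀ (z : ι → ℂ), (∀ μ, 0 < (z μ).re) → ∏ μ, Complex.Gammaℝ (σ μ + z μ) ≠ 0 :=
    fun z hz => by simpa only [add_comm] using hne z hz σ
  rw [normMellinZ, normMellinZ, mellinZ_add_one _ hσ, mellinZ_add_one _ hσ, hG, hG]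
  have e1 := hne s hs0 (1 - σ)
  have e2 := hne _ hr0 (1 - σ)
  have e3 := hne' s hs0
  have e4 := hne' _ hr0
  have e5 : (∏ μ, Complex.I ^ σ μ) ≠ 0 :=
    Finset.prod_ne_zero_iff.2 fun μ _ => pow_ne_zero _ Complex.I_ne_zero
  rw [← hI] at hFE
  have e6 : (∏ μ, Complex.I ^ (1 - σ : ι → ℕ) μ) ≠ 0 :=
    Finset.prod_ne_zero_iff.2 fun μ _ => pow_ne_zero _ Complex.I_ne_zero
  generalize (∏ μ, Complex.I ^ (1 - σ : ι → ℕ) μ) = i1 at *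
  generalize (∏ μ, Complex.I ^ σ μ) = i2 at *
  generalize (∏ μ, Complex.Gammaℝ (s μ + (1 - σ : ι → ℕ) μ)) = x1 at *
  generalize (∏ μ, Complex.Gammaℝ (1 - s μ + (1 - σ : ι → ℕ) μ)) = x2 at *
  generalize (∏ μ, Complex.Gammaℝ (σ μ + s μ)) = x3 at *
  generalize (∏ μ, Complex.Gammaℝ (σ μ + (1 - s μ))) = x4 at *
  field_simp
  field_simp at hFE
  linear_combination hFE

/-- The functional equation persists for the entire continuations, away from the poles of the
Gamma factors. -/
theorem entire_functional_equation (g g' : SchwartzMap (ι → ℝ) ℂ)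
    (hg : ∀ ξ, g' ξ = Complex.I ^ Fintype.card ι * ∫ t, g t *
      Complex.exp (-2 * Real.pi * Complex.I * ∑ μ, (t μ * ξ μ : ℂ)))
    {σ : ι → ℕ} (hσ : ∀ μ, σ μ ≤ 1) {c : ℂ} {L L' : (ι → ℂ) → ℂ} (hL : Differentiable ℂ L)
    (hL' : Differentiable ℂ L')
    (hLs : ∀ s, (∀ μ, 0 < (s μ).re) → L s = c * normMellinZ g (σ + 1) s)
    (hLs' : ∀ s, (∀ μ, 0 < (s μ).re) → L' s = c * normMellinZ g' (σ + 1) s) {s : ι → ℂ}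
    (hs : ∏ μ, Complex.Gammaℝ (σ μ + s μ) ≠ 0)
    (hs' : ∏ μ, Complex.Gammaℝ (σ μ + (1 - s μ)) ≠ 0) :
    (∏ μ, Complex.Gammaℝ (σ μ + s μ)) * L s =
      (∏ μ, Complex.I ^ σ μ)⁻¹ * ((∏ μ, Complex.Gammaℝ (σ μ + (1 - s μ))) *
        L' (fun μ => 1 - s μ)) := by
  -- dividing by both Gamma factors turns the equation into one between entire functions
  have hd1 : Differentiable ℂ fun s : ι → ℂ =>
      L s * ∏ μ, (Complex.Gammaℝ (σ μ + (1 - s μ)))⁻¹ := by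
    refine hL.mul (differentiable_prod_comp_apply
      (f := fun μ z => (Complex.Gammaℝ (σ μ + (1 - z)))⁻¹) fun μ => ?_)
    exact Complex.differentiable_Gammaℝ_inv.comp (by fun_prop)
  have hd2 : Differentiable ℂ fun s : ι → ℂ =>
      (∏ μ, Complex.I ^ σ μ)⁻¹ * L' (fun μ => 1 - s μ) *
        ∏ μ, (Complex.Gammaℝ (σ μ + s μ))⁻¹ := by
    refine Differentiable.mul ((hL'.comp ?_).const_mul _) (differentiable_prod_comp_apply
      (f := fun μ z => (Complex.Gammaℝ (σ μ + z))⁻¹) fun μ => ?_)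
    · fun_prop
    · exact Complex.differentiable_Gammaℝ_inv.comp (by fun_prop)
  have hne : ∀ z : ι → ℂ, (∀ μ, 0 < (z μ).re) → ∏ μ, Complex.Gammaℝ (σ μ + z μ) ≠ 0 := fun z hz =>
    Finset.prod_ne_zero_iff.2 fun μ _ => Complex.Gammaℝ_ne_zero_of_re_pos (by
      have : (0 : ℝ) ≤ σ μ := Nat.cast_nonneg (σ μ)
      have := hz μ
      rw [Complex.add_re, Complex.natCast_re]
      linarith)
  have hU : {s : ι → ℂ | ∀ μ, 0 < (s μ).re} ∩ {s : ι → ℂ | ∀ μ, (s μ).re < 1} ∈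
      𝓝 (fun _ => (1 / 2 : ℂ) : ι → ℂ) := by
    have h2 : IsOpen {s : ι → ℂ | ∀ μ, (s μ).re < 1} := by
      simp only [Set.ofPred_forall]
      exact isOpen_iInter_of_finite fun μ =>
        isOpen_lt (Complex.continuous_re.comp (continuous_apply μ)) continuous_const
    refine ((isOpen_re_gt 0).inter h2).mem_nhds ⟨fun μ => ?_, fun μ => ?_⟩ <;> norm_num
  have hev : (fun s : ι → ℂ => L s * ∏ μ, (Complex.Gammaℝ (σ μ + (1 - s μ)))⁻¹)
      =ᶠ[𝓝 (fun _ => (1 / 2 : ℂ) : ι → ℂ)] fun s => (∏ μ, Complex.I ^ σ μ)⁻¹ *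
        L' (fun μ => 1 - s μ) * ∏ μ, (Complex.Gammaℝ (σ μ + s μ))⁻¹ := by
    filter_upwards [hU] with s hs
    have hr0 : ∀ μ, 0 < (1 - s μ).re := fun μ => by
      have := hs.2 μ
      rw [Complex.sub_re, Complex.one_re]
      linarith
    have h1 := normMellinZ_functional_equation g g' hg hσ hs.1 hs.2
    have e3 := hne s hs.1
    have e4 := hne _ hr0
    rw [hLs s hs.1, hLs' _ hr0, Finset.prod_inv_distrib, Finset.prod_inv_distrib]
    generalize (∏ μ, Complex.Gammaℝ (σ μ + s μ)) = x3 at *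
    generalize (∏ μ, Complex.Gammaℝ (σ μ + (1 - s μ))) = x4 at *
    field_simp
    linear_combination c * h1
  have h := eqOn_of_convex_of_eventuallyEq convex_univ isOpen_univ hd1.differentiableOn
    hd2.differentiableOn (Set.mem_univ _) hev (Set.mem_univ s)
  simp only [Finset.prod_inv_distrib] at h
  rw [← div_eq_mul_inv, ← div_eq_mul_inv, div_eq_div_iff hs' hs] at h
  linear_combination h

end

/-! ### The L-function of a function with a Schwartz transform -/

section

open Topology

variable {V : Type*} [AddCommGroup V] [Module ℚ V] {n : ℕ}

theorem continuous_schwartz_comp_linearEquiv {m : ℕ} (ε : RealPts V ≃ₗ[ℝ] (Fin m → ℝ))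
    (g : SchwartzMap (Fin m → ℝ) ℂ) : Continuous fun t => g (ε t) :=
  g.continuous.comp (IsModuleTopology.continuous_of_linearMap ε.toLinearMap)

theorem charFan_eq_linearCombination (r : FanOrientation n V) (B : Fan n V) (v : V) :
    charFan r B v = Finsupp.linearCombination ℤ (fun Λ => charCone r Λ v) B := rfl

variable [FiniteDimensional ℚ V]

theorem Represents.congr {f f' : V → ℂ} {G G' : RealPts (Dual ℚ V) → ℂ} (h : Represents f G)
    (hf : f = f') (hG : G = G') : Represents f' G' :=
  hf ▸ hG ▸ h

/-- Any Schwartz representative is the transform, by uniqueness. -/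
theorem transform_eq {f : V → ℂ} (ε : RealPts (Dual ℚ V) ≃ₗ[ℝ] (Fin n → ℝ))
    {g : SchwartzMap (Fin n → ℝ) ℂ} (h : Represents f fun t => g (ε t)) :
    transform f = fun t => g (ε t) := by
  obtain ⟨⟨m, ε', g', hg'⟩, hr⟩ := Classical.epsilon_spec
    (p := fun G : RealPts (Dual ℚ V) → ℂ => IsSchwartz G ∧ Represents f G)
    ⟨_, ⟨n, ε, g, fun _ => rfl⟩, h⟩
  refine Represents.unique hr h ?_ (continuous_schwartz_comp_linearEquiv ε g)
  rw [show transform f = fun t => g' (ε' t) from funext hg']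
  exact continuous_schwartz_comp_linearEquiv ε' g'

/-- The measure `dt_μ / t_μ` contributes a further sign, whence the exponents `σ + 1`. -/
theorem integrand_eq (σ : Fin n → Fin 2) {f : V → ℂ} {ρ : RealPts V ≃ₗ[ℝ] (Fin n → ℝ)}
    {g : SchwartzMap (Fin n → ℝ) ℂ} (h : Represents f fun t => g (dualIso ρ t)) (s : Fin n → ℂ)
    {t : Fin n → ℝ} (ht : ∀ μ, t μ ≠ 0) :
    integrand σ f ρ s t = g t * ∏ μ, homKernel (((fun μ => (σ μ : ℕ)) + 1 : Fin n → ℕ) μ)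
      (s μ) (t μ) := by
  rw [integrand, transform_eq _ h]
  beta_reduce
  rw [LinearEquiv.apply_symm_apply, signedPow, mul_assoc, ← Finset.prod_mul_distrib]
  congr 1
  refine Finset.prod_congr rfl fun μ _ => ?_
  have habs : ((|t μ| : ℝ) : ℂ) ≠ 0 := by exact_mod_cast abs_ne_zero.2 (ht μ)
  have htc : (t μ : ℂ) ≠ 0 := by exact_mod_cast ht μ
  have h2 : ((|t μ| : ℝ) : ℂ) * ((|t μ| : ℝ) : ℂ) = (t μ : ℂ) * t μ := by
    exact_mod_cast abs_mul_abs_self (t μ)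
  rw [homKernel, Complex.cpow_sub _ _ habs, Complex.cpow_one, Pi.add_apply, Pi.one_apply, pow_succ,
    Complex.ofReal_div]
  field_simp
  rw [sq, sq, h2]

theorem ae_eq_integrand (σ : Fin n → Fin 2) {f : V → ℂ} {ρ : RealPts V ≃ₗ[ℝ] (Fin n → ℝ)}
    {g : SchwartzMap (Fin n → ℝ) ℂ} (h : Represents f fun t => g (dualIso ρ t))
    (s : Fin n → ℂ) : (fun t => g t * ∏ μ, homKernel (((fun μ => (σ μ : ℕ)) + 1 : Fin n → ℕ) μ)
      (s μ) (t μ)) =ᵐ[volume] integrand σ f ρ s := by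
  filter_upwards [ae_forall_ne_zero] with t ht
  exact (integrand_eq σ h s ht).symm

theorem integralL_eq (σ : Fin n → Fin 2) {f : V → ℂ} {ρ : RealPts V ≃ₗ[ℝ] (Fin n → ℝ)}
    {g : SchwartzMap (Fin n → ℝ) ℂ} (h : Represents f fun t => g (dualIso ρ t))
    (s : Fin n → ℂ) :
    integralL σ f ρ s = 2 ^ n * normMellinZ g ((fun μ => (σ μ : ℕ)) + 1) s := by
  have h1 : (volume : Measure (Fin n → ℝ)).restrict {t : Fin n → ℝ | ∀ μ, t μ ≠ 0} = volume :=
    Measure.restrict_eq_self_of_ae_mem ae_forall_ne_zero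
  rw [integralL, h1, ← integral_congr_ae (ae_eq_integrand σ h s), normMellinZ, mellinZ,
    Finset.prod_inv_distrib]
  ring

/-- A function whose transform is Schwartz has a well-defined L-function. -/
theorem lSigma_wellDefined (σ : Fin n → Fin 2) {f : V → ℂ} {ρ : RealPts V ≃ₗ[ℝ] (Fin n → ℝ)}
    {g : SchwartzMap (Fin n → ℝ) ℂ} (h : Represents f fun t => g (dualIso ρ t)) :
    LSigmaWellDefined σ f ρ := by
  refine ⟨⟨_, ⟨n, dualIso ρ, g, fun _ => rfl⟩, h⟩, fun s hs => ?_, ?_⟩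
  · exact ((integrable_schwartz_mul_homKernel g _ hs).congr (ae_eq_integrand σ h s)).integrableOn
  · obtain ⟨G, hG, hGs⟩ := exists_entire_normMellinZ g ((fun μ => (σ μ : ℕ)) + 1)
    refine Classical.epsilon_spec (p := fun G => IsEntireContinuation (integralL σ f ρ) G)
      ⟨fun s => 2 ^ n * G s, hG.const_mul _, fun s hs => ?_⟩
    simp only [hGs s hs, integralL_eq σ h]

/-! ### Dual fans -/

theorem charFan_dualFan (hn : finrank ℚ V = n) (r : FanOrientation n V) (B : Fan n V)
    (v : Dual ℚ V) : charFan (r.dual hn) (dualFan hn B) v =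
      B.sum fun Λ c => c * charFan (r.dual hn) (dualCone hn Λ) v := by
  simp only [charFan_eq_linearCombination]
  rw [dualFan, map_finsuppSum]
  simp only [map_smul, smul_eq_mul]

/-- The basis formed by the generators of a simple cone. -/
def coneBasis (hn : finrank ℚ V = n) {Λ : Cone n V} (h : IsSimple Λ) : Basis (Fin n) ℚ V :=
  basisOfLinearIndependentOfCardEqFinrank' (fun j => (Λ j : V)) h (by rw [Fintype.card_fin, hn])

theorem coneBasis_apply (hn : finrank ℚ V = n) {Λ : Cone n V} (h : IsSimple Λ) (j : Fin n) :
    coneBasis hn h j = Λ j := by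
  exact congrFun (coe_basisOfLinearIndependentOfCardEqFinrank' _ h _) j

theorem dualCone_of_isSimple (hn : finrank ℚ V = n) {Λ : Cone n V} (h : IsSimple Λ) :
    dualCone hn Λ =
      Finsupp.single (fun j => ⟨(coneBasis hn h).dualBasis j, Basis.ne_zero _ j⟩) 1 :=
  dif_pos h

theorem mem_openCone_iff {W : Type*} [AddCommGroup W] [Module ℚ W] {b : Basis (Fin n) ℚ W}
    {Λ : Cone n W} (hb : ∀ j, b j = Λ j) (v : W) : v ∈ openCone Λ ↔ ∀ j, 0 < b.repr v j := by
  simp only [openCone, Set.mem_ofPred_eq, ← hb]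
  constructor
  · rintro ⟨t, ht, rfl⟩ j
    rw [Basis.repr_sum_self]
    exact ht j
  · intro h
    exact ⟨_, h, (b.sum_repr v).symm⟩

open Classical in
/-- The characteristic function of a simple cone, in coordinates. -/
theorem charCone_eq {W : Type*} [AddCommGroup W] [Module ℚ W] (r : FanOrientation n W)
    {b : Basis (Fin n) ℚ W} {Λ : Cone n W} (hb : ∀ j, b j = Λ j) (v : W) :
    charCone r Λ v = ((r.toFun b : SignType) : ℤ) * if ∀ j, 0 < b.repr v j then 1 else 0 := by
  have hs : IsSimple Λ := by
    have := b.linearIndependent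
    rwa [show (b : Fin n → W) = fun j => (Λ j : W) from funext hb] at this
  have hb' : (fun j => (Λ j : W)) = b := (funext hb).symm
  rw [charCone, hb']
  simp only [hs, true_and, mem_openCone_iff hb, mul_ite, mul_one, mul_zero]

open Classical in
theorem charFan_dualCone (hn : finrank ℚ V = n) (r : FanOrientation n V) {Λ : Cone n V}
    (h : IsSimple Λ) (v : Dual ℚ V) : charFan (r.dual hn) (dualCone hn Λ) v =
      ((r.toFun (coneBasis hn h) : SignType) : ℤ) *
        if ∀ j, 0 < (coneBasis hn h).dualBasis.repr v j then 1 else 0 := by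
  rw [dualCone_of_isSimple hn h, charFan, Finsupp.sum_single_index (by simp), one_mul,
    charCone_eq (r.dual hn) (b := (coneBasis hn h).dualBasis) (fun j => rfl),
    FanOrientation.dual_dualBasis]

/-- The cones of the dual fan are the duals of simple cones of the fan, some of
which may cancel. -/
theorem exists_of_mem_support_dualFan (hn : finrank ℚ V = n) {B : Fan n V}
    {Λ' : Cone n (Dual ℚ V)} (h : Λ' ∈ (dualFan hn B).support) :
    ∃ Λ ∈ B.support, ∃ hΛ : IsSimple Λ, ∀ j, (coneBasis hn hΛ).dualBasis j = Λ' j := by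
  classical
  obtain ⟨Λ, hΛ, h1⟩ := Finset.mem_biUnion.1 (Finsupp.support_sum h)
  have h2 := Finsupp.support_smul h1
  by_cases hs : IsSimple Λ
  · rw [dualCone_of_isSimple hn hs] at h2
    have h3 := Finset.mem_singleton.1 (Finsupp.support_single_subset h2)
    exact ⟨Λ, hΛ, hs, fun j => by rw [h3]⟩
  · rw [dualCone, dif_neg hs] at h2
    simp at h2

/-- Each cone of the fan contributes a Schwartz function to the transform of `Φ 𝔠(B)`, and its
Fourier transform, up to a power of `i`, to the transform on the dual side. -/
theorem exists_transform_pair_cone (hn : finrank ℚ V = n) (r : FanOrientation n V)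
    {ρ : RealPts V ≃ₗ[ℝ] (Fin n → ℝ)} {ν : Measure (AdelicPts V)} [ν.IsAddHaarMeasure]
    (hν : IsCompatible ρ ν) {Φ : AdelicPts V → ℂ} (hΦ : IsSchwartzBruhat Φ) (Λ : Cone n V)
    (hΛ : IsSimple Λ → ConditionP1 Φ Λ ∧ ConditionP2 Φ Λ) :
    ∃ g g' : SchwartzMap (Fin n → ℝ) ℂ,
      Represents (fun v : V => Φ (1 ⊗ₜ[ℚ] v) * (charCone r Λ v : ℂ)) (fun t => g (dualIso ρ t)) ∧
      Represents (fun v : Dual ℚ V => adelicFourier ν Φ (1 ⊗ₜ[ℚ] v) *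
        (charFan (r.dual hn) (dualCone hn Λ) v : ℂ)) (fun t => g' (dualIso (dualIso ρ) t)) ∧
      ∀ ξ, g' ξ = Complex.I ^ n *
        ∫ t, g t * Complex.exp (-2 * Real.pi * Complex.I * ∑ μ, (t μ * ξ μ : ℂ)) := by
  by_cases hs : IsSimple Λ
  · obtain ⟨N, hN, hstep⟩ := exists_isRegularStep hΦ (coneBasis_apply hn hs) (hΛ hs).1 (hΛ hs).2
    obtain ⟨g, g', h1, h2, h3⟩ := hstep.exists_transform_pair (by omega) hν
    set c : ℂ := ((r.toFun (coneBasis hn hs) : SignType) : ℂ) with hc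
    refine ⟨c • g, c • g', ?_, ?_, fun ξ => ?_⟩
    · refine (h1.smul c).congr (funext fun v => ?_) rfl
      rw [charCone_eq r (coneBasis_apply hn hs), Pi.smul_apply, smul_eq_mul, hc]
      push_cast
      ring
    · refine (h2.smul c).congr (funext fun v => ?_) rfl
      rw [charFan_dualCone hn r hs, Pi.smul_apply, smul_eq_mul, hc]
      push_cast
      ring
    · simp only [_root_.smul_apply, smul_eq_mul, mul_assoc]
      rw [h3, integral_const_mul, mul_left_comm]
      simp only [mul_assoc]
  · refine ⟨0, 0, ?_, ?_, by simp⟩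
    · refine Represents.zero.congr (funext fun v => ?_) rfl
      simp [charCone, hs]
    · refine Represents.zero.congr (funext fun v => ?_) rfl
      simp [dualCone, hs, charFan]

/-- The transforms of `Φ 𝔠(B)` and of the dual data are Schwartz functions which are Fourier
transforms of each other up to a power of `i`. -/
theorem exists_transform_pair_fan (hn : finrank ℚ V = n) (r : FanOrientation n V)
    {ρ : RealPts V ≃ₗ[ℝ] (Fin n → ℝ)} {ν : Measure (AdelicPts V)} [ν.IsAddHaarMeasure]
    (hν : IsCompatible ρ ν) {B : Fan n V} {Φ : AdelicPts V → ℂ} (hΦ : IsSchwartzBruhat Φ)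
    (hreg : IsRegularFor Φ B) :
    ∃ g g' : SchwartzMap (Fin n → ℝ) ℂ,
      Represents (fanFunction r Φ B) (fun t => g (dualIso ρ t)) ∧
      Represents (fanFunction (r.dual hn) (adelicFourier ν Φ) (dualFan hn B))
        (fun t => g' (dualIso (dualIso ρ) t)) ∧
      ∀ ξ, g' ξ = Complex.I ^ n *
        ∫ t, g t * Complex.exp (-2 * Real.pi * Complex.I * ∑ μ, (t μ * ξ μ : ℂ)) := by
  have key := fun Λ : B.support => exists_transform_pair_cone hn r hν hΦ Λ (hreg Λ Λ.2)
  choose g g' h1 h2 h3 using key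
  refine ⟨∑ Λ : B.support, (B Λ : ℂ) • g Λ, ∑ Λ : B.support, (B Λ : ℂ) • g' Λ, ?_, ?_, fun ξ => ?_⟩
  · refine (Represents.sum Finset.univ fun Λ _ => (h1 Λ).smul (B Λ : ℂ)).congr
      (funext fun v => ?_) (funext fun t => ?_)
    · symm
      rw [fanFunction, charFan, Finsupp.sum, ← Finset.sum_coe_sort, Finset.sum_apply]
      push_cast
      rw [Finset.mul_sum]
      refine Finset.sum_congr rfl fun Λ _ => ?_
      rw [Pi.smul_apply, smul_eq_mul]
      ring
    · simp [_root_.sum_apply]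
  · refine (Represents.sum Finset.univ fun Λ _ => (h2 Λ).smul (B Λ : ℂ)).congr
      (funext fun v => ?_) (funext fun t => ?_)
    · symm
      rw [fanFunction, charFan_dualFan, Finsupp.sum, ← Finset.sum_coe_sort, Finset.sum_apply]
      push_cast
      rw [Finset.mul_sum]
      refine Finset.sum_congr rfl fun Λ _ => ?_
      rw [Pi.smul_apply, smul_eq_mul]
      ring
    · simp [_root_.sum_apply]
  · have hI : ∀ Λ : B.support, Integrable fun t : Fin n → ℝ =>
        (B Λ : ℂ) * (g Λ t * Complex.exp (-2 * Real.pi * Complex.I * ∑ μ, (t μ * ξ μ : ℂ))) := by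
      intro Λ
      refine ((g Λ).integrable.mul_bdd (c := 1) ?_ (.of_forall fun t => ?_)).const_mul _
      · exact Continuous.aestronglyMeasurable (by fun_prop)
      · have h1 : -2 * Real.pi * Complex.I * ∑ μ, (t μ * ξ μ : ℂ) =
            ((-2 * Real.pi * ∑ μ, t μ * ξ μ : ℝ) : ℂ) * Complex.I := by
          push_cast
          ring
        rw [h1, Complex.norm_exp_ofReal_mul_I]
    simp only [_root_.sum_apply, _root_.smul_apply, smul_eq_mul, Finset.sum_mul, mul_assoc]
      at hI ⊢
    rw [integral_finsetSum _ fun Λ _ => hI Λ, Finset.mul_sum]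
    refine Finset.sum_congr rfl fun Λ _ => ?_
    rw [h3, integral_const_mul, mul_left_comm]
    simp only [mul_assoc]

end

end Shintani

end

open Shintani

theorem mainTheorem4 {V : Type*} [AddCommGroup V] [Module ℚ V] [FiniteDimensional ℚ V] {n : ℕ}
    (hn : finrank ℚ V = n) (r : FanOrientation n V) (ρ : RealPts V ≃ₗ[ℝ] (Fin n → ℝ))
    (ν : Measure (AdelicPts V)) [ν.IsAddHaarMeasure] (hν : IsCompatible ρ ν)
    (B : Fan n V) (Φ : AdelicPts V → ℂ) (hΦ : IsSchwartzBruhat Φ) (hreg : IsRegularFor Φ B)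
    (σ : Fin n → Fin 2) :
    (IsSchwartzBruhat (adelicFourier ν Φ) ∧ IsRegularFor (adelicFourier ν Φ) (dualFan hn B)) ∧
    LSigmaWellDefined σ (fanFunction r Φ B) ρ ∧
    LSigmaWellDefined σ (fanFunction (r.dual hn) (adelicFourier ν Φ) (dualFan hn B))
      (dualIso ρ) ∧
    ∀ s : Fin n → ℂ, NotPole σ s → NotPole σ (fun μ => 1 - s μ) →
      (GammaSigma σ s * LSigma σ (fanFunction r Φ B) ρ s =
        (iSigma σ)⁻¹ * GammaSigma σ (fun μ => 1 - s μ) *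
          LSigma σ (fanFunction (r.dual hn) (adelicFourier ν Φ) (dualFan hn B)) (dualIso ρ)
            (fun μ => 1 - s μ)) ∧
      (LHatSigma σ (fanFunction r Φ B) ρ s =
        (iSigma σ)⁻¹ *
          LHatSigma σ (fanFunction (r.dual hn) (adelicFourier ν Φ) (dualFan hn B)) (dualIso ρ)
            (fun μ => 1 - s μ)) := by
  obtain ⟨g, g', h1, h2, h3⟩ := exists_transform_pair_fan hn r hν hΦ hreg
  have w1 := lSigma_wellDefined σ h1
  have w2 := lSigma_wellDefined σ h2
  refine ⟨⟨?_, ?_⟩, w1, w2, fun s hs hs' => ?_⟩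
  · obtain ⟨N, hN, hstep⟩ := hΦ.exists_isStepFun (finBasisOfFinrankEq ℚ V hn)
    have hN0 : N ≠ 0 := by omega
    exact (hstep.adelicFourier hN0 ν).isSchwartzBruhat hN0
  · intro Λ' hΛ' _
    obtain ⟨Λ, hΛ, hsimple, hb⟩ := exists_of_mem_support_dualFan hn hΛ'
    obtain ⟨N, hN, hstep⟩ := exists_isRegularStep hΦ (coneBasis_apply hn hsimple)
      (hreg Λ hΛ hsimple).1 (hreg Λ hΛ hsimple).2
    have hN0 : N ≠ 0 := by omega
    exact ⟨(hstep.adelicFourier hN0 ν).conditionP1 hb,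
      (hstep.adelicFourier hN0 ν).conditionP2 hN0 hb⟩
  · have hne : ∀ z : Fin n → ℂ, NotPole σ z → ∏ μ, Complex.Gammaℝ (((σ μ : ℕ) : ℂ) + z μ) ≠ 0 :=
      fun z hz => Finset.prod_ne_zero_iff.2 fun μ _ h0 => by
        obtain ⟨k, hk⟩ := Complex.Gammaℝ_eq_zero_iff.1 h0
        exact hz μ k hk
    have h := entire_functional_equation g g' (σ := fun μ => (σ μ : ℕ))
      (by rwa [Fintype.card_fin]) (fun μ => Nat.lt_succ_iff.1 (σ μ).2) w1.2.2.1 w2.2.2.1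
      (fun z hz => (w1.2.2.2 z hz).trans (integralL_eq σ h1 z))
      (fun z hz => (w2.2.2.2 z hz).trans (integralL_eq σ h2 z)) (hne s hs) (hne _ hs')
    exact ⟨h.trans (mul_assoc _ _ _).symm, h⟩
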